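/- **Theorem (existence of a conjugating chart map for the unstable manifold).** Let $X$ be a complex Banach space (for instance a Banach algebra, with $G$ given by a convergent power series $G(x)=\sum_{j} g_j * x^{*j}$, $g_j\in X$). Let $A\colon D(A)\subset X\to X$ be sectorial: closed, densely defined, and such that for some $\omega\in\mathbb R$, $\varphi\in(\pi/2,\pi)$, $M>0$ every $z\neq\omega$ with $|\arg(z-\omega)|<\varphi$ lies in the resolvent set of $A$ and $\|(z-A)^{-1}\|\le M/|z-\omega|$. Assume that $A$ has compact resolvent. Let $G\colon X\to X$ be analytic in a neighbourhood of a point $\tilde x\in D(A)$, let $F(x)=Ax+G(x)$, and suppose $F(\tilde x)=0$. (The normal form $x'=Ax+N(x)$ with $\tilde x=0$ and $N$ analytic near $0$ with $N(0)=0$, $DN(0)=0$ is a special case.) Assume: * (hyperbolicity) $DF(\tilde x)=A+DG(\tilde x)$, with domain $D(A)$, has no eigenvalue on the imaginary axis; * the eigenvalues of $DF(\tilde x)$ with positive real part are exactly $\lambda_1,\dots,\lambda_d$; these are real, pairwise distinct, and each has algebraic multiplicity one; * (non-resonance) $m_1\lambda_1+\dots+m_d\lambda_d\neq\lambda_j$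 for all $1\le j\le d$ and all $m\in\mathbb N^d$ with $|m|=m_1+\dots+m_d\ge 2$. Let $\xi_1,\dots,\xi_d$ be eigenvectors of unit norm, $DF(\tilde x)\xi_j=\lambda_j\xi_j$, let $A_u=\operatorname{diag}(\lambda_1,\dots,\lambda_d)$, and let $B_1=\{\theta\in\mathbb C^d : |\theta_j|<1,\ 1\le j\le d\}$. Then there is a $\delta>0$ such that for all real $s_1,\dots,s_d$ with $\max_j|s_j|\le\delta$ there is a unique analytic map $P\colon B_1\to X$ with values in $D(A)$ satisfying $$P(0)=\tilde x,\qquad \frac{\partial P}{\partial\theta_j}(0)=s_j\xi_j\quad(1\le j\le d),$$ and the invariance equation $$F(P(\theta))=DP(\theta)A_u\theta\qquad\text{for all }\theta\in B_1 .$$ If moreover all $s_j\neq 0$, then $P(B_1)$ is a local unstable manifold at $\tilde x$ with chart map $P$: the map $P$ is an immersion and a homeomorphism onto its image, and there is an open neighbourhood $U$ of $\tilde x$ such that $P(B_1)$ is the set of all points $a(0)$, where $a\colon(-\infty,0]\to U\cap D(A)$ is a differentiable solution of $a'=F(a)$ with $\lim_{t\to-\infty}a(t)=\tilde x$. Finally,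 $P$ is real if the data are: if $\sigma\colon X\to X$ is a bounded conjugate-linear involution with $\sigma\tilde x=\tilde x$, $\sigma\xi_j=\xi_j$, $\sigma D(A)\subseteq D(A)$, $\sigma A=A\sigma$ on $D(A)$, and $\sigma G=G\sigma$ near $\tilde x$, then $P(\bar\theta)=\sigma(P(\theta))$ on $B_1$; in particular $P$ maps $B_1\cap\mathbb R^d$ into the real subspace $\{x:\sigma x=x\}$. -/

import Mathlib

open Set Filter Topology

noncomputable section

namespace UnstableChart

section Operators

variable {X : Type*} [NormedAddCommGroup X] [NormedSpace ℂ X]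

/-- `R` is the (bounded, everywhere defined) resolvent operator `(z - A)⁻¹` of the unbounded
operator `A` at the point `z`; `z` is in the resolvent set of `A` iff such an `R` exists. -/
def IsResolventAt (A : X →ₗ.[ℂ] X) (z : ℂ) (R : X →L[ℂ] X) : Prop :=
  (∀ x : X, ∃ h : R x ∈ A.domain, z • R x - A ⟨R x, h⟩ = x) ∧
    ∀ x : A.domain, R (z • (x : X) - A x) = x

/-- Sectorial operators, with the sign convention for which `A` (and not `-A`) generates an
analytic semigroup: `A` is closed and densely defined, the sector of half-angle `φ > π / 2` around
the half-line `[ω, ∞)` with its vertex `ω` removed lies in the resolvent set, and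
`‖(z - A)⁻¹‖ ≤ M / |z - ω|` there. -/
def IsSectorial (A : X →ₗ.[ℂ] X) : Prop :=
  A.IsClosed ∧ Dense (A.domain : Set X) ∧
    ∃ (ω φ M : ℝ), Real.pi / 2 < φ ∧ φ < Real.pi ∧ 0 < M ∧
      ∀ z : ℂ, z ≠ ω → |Complex.arg (z - ω)| < φ →
        ∃ R : X →L[ℂ] X, IsResolventAt A z R ∧ ‖R‖ ≤ M / ‖z - ω‖

/-- `A` has compact resolvent: some resolvent operator of `A` exists and is compact (by the
resolvent identity all of them then are). -/
def HasCompactResolvent (A : X →ₗ.[ℂ] X) : Prop :=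
  ∃ (z : ℂ) (R : X →L[ℂ] X), IsResolventAt A z R ∧ IsCompactOperator R

/-- The linearization `DF(x₀) = A + DG(x₀)` of `F(x) = A x + G(x)`, an unbounded operator with the
same domain as `A`. -/
def linearization (A : X →ₗ.[ℂ] X) (G : X → X) (x₀ : X) : X →ₗ.[ℂ] X :=
  (fderiv ℂ G x₀ : X →ₗ[ℂ] X) +ᵥ A

/-- `z` is an eigenvalue of `L`. -/
def IsEigenvalue (L : X →ₗ.[ℂ] X) (z : ℂ) : Prop :=
  ∃ v : L.domain, v ≠ 0 ∧ L v = z • (v : X)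

/-- The kernel of `(L - z)ⁿ`, on its natural domain:
`ker (L - z)ⁿ⁺¹ = {x ∈ D(L) | (L - z) x ∈ ker (L - z)ⁿ}`. -/
def kerPow (L : X →ₗ.[ℂ] X) (z : ℂ) : ℕ → Submodule ℂ X
  | 0 => ⊥
  | n + 1 => ((kerPow L z n).comap (L.toFun - z • L.domain.subtype)).map L.domain.subtype

/-- The algebraic multiplicity of `z` as an eigenvalue of `L`: the dimension of the generalized
eigenspace `⋃ₙ ker (L - z)ⁿ` (with value `0` if that is infinite-dimensional). -/
def algMultiplicity (L : X →ₗ.[ℂ] X) (z : ℂ) : ℕ :=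
  Module.finrank ℂ (⨆ n, kerPow L z n : Submodule ℂ X)

end Operators

/-- Non-resonance: `m₁ λ₁ + ⋯ + m_d λ_d ≠ λ_j` for all `j` and all multi-indices `|m| ≥ 2`. -/
def NonResonant {d : ℕ} (lam : Fin d → ℂ) : Prop :=
  ∀ m : Fin d → ℕ, 2 ≤ ∑ i, m i → ∀ j, ∑ i, (m i : ℂ) * lam i ≠ lam j

/-- The open unit polydisk in `ℂᵈ`. -/
def polydisk (d : ℕ) : Set (Fin d → ℂ) := {θ | ∀ j, ‖θ j‖ < 1}

section Dynamics

variable {X : Type*} [NormedAddCommGroup X] [NormedSpace ℂ X]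

/-- `P` is an analytic map on the unit polydisk with `P(0) = x₀`, `∂P/∂θ_j(0) = s_j ξ_j`, which
takes values in the domain of `F = A + G` and solves the invariance equation
`F(P(θ)) = DP(θ) A_u θ`, where `A_u = diag(λ₁, …, λ_d)`. -/
structure SolvesInvarianceEq (A : X →ₗ.[ℂ] X) (G : X → X) (x₀ : X) {d : ℕ}
    (lam : Fin d → ℝ) (ξ : Fin d → X) (s : Fin d → ℝ) (P : (Fin d → ℂ) → X) : Prop where
  analytic : AnalyticOnNhd ℂ P (polydisk d)
  map_zero : P 0 = x₀
  deriv_zero : ∀ j, fderiv ℂ P 0 (Pi.single j 1) = (s j : ℂ) • ξ j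
  invariance : ∀ θ ∈ polydisk d, ∃ h : P θ ∈ A.domain,
    A ⟨P θ, h⟩ + G (P θ) = fderiv ℂ P θ (fun j => (lam j : ℂ) * θ j)

/-- `a` restricted to `(-∞, 0]` is a (classical) solution of `x' = A x + G(x)`. -/
def IsBackwardSolution (A : X →ₗ.[ℂ] X) (G : X → X) (a : ℝ → X) : Prop :=
  ∀ t ≤ 0, ∃ h : a t ∈ A.domain, HasDerivWithinAt a (A ⟨a t, h⟩ + G (a t)) (Iic 0) t

/-- The local unstable set of `x₀` relative to `U`: the points through which there is a backward
solution that stays in `U` for all `t ≤ 0` and converges to `x₀` as `t → -∞`. -/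
def localUnstableSet (A : X →ₗ.[ℂ] X) (G : X → X) (x₀ : X) (U : Set X) : Set X :=
  {x | ∃ a : ℝ → X, IsBackwardSolution A G a ∧ a 0 = x ∧ (∀ t ≤ 0, a t ∈ U) ∧
    Tendsto a atBot (𝓝 x₀)}

/-- The image of the polydisk under `P` is a local unstable manifold at `x₀`, and `P` is a
(global) chart map for it: `P` is an immersion and a homeomorphism onto its image, and the
image is the local unstable set of `x₀` relative to some open neighbourhood `U` of `x₀`. -/
structure IsLocalUnstableManifoldChart (A : X →ₗ.[ℂ] X) (G : X → X) (x₀ : X) {d : ℕ}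
    (P : (Fin d → ℂ) → X) : Prop where
  immersion : ∀ θ ∈ polydisk d, Function.Injective (fderiv ℂ P θ)
  embedding : IsEmbedding ((polydisk d).domRestrict P)
  image_eq : ∃ U : Set X, IsOpen U ∧ x₀ ∈ U ∧ P '' polydisk d = localUnstableSet A G x₀ U

/-- `σ` is a conjugation of `X` (a bounded conjugate-linear involution; its fixed points form a
real Banach space with complexification `X`) under which `A`, `G` (near `x₀`), the
equilibrium `x₀` and the vectors `ξ_j` are real. -/
structure IsRealStructure (A : X →ₗ.[ℂ] X) (G : X → X) (x₀ : X) {d : ℕ}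
    (ξ : Fin d → X) (σ : X →SL[starRingEnd ℂ] X) : Prop where
  involutive : ∀ x, σ (σ x) = x
  map_op : ∀ x : A.domain, ∃ h : σ x ∈ A.domain, A ⟨σ x, h⟩ = σ (A x)
  map_nonlinearity : ∀ᶠ x in 𝓝 x₀, G (σ x) = σ (G x)
  map_equilibrium : σ x₀ = x₀
  map_eigenvector : ∀ j, σ (ξ j) = ξ j

end Dynamics

end UnstableChart

end

/-!
Write `L = A + B`, `B = DG(x₀)`, for the linearization and `N(x) = G(x₀ + x) - G(x₀) - B x`. For
`P = x₀ + Σₙ bₙ θⁿ` the invariance equation says `(⟨n, λ⟩ - L) bₙ = N(b)ₙ`, where `N(b)` denotes the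
power series of `N ∘ Σ bₙ θⁿ`.

*Existence and uniqueness.* The coefficients live in `ℓ¹(ℕᵈ; X)`, on which `N` acts as a map with
vanishing derivative at `0` (`exists_nonlinear_extension`). The `λ_j` are the only eigenvalues of `L`
in the right half-plane, so non-resonance makes `⟨n, λ⟩ - L` invertible for `|n| ≥ 2`; since
`⟨n, λ⟩ → ∞`, sectoriality bounds the inverses (`exists_resolvent_wt`). Hence the coefficient equation
is a fixed point equation near the identity, uniquely solvable in a small ball of `ℓ¹` for small first
order coefficients (`exists_isFormalSolution`). After halving the variables `θ`, the term `⟨n, λ⟩ bₙ`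
is summable too, and the coefficient equation and the invariance equation are equivalent
(`forall_coeff_iff`). Any other solution has, in sufficiently shrunk variables, an expansion in the
same small ball, so its germ at `0` is determined by its first order coefficients; the identity theorem
then applies on the polydisk. Reality follows by applying uniqueness to `σ ∘ P ∘ conj`.

*The image is the local unstable set.* `P` carries the linear flow `e^{Λt} θ` to backward solutions, so
one has to show that a backward solution close to `x₀` is determined by the unstable components
`l_j` of its final value. Subtracting `2 λ_j` on the unstable eigenvectors turns `L` into an operator
without spectrum in the closed right half-plane (`exists_dual_family`). Its resolvent is defined, and
`O(1 / |z|)`, to the right of a hyperbola in the left half-plane, so the integral of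
`e^{tz} (z - L)⁻¹` along this hyperbola gives a semigroup whose norm is integrable on `(0, ∞)`. Hence a
bounded backward solution of the inhomogeneous equation is bounded by the forcing
(`IsStableResolvent.norm_le_of_backward_solution`), and the difference of two backward solutions with
the same unstable components is at most half of any bound for it (`exists_backward_unique`). Finally
`θ ↦ (l_j (P θ - x₀))_j` is a local diffeomorphism, which makes `P` an immersion and an embedding and
singles out the neighbourhood `U` (`exists_isLocalUnstableManifoldChart`).
-/

namespace UnstableChart

/-! ### Resolvents of perturbed operators -/

section Resolvents

variable {X : Type*} [NormedAddCommGroup X] [NormedSpace ℂ X]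

/-- The resolvent of a bounded perturbation `B + A` at `z`, from a resolvent `K` of `A` at `μ`:
`z - (B + A) = (1 - (B + (μ - z)) K) (μ - A)`. -/
lemma IsResolventAt.perturb {A : X →ₗ.[ℂ] X} {μ : ℂ} {K : X →L[ℂ] X} (hK : IsResolventAt A μ K)
    (B : X →L[ℂ] X) (z : ℂ) {U : X →L[ℂ] X}
    (h1 : (1 - (B + (μ - z) • 1) * K) * U = 1) (h2 : U * (1 - (B + (μ - z) • 1) * K) = 1) :
    IsResolventAt ((B : X →ₗ[ℂ] X) +ᵥ A) z (K * U) := by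
  refine ⟨fun x => ?_, fun x => ?_⟩
  · obtain ⟨h, he⟩ := hK.1 (U x)
    refine ⟨h, ?_⟩
    have e1 : U x - (B (K (U x)) + (μ - z) • K (U x)) = x := by
      simpa using congrArg (fun T : X →L[ℂ] X => T x) h1
    rw [LinearPMap.vadd_apply]
    change z • K (U x) - (B (K (U x)) + A ⟨K (U x), h⟩) = x
    rw [eq_sub_of_add_eq' (sub_eq_iff_eq_add.1 he).symm]
    refine Eq.trans ?_ e1
    module
  · have hx : (x : X) ∈ A.domain := x.2
    have e1 := hK.2 ⟨x, hx⟩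
    set v := μ • (x : X) - A ⟨x, hx⟩ with hv
    have e2 : U (v - (B (K v) + (μ - z) • K v)) = v := by
      simpa using congrArg (fun T : X →L[ℂ] X => T v) h2
    rw [LinearPMap.vadd_apply]
    change K (U (z • (x : X) - (B x + A ⟨x, hx⟩))) = x
    have e3 : z • (x : X) - (B x + A ⟨x, hx⟩) = v - (B (K v) + (μ - z) • K v) := by
      have e1' : K v = x := e1
      rw [e1', hv]; module
    rw [e3, e2]; exact e1

/-- The resolvent identity. -/
lemma IsResolventAt.sub_eq {A : X →ₗ.[ℂ] X} {z z' : ℂ} {R R' : X →L[ℂ] X}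
    (hR : IsResolventAt A z R) (hR' : IsResolventAt A z' R') :
    R' - R = (z - z') • (R' * R) := by
  ext x
  obtain ⟨h, he⟩ := hR.1 x
  have h2 := hR'.2 ⟨R x, h⟩
  have h3 : z' • R x - A ⟨R x, h⟩ = x - (z - z') • R x := by
    rw [eq_sub_of_add_eq' (sub_eq_iff_eq_add.1 he).symm]
    module
  simp only [h3, map_sub, map_smul] at h2
  simp only [sub_apply, smul_apply,
    mul_apply_eq_comp]
  nth_rewrite 1 [← h2]
  abel

/-- `R(z) x = (x + R(z) (A - p) x) / (z - p)` for `x` in the domain, without division. -/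
lemma IsResolventAt.apply_domain {A : X →ₗ.[ℂ] X} {z : ℂ} {R : X →L[ℂ] X}
    (hR : IsResolventAt A z R) (p : ℂ) (x : A.domain) :
    (z - p) • R x = x + R (A x - p • (x : X)) := by
  have := hR.2 x
  simp only [map_sub, map_smul] at this ⊢
  nth_rewrite 2 [← this]
  module

lemma zero_vadd_linearPMap (A : X →ₗ.[ℂ] X) : ((0 : X →L[ℂ] X) : X →ₗ[ℂ] X) +ᵥ A = A := by
  simp

variable [CompleteSpace X]

/-- Neumann series: `1 - T` is invertible with inverse of norm at most `2` if `‖T‖ ≤ 1 / 2`. -/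
lemma exists_inverse_one_sub (T : X →L[ℂ] X) (hT : ‖T‖ ≤ 1 / 2) :
    ∃ U : X →L[ℂ] X, (1 - T) * U = 1 ∧ U * (1 - T) = 1 ∧ ‖U‖ ≤ 2 := by
  have hT' : ‖T‖ < 1 := by linarith
  refine ⟨∑' n : ℕ, T ^ n, mul_neg_geom_series T hT', geom_series_mul_neg T hT', ?_⟩
  have h := tsum_geometric_le_of_norm_lt_one T hT'
  have h1 : ‖(1 : X →L[ℂ] X)‖ ≤ 1 := ContinuousLinearMap.norm_id_le
  have h2 : (1 - ‖T‖)⁻¹ ≤ 2 := by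
    rw [inv_le_comm₀ (by linarith) (by norm_num)]; linarith
  linarith

/-- Quantitative stability of the resolvent under small perturbations. -/
lemma IsResolventAt.perturb_small {A : X →ₗ.[ℂ] X} {μ : ℂ} {K : X →L[ℂ] X}
    (hK : IsResolventAt A μ K) (B : X →L[ℂ] X) (z : ℂ) (h : (‖B‖ + ‖μ - z‖) * ‖K‖ ≤ 1 / 2) :
    ∃ R, IsResolventAt ((B : X →ₗ[ℂ] X) +ᵥ A) z R ∧ ‖R‖ ≤ 2 * ‖K‖ := by
  have hB : ‖(B + (μ - z) • (1 : X →L[ℂ] X)) * K‖ ≤ 1 / 2 := by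
    refine (norm_mul_le _ _).trans (le_trans ?_ h)
    gcongr
    refine (norm_add_le _ _).trans ?_
    gcongr
    refine (norm_smul_le (μ - z) (1 : X →L[ℂ] X)).trans ?_
    exact mul_le_of_le_one_right (norm_nonneg _) ContinuousLinearMap.norm_id_le
  obtain ⟨U, h1, h2, h3⟩ := exists_inverse_one_sub _ hB
  refine ⟨K * U, hK.perturb B z h1 h2, (norm_mul_le _ _).trans ?_⟩
  nlinarith [norm_nonneg K]

lemma IsResolventAt.exists_near {A : X →ₗ.[ℂ] X} {μ : ℂ} {K : X →L[ℂ] X}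
    (hK : IsResolventAt A μ K) (z : ℂ) (h : ‖μ - z‖ * ‖K‖ ≤ 1 / 2) :
    ∃ R, IsResolventAt A z R ∧ ‖R‖ ≤ 2 * ‖K‖ := by
  have := hK.perturb_small 0 z (by simpa using h)
  rwa [zero_vadd_linearPMap] at this

/-- The Fredholm alternative: if `A` has compact resolvent, then every point that is not an
eigenvalue of the bounded perturbation `B + A` lies in its resolvent set. -/
lemma exists_resolvent_of_not_isEigenvalue {A : X →ₗ.[ℂ] X} (hA : HasCompactResolvent A)
    (B : X →L[ℂ] X) {z : ℂ} (hz : ¬ IsEigenvalue ((B : X →ₗ[ℂ] X) +ᵥ A) z) :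
    ∃ R, IsResolventAt ((B : X →ₗ[ℂ] X) +ᵥ A) z R := by
  obtain ⟨μ, K, hK, hKc⟩ := hA
  set C : X →L[ℂ] X := (B + (μ - z) • 1) * K with hC
  have hCc : IsCompactOperator C := by
    simpa [hC] using! hKc.clm_comp (B + (μ - z) • 1)
  rcases hCc.hasEigenvalue_or_mem_resolventSet (μ := (1 : ℂ)) one_ne_zero with h | h
  · exfalso
    obtain ⟨v, hv⟩ := h.exists_hasEigenvector
    have hv1 : B (K v) + (μ - z) • K v = v := by simpa [hC] using hv.apply_eq_smul
    obtain ⟨h, he⟩ := hK.1 v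
    refine hz ⟨⟨K v, h⟩, ?_, ?_⟩
    · intro h0
      have h0' : K v = 0 := congrArg Subtype.val h0
      rw [h0'] at hv1
      exact hv.2 (by simpa using hv1.symm)
    · rw [LinearPMap.vadd_apply]
      change B (K v) + A ⟨K v, h⟩ = z • K v
      rw [eq_sub_of_add_eq' (sub_eq_iff_eq_add.1 he).symm]
      nth_rewrite 3 [← hv1]
      module
  · have hu : IsUnit (1 - C) := by
      have := spectrum.mem_resolventSet_iff.1 h
      simpa using this
    obtain ⟨u, hu⟩ := hu
    refine ⟨K * (↑u⁻¹ : X →L[ℂ] X), hK.perturb B z ?_ ?_⟩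
    · rw [← hC, ← hu, Units.mul_inv]
    · rw [← hC, ← hu, Units.inv_mul]

/-- A bounded perturbation of a sectorial operator has its resolvent in the part of the closed right
half-plane outside of a disk, and it decays there like `1 / |z|`. -/
lemma IsSectorial.exists_resolvent_far {A : X →ₗ.[ℂ] X} (hA : IsSectorial A) (B : X →L[ℂ] X) :
    ∃ ρ C : ℝ, 0 < ρ ∧ 0 < C ∧ ∀ z : ℂ, 0 ≤ z.re → ρ ≤ ‖z‖ →
      ∃ R, IsResolventAt ((B : X →ₗ[ℂ] X) +ᵥ A) z R ∧ ‖R‖ ≤ C / ‖z‖ := by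
  obtain ⟨-, -, ω, φ, M, hφ, hφ', hM, h⟩ := hA
  have hcos : Real.cos φ < 0 := Real.cos_neg_of_pi_div_two_lt_of_lt hφ (by linarith)
  set q := -Real.cos φ with hq
  have hq0 : 0 < q := by linarith
  refine ⟨2 * |ω| + 2 * (|ω| / q + 1) + 2 * (2 * M * ‖B‖), 4 * M, by positivity, by positivity,
    fun z hz hzρ => ?_⟩
  have hnn : (0 : ℝ) ≤ |ω| / q := by positivity
  have hMB : 0 ≤ 2 * M * ‖B‖ := by positivity
  have hω : ‖(ω : ℂ)‖ = |ω| := by simp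
  have hzω : ‖z‖ / 2 ≤ ‖z - ω‖ := by
    have := norm_sub_norm_le z (ω : ℂ)
    rw [hω] at this
    linarith
  have hz0 : 0 < ‖z‖ := by
    have := abs_nonneg ω
    linarith
  have hpos : 0 < ‖z - ω‖ := by linarith
  have hne : z - ω ≠ 0 := norm_pos_iff.1 hpos
  have harg : |Complex.arg (z - ω)| < φ := by
    have h1 : Real.cos φ < Real.cos |Complex.arg (z - ω)| := by
      rw [Real.cos_abs, Complex.cos_arg hne, lt_div_iff₀ hpos]
      have h2 : (z - ω).re = z.re - ω := by simp
      rw [h2]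
      have h3 : |ω| < ‖z - ω‖ * q := by
        rw [← div_lt_iff₀ hq0]
        have := abs_nonneg ω
        linarith
      have := le_abs_self ω
      nlinarith
    by_contra hcon
    push Not at hcon
    have := Real.cos_le_cos_of_nonneg_of_le_pi (by linarith [Real.pi_pos]) (Complex.abs_arg_le_pi _)
      hcon
    linarith
  obtain ⟨K, hK, hKn⟩ := h z (sub_ne_zero.1 hne) harg
  have hKn' : ‖K‖ ≤ 2 * M / ‖z‖ := by
    refine hKn.trans ?_
    rw [div_le_div_iff₀ hpos hz0]
    nlinarith
  obtain ⟨R, hR, hRn⟩ := hK.perturb_small B z (by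
    simp only [sub_self, norm_zero, add_zero]
    calc ‖B‖ * ‖K‖ ≤ ‖B‖ * (2 * M / ‖z‖) := by gcongr
      _ ≤ 1 / 2 := by
        rw [mul_div_assoc', div_le_iff₀ hz0]
        have := abs_nonneg ω
        linarith)
  refine ⟨R, hR, hRn.trans ?_⟩
  calc 2 * ‖K‖ ≤ 2 * (2 * M / ‖z‖) := by gcongr
    _ = 4 * M / ‖z‖ := by ring

/-- The resolvent is bounded on compact subsets of the resolvent set. -/
lemma exists_resolvent_bound_of_isCompact {L : X →ₗ.[ℂ] X} {s : Set ℂ} (hs : IsCompact s)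
    (h : ∀ z ∈ s, ∃ R, IsResolventAt L z R) :
    ∃ C : ℝ, 0 < C ∧ ∀ z ∈ s, ∃ R, IsResolventAt L z R ∧ ‖R‖ ≤ C := by
  refine hs.induction_on (p := fun s => ∃ C : ℝ, 0 < C ∧
    ∀ z ∈ s, ∃ R, IsResolventAt L z R ∧ ‖R‖ ≤ C) ⟨1, one_pos, by simp⟩ ?_ ?_ ?_
  · rintro s t hst ⟨C, hC, H⟩
    exact ⟨C, hC, fun z hz => H z (hst hz)⟩
  · rintro s t ⟨C, hC, H⟩ ⟨D, hD, H'⟩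
    refine ⟨max C D, lt_max_of_lt_left hC, ?_⟩
    rintro z (hz | hz)
    · obtain ⟨R, hR, hn⟩ := H z hz
      exact ⟨R, hR, hn.trans (le_max_left _ _)⟩
    · obtain ⟨R, hR, hn⟩ := H' z hz
      exact ⟨R, hR, hn.trans (le_max_right _ _)⟩
  · intro z hz
    obtain ⟨K, hK⟩ := h z hz
    refine ⟨Metric.ball z (1 / (2 * (‖K‖ + 1))), mem_nhdsWithin_of_mem_nhds
      (Metric.ball_mem_nhds _ (by positivity)), 2 * (‖K‖ + 1), by positivity, fun z' hz' => ?_⟩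
    obtain ⟨R, hR, hn⟩ := hK.exists_near z' (by
      rw [Metric.mem_ball, dist_comm, dist_eq_norm] at hz'
      calc ‖z - z'‖ * ‖K‖ ≤ 1 / (2 * (‖K‖ + 1)) * (‖K‖ + 1) := by gcongr; linarith
        _ = 1 / 2 := by field_simp)
    exact ⟨R, hR, by linarith⟩

/-- The resolvent set of `L` contains the region to the right of the wedge
`Re z = -κ (1 + |Im z|)`, and the resolvent is bounded by `C / (1 + |z|)` there. -/
def HasStableResolvent (L : X →ₗ.[ℂ] X) (κ C : ℝ) : Prop :=
  ∀ z : ℂ, -(κ * (1 + |z.im|)) ≤ z.re → ∃ R, IsResolventAt L z R ∧ ‖R‖ ≤ C / (1 + ‖z‖)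

lemma exists_hasStableResolvent {A : X →ₗ.[ℂ] X} (hA : IsSectorial A)
    (hAc : HasCompactResolvent A) (B : X →L[ℂ] X)
    (h : ∀ z : ℂ, 0 ≤ z.re → ¬ IsEigenvalue ((B : X →ₗ[ℂ] X) +ᵥ A) z) :
    ∃ κ C : ℝ, 0 < κ ∧ 0 < C ∧ HasStableResolvent ((B : X →ₗ[ℂ] X) +ᵥ A) κ C := by
  obtain ⟨ρ, C₁, hρ, hC₁, far⟩ := hA.exists_resolvent_far B
  obtain ⟨C₂, hC₂, near⟩ := exists_resolvent_bound_of_isCompact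
    (L := (B : X →ₗ[ℂ] X) +ᵥ A) (s := Metric.closedBall 0 ρ ∩ {z : ℂ | 0 ≤ z.re})
    ((isCompact_closedBall _ _).inter_right (isClosed_le continuous_const Complex.continuous_re))
    (fun z hz => exists_resolvent_of_not_isEigenvalue hAc B (h z hz.2))
  -- the bound on the closed right half-plane
  obtain ⟨D, hD, right⟩ : ∃ D : ℝ, 0 < D ∧ ∀ z : ℂ, 0 ≤ z.re →
      ∃ R, IsResolventAt ((B : X →ₗ[ℂ] X) +ᵥ A) z R ∧ ‖R‖ ≤ D / (1 + ‖z‖) := by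
    refine ⟨C₁ * (1 / ρ + 1) + C₂ * (1 + ρ), by positivity, fun z hz => ?_⟩
    rcases le_total ρ ‖z‖ with hzρ | hzρ
    · obtain ⟨R, hR, hn⟩ := far z hz hzρ
      have hz0 : 0 < ‖z‖ := hρ.trans_le hzρ
      refine ⟨R, hR, hn.trans ?_⟩
      rw [div_le_div_iff₀ hz0 (by positivity)]
      have h1 : 1 ≤ 1 / ρ * ‖z‖ := by
        rw [one_div_mul_eq_div, one_le_div hρ]; exact hzρ
      have h2 : C₁ * 1 ≤ C₁ * (1 / ρ * ‖z‖) := by gcongr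
      have h3 : 0 ≤ C₂ * (1 + ρ) * ‖z‖ := by positivity
      nlinarith
    · obtain ⟨R, hR, hn⟩ := near z ⟨by simpa using hzρ, hz⟩
      refine ⟨R, hR, hn.trans ?_⟩
      rw [le_div_iff₀ (by positivity)]
      have h1 : C₂ * (1 + ‖z‖) ≤ C₂ * (1 + ρ) := by gcongr
      have h2 : 0 ≤ C₁ * (1 / ρ + 1) := by positivity
      linarith
  refine ⟨1 / (2 * D), 2 * D * (1 + 1 / (2 * D)), by positivity, by positivity, fun z hz => ?_⟩
  have hκ : 0 < 1 / (2 * D) := by positivity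
  rcases le_total 0 z.re with hre | hre
  · obtain ⟨R, hR, hn⟩ := right z hre
    refine ⟨R, hR, hn.trans ?_⟩
    gcongr
    have : 2 * D * (1 + 1 / (2 * D)) = 2 * D + 1 := by field_simp
    linarith
  · -- compare with the point `i Im z` of the imaginary axis
    set w : ℂ := z.im * Complex.I with hw
    have hwn : ‖w‖ = |z.im| := by simp [hw]
    have hwz : ‖w - z‖ = -z.re := by
      have : w - z = ((-z.re : ℝ) : ℂ) := by
        apply Complex.ext <;> simp [hw]
      rw [this, Complex.norm_real, Real.norm_of_nonneg (by linarith)]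
    obtain ⟨K, hK, hKn⟩ := right w (by simp [hw])
    rw [hwn] at hKn
    have hpos : 0 < 1 + |z.im| := by positivity
    obtain ⟨R, hR, hRn⟩ := hK.exists_near z (by
      rw [hwz]
      calc -z.re * ‖K‖ ≤ (1 / (2 * D) * (1 + |z.im|)) * (D / (1 + |z.im|)) := by
            gcongr; linarith
        _ = 1 / 2 := by field_simp)
    refine ⟨R, hR, hRn.trans ?_⟩
    have hzn : 1 + ‖z‖ ≤ (1 + 1 / (2 * D)) * (1 + |z.im|) := by
      have h1 : ‖z‖ ≤ ‖w‖ + ‖w - z‖ := by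
        have := norm_sub_le w (w - z)
        simpa using this
      rw [hwn, hwz] at h1
      linarith
    calc 2 * ‖K‖ ≤ 2 * (D / (1 + |z.im|)) := by gcongr
      _ ≤ 2 * D * (1 + 1 / (2 * D)) / (1 + ‖z‖) := by
        rw [mul_div_assoc', div_le_div_iff₀ hpos (by positivity)]
        calc 2 * D * (1 + ‖z‖) ≤ 2 * D * ((1 + 1 / (2 * D)) * (1 + |z.im|)) := by gcongr
          _ = _ := by ring

/-! ### Spectral functionals of simple eigenvalues -/

/-- A simple eigenvalue `lam` of `L = B + A` with eigenvector `ξ` has a bounded dual eigenvector `ℓ`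
with `ℓ ξ = 1`. If `g` is any functional with `g ξ = 1`, then simplicity of `lam` shows that `lam`
is no eigenvalue of `L + ξ ⊗ g`, hence in its resolvent set; `ℓ = -g ∘ (lam - L - ξ ⊗ g)⁻¹`. -/
lemma exists_dual_eigenvector {A : X →ₗ.[ℂ] X} (hAc : HasCompactResolvent A) (B : X →L[ℂ] X)
    {lam : ℂ} (hsimple : algMultiplicity ((B : X →ₗ[ℂ] X) +ᵥ A) lam = 1) {ξ : X} (hξ0 : ξ ≠ 0)
    (hξ : ξ ∈ A.domain) (hξe : B ξ + A ⟨ξ, hξ⟩ = lam • ξ) :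
    ∃ l : X →L[ℂ] ℂ, l ξ = 1 ∧ (∀ x : A.domain, l (B x + A x) = lam * l x) ∧
      ∀ x : A.domain, B x + A x = lam • (x : X) → ∃ c : ℂ, (x : X) = c • ξ := by
  set L : X →ₗ.[ℂ] X := (B : X →ₗ[ℂ] X) +ᵥ A with hL
  have hLa : ∀ x : A.domain, L x = B x + A x := fun x => LinearPMap.vadd_apply _ _ x
  -- the generalized eigenspace is the line through `ξ`
  have hker1 : ∀ x : A.domain, B x + A x = lam • (x : X) → (x : X) ∈ kerPow L lam 1 := by
    intro x hx
    refine ⟨x, ?_, rfl⟩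
    change L x - lam • (x : X) ∈ kerPow L lam 0
    rw [hLa, hx, sub_self]
    exact zero_mem _
  have hle : ∀ n, kerPow L lam n ≤ ⨆ n, kerPow L lam n := fun n => le_iSup (kerPow L lam) n
  have hspan : ∀ y ∈ ⨆ n, kerPow L lam n, ∃ c : ℂ, c • ξ = y := by
    intro y hy
    have hξm : ξ ∈ ⨆ n, kerPow L lam n := hle 1 (hker1 ⟨ξ, hξ⟩ hξe)
    have h := (finrank_eq_one_iff_of_nonzero' (⟨ξ, hξm⟩ : ↥(⨆ n, kerPow L lam n))
      (by simpa [Subtype.ext_iff] using hξ0)).1 hsimple ⟨y, hy⟩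
    obtain ⟨c, hc⟩ := h
    exact ⟨c, congrArg Subtype.val hc⟩
  obtain ⟨g₀, -, hg₀⟩ := exists_dual_vector ℂ ξ (by simpa using hξ0)
  have hξn : (‖ξ‖ : ℂ) ≠ 0 := by simpa using hξ0
  set g : X →L[ℂ] ℂ := ((‖ξ‖ : ℂ)⁻¹) • g₀ with hg
  have hgξ : g ξ = 1 := by
    rw [hg, smul_apply, hg₀, smul_eq_mul]
    exact inv_mul_cancel₀ hξn
  set B' : X →L[ℂ] X := B + g.smulRight ξ with hB'
  have hnot : ¬ IsEigenvalue ((B' : X →ₗ[ℂ] X) +ᵥ A) lam := by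
    rintro ⟨v, hv0, hv⟩
    have hvd : (v : X) ∈ A.domain := v.2
    have hv' : B v + A ⟨v, hvd⟩ = lam • (v : X) - g v • ξ := by
      have : B v + g v • ξ + A ⟨v, hvd⟩ = lam • (v : X) := by
        rw [LinearPMap.vadd_apply] at hv
        simpa [hB'] using! hv
      rw [← this]; abel
    have hv2 : (v : X) ∈ kerPow L lam 2 := by
      refine ⟨⟨v, hvd⟩, ?_, rfl⟩
      change L ⟨v, hvd⟩ - lam • (v : X) ∈ kerPow L lam 1
      rw [hLa]
      have : B (⟨v, hvd⟩ : A.domain) + A ⟨v, hvd⟩ - lam • (v : X) = -(g v) • ξ := by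
        change B v + A ⟨v, hvd⟩ - lam • (v : X) = _
        rw [hv']; module
      rw [this]
      exact Submodule.smul_mem _ _ (hker1 ⟨ξ, hξ⟩ hξe)
    obtain ⟨c, hc⟩ := hspan _ (hle 2 hv2)
    have hgv : g v = c := by rw [← hc, map_smul, hgξ, smul_eq_mul, mul_one]
    have hAv : A ⟨v, hvd⟩ = c • A ⟨ξ, hξ⟩ := by
      rw [← LinearPMap.map_smul]
      congr 1
      exact Subtype.ext hc.symm
    have hc0 : c • ξ = 0 := by
      have h1 : B v + A ⟨v, hvd⟩ = c • (lam • ξ) := by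
        rw [hAv, ← hc, map_smul, ← smul_add, hξe]
      rw [hv', hgv, ← hc] at h1
      have : lam • c • ξ = c • lam • ξ := smul_comm _ _ _
      rw [this] at h1
      simpa using h1
    exact hv0 (Subtype.ext (by rw [← hc, hc0]; rfl))
  obtain ⟨S, hS⟩ := exists_resolvent_of_not_isEigenvalue hAc B' hnot
  have hS2 : ∀ x : A.domain, S (lam • (x : X) - (B x + g x • ξ + A x)) = x := by
    intro x
    have := hS.2 x
    rw [LinearPMap.vadd_apply] at this
    simpa [hB'] using! this
  refine ⟨-(g ∘L S), ?_, fun x => ?_, fun x hx => ?_⟩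
  · have h1 := hS2 ⟨ξ, hξ⟩
    have h2 : lam • ξ - (B ξ + g ξ • ξ + A ⟨ξ, hξ⟩) = -ξ := by
      rw [← hξe, hgξ]; module
    simp only [h2, map_neg] at h1
    simp only [neg_apply, ContinuousLinearMap.comp_apply]
    rw [← map_neg, h1, hgξ]
  · set x' : A.domain := x - g x • ⟨ξ, hξ⟩ with hx'
    have hx'v : (x' : X) = x - g x • ξ := rfl
    have hgx' : g x' = 0 := by rw [hx'v, map_sub, map_smul, hgξ]; simp
    have hAx' : A x' = A x - g x • A ⟨ξ, hξ⟩ := by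
      rw [hx', LinearPMap.map_sub, LinearPMap.map_smul]
    have h1 := hS2 x'
    rw [hgx', zero_smul, add_zero, hAx'] at h1
    have h2 : lam • (x' : X) - (B x' + (A x - g x • A ⟨ξ, hξ⟩)) = lam • (x : X) - (B x + A x) := by
      have : A ⟨ξ, hξ⟩ = lam • ξ - B ξ := by rw [← hξe]; abel
      rw [this, hx'v, map_sub, map_smul]
      module
    rw [h2] at h1
    have h3 := congrArg g h1
    rw [hgx', map_sub, map_smul, map_sub, map_smul] at h3
    simp only [neg_apply, ContinuousLinearMap.comp_apply]
    have h3' := sub_eq_zero.1 h3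
    rw [smul_eq_mul] at h3'
    rw [← h3']; ring
  · obtain ⟨c, hc⟩ := hspan _ (hle 1 (hker1 x hx))
    exact ⟨c, hc.symm⟩

end Resolvents

open MeasureTheory

/-! ### Inverse Laplace transforms along a hyperbolic contour -/

noncomputable section Contour

/-- `√(1 + y²)`, the weight in which all bounds along the contour are expressed. -/
def jb (y : ℝ) : ℝ := √(1 + y ^ 2)

lemma jb_sq (y : ℝ) : jb y ^ 2 = 1 + y ^ 2 := Real.sq_sqrt (by positivity)

lemma one_le_jb (y : ℝ) : 1 ≤ jb y := by
  rw [jb, Real.one_le_sqrt]; nlinarith [sq_nonneg y]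

lemma jb_pos (y : ℝ) : 0 < jb y := one_pos.trans_le (one_le_jb y)

lemma jb_le (y : ℝ) : jb y ≤ 1 + |y| := by
  rw [jb, Real.sqrt_le_left (by positivity)]
  nlinarith [abs_nonneg y, sq_abs y]

lemma abs_le_jb (y : ℝ) : |y| ≤ jb y := Real.abs_le_sqrt (by linarith)

lemma hasDerivAt_jb (y : ℝ) : HasDerivAt jb (y / jb y) y := by
  have h : HasDerivAt (fun y : ℝ => 1 + y ^ 2) (2 * y) y := by
    simpa using (hasDerivAt_pow 2 y).const_add 1
  have := h.sqrt (by positivity)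
  refine this.congr_deriv ?_
  rw [jb]; field_simp

lemma continuous_jb : Continuous jb := by unfold jb; fun_prop

lemma integrable_inv_jb_sq : Integrable (fun y => (jb y ^ 2)⁻¹) := by
  simpa only [jb_sq] using integrable_inv_one_add_sq

lemma integrable_jb_rpow : Integrable (fun y => jb y ^ (-(3 / 2 : ℝ))) := by
  have h := integrable_rpow_neg_one_add_norm_sq (E := ℝ) (μ := volume) (r := 3 / 2)
    (by simp; norm_num)
  refine h.congr (Eventually.of_forall fun y => ?_)
  simp only [Real.norm_eq_abs, sq_abs]
  rw [jb, Real.sqrt_eq_rpow, ← Real.rpow_mul (by positivity)]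
  norm_num

/-- The contour `Γ`, the hyperbola `y ↦ -(κ / 2) √(1 + y²) + i y`. -/
def hyp (κ : ℝ) (y : ℝ) : ℂ := (-(κ / 2 * jb y) : ℝ) + y * Complex.I

/-- The derivative of `hyp`. -/
def hypDeriv (κ : ℝ) (y : ℝ) : ℂ := (-(κ / 2 * (y / jb y)) : ℝ) + Complex.I

variable {κ : ℝ}

@[simp] lemma hyp_re (y : ℝ) : (hyp κ y).re = -(κ / 2 * jb y) := by simp [hyp]
@[simp] lemma hyp_im (y : ℝ) : (hyp κ y).im = y := by simp [hyp]

lemma hasDerivAt_hyp (y : ℝ) : HasDerivAt (hyp κ) (hypDeriv κ y) y := by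
  have h1 : HasDerivAt (fun y => (-(κ / 2 * jb y) : ℝ)) (-(κ / 2 * (y / jb y))) y :=
    ((hasDerivAt_jb y).const_mul _).neg
  have h2 : HasDerivAt (fun y : ℝ => (y : ℂ) * Complex.I) (1 * Complex.I) y :=
    (hasDerivAt_id y).ofReal_comp.mul_const _
  exact (h1.ofReal_comp.add h2).congr_deriv (by simp [hypDeriv])

lemma continuous_hyp : Continuous (hyp κ) := by
  unfold hyp; have := continuous_jb; fun_prop

lemma continuous_hypDeriv : Continuous (hypDeriv κ) := by
  unfold hypDeriv
  have : Continuous fun y => y / jb y := continuous_id.div continuous_jb fun y => (jb_pos y).ne'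
  fun_prop

lemma norm_hypDeriv_le (hκ : 0 < κ) (y : ℝ) : ‖hypDeriv κ y‖ ≤ κ / 2 + 1 := by
  refine (norm_add_le _ _).trans ?_
  rw [Complex.norm_real, Complex.norm_I, norm_neg, norm_mul, Real.norm_of_nonneg (by positivity)]
  gcongr
  refine mul_le_of_le_one_right (by positivity) ?_
  rw [norm_div, Real.norm_eq_abs, Real.norm_of_nonneg (jb_pos y).le]
  exact div_le_one_of_le₀ (abs_le_jb y) (jb_pos y).le

lemma norm_exp_hyp (t y : ℝ) : ‖Complex.exp (t * hyp κ y)‖ = Real.exp (-(κ / 2 * t * jb y)) := by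
  rw [Complex.norm_exp]; congr 1; simp; ring

lemma jb_le_norm_hyp_add (a y : ℝ) : jb y ≤ 1 + ‖hyp κ y + a‖ := by
  refine (jb_le y).trans ?_
  have := Complex.abs_im_le_norm (hyp κ y + a)
  simp at this
  linarith

lemma norm_hyp_le (hκ : 0 < κ) (y : ℝ) : ‖hyp κ y‖ ≤ (κ / 2 + 1) * jb y := by
  refine (norm_add_le _ _).trans ?_
  rw [Complex.norm_real, norm_mul, Complex.norm_I, Complex.norm_real, norm_neg,
    Real.norm_of_nonneg (mul_nonneg (by positivity) (jb_pos y).le), Real.norm_eq_abs]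
  nlinarith [abs_le_jb y]

/-- The distance of the contour, shifted to the right, from a point to its left. -/
lemma le_norm_hyp_sub (hκ : 0 < κ) {a : ℝ} (ha : -(κ / 4) ≤ a) (y : ℝ) :
    min 1 κ / 2 * jb y ≤ ‖hyp κ y + a + 2 * κ‖ := by
  have hm1 := min_le_left 1 κ
  have hm2 := min_le_right 1 κ
  have hm0 : 0 < min 1 κ := lt_min one_pos hκ
  rcases le_total 1 |y| with hy | hy
  · have h1 := Complex.abs_im_le_norm (hyp κ y + a + 2 * κ)
    simp at h1
    have h2 := jb_le y
    nlinarith [jb_pos y]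
  · have h1 := Complex.re_le_norm (hyp κ y + a + 2 * κ)
    simp at h1
    have h2 : jb y ≤ 3 / 2 := by
      rw [jb, Real.sqrt_le_left (by norm_num)]
      nlinarith [sq_abs y, abs_nonneg y]
    have h3 : jb y * κ ≤ 3 / 2 * κ := by gcongr
    have h4 : min 1 κ / 2 * jb y ≤ κ / 2 * (3 / 2) := by gcongr; exact (jb_pos y).le
    linarith

lemma le_norm_hyp (y : ℝ) : κ / 2 * jb y ≤ ‖hyp κ y‖ := by
  have h1 := Complex.abs_re_le_norm (hyp κ y)
  rw [hyp_re, abs_neg] at h1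
  exact (le_abs_self _).trans h1

variable {E : Type*} [NormedAddCommGroup E] [NormedSpace ℂ E]

/-- The inverse Laplace transform `∫_Γ e^{t z} h(z) dz`, where the weight `h` along the contour
includes the derivative of the contour. -/
def lap (κ : ℝ) (h : ℝ → E) (t : ℝ) : E := ∫ y, Complex.exp (t * hyp κ y) • h y

lemma exp_neg_le {u : ℝ} (hu : 0 < u) : Real.exp (-u) ≤ 2 / (√u * (1 + u)) := by
  have hs : √u ≤ 1 + u := by
    rw [Real.sqrt_le_left (by positivity)]; nlinarith
  have h0 : 0 < √u := Real.sqrt_pos.2 hu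
  rw [Real.exp_neg, inv_eq_one_div, div_le_div_iff₀ (Real.exp_pos _) (by positivity), one_mul]
  have := Real.quadratic_le_exp_of_nonneg hu.le
  nlinarith

lemma exp_neg_le_sq {u : ℝ} (hu : 0 < u) : Real.exp (-u) ≤ 2 / u ^ 2 := by
  rw [Real.exp_neg, inv_eq_one_div, div_le_div_iff₀ (Real.exp_pos _) (by positivity), one_mul]
  have := Real.quadratic_le_exp_of_nonneg hu.le
  nlinarith

lemma continuous_exp_hyp (t : ℝ) : Continuous fun y => Complex.exp (t * hyp κ y) := by
  have := continuous_hyp (κ := κ); fun_prop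

/-- The constant in the bound of the kernel `lap`. -/
def lapConst (κ : ℝ) : ℝ :=
  2 / (√(κ / 2) * min 1 (κ / 2)) * ∫ y, jb y ^ (-(3 / 2 : ℝ))

lemma lapConst_nonneg (hκ : 0 < κ) : 0 ≤ lapConst κ := by
  have h : 0 ≤ ∫ y, jb y ^ (-(3 / 2 : ℝ)) :=
    integral_nonneg fun y => Real.rpow_nonneg (jb_pos y).le _
  have : 0 < min 1 (κ / 2) := lt_min one_pos (by positivity)
  unfold lapConst; positivity

/-- If the weight is `O(1 / |z|)` along the contour, then its inverse Laplace transform has at most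
an integrable singularity at `0`, and it decays at infinity. -/
lemma norm_lap_le (hκ : 0 < κ) {h : ℝ → E} {K : ℝ} (hh : ∀ y, ‖h y‖ ≤ K / jb y) {t : ℝ}
    (ht : 0 < t) : ‖lap κ h t‖ ≤ lapConst κ * K * (1 / (√t * (1 + t))) := by
  have hK : 0 ≤ K := by
    have := (norm_nonneg _).trans (hh 0)
    by_contra hc
    exact absurd this (not_le.2 (div_neg_of_neg_of_pos (not_le.1 hc) (jb_pos 0)))
  set m := min 1 (κ / 2)
  have hm : 0 < m := lt_min one_pos (by positivity)
  have hs : 0 < √t := Real.sqrt_pos.2 ht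
  have hs' : 0 < √(κ / 2) := Real.sqrt_pos.2 (by positivity)
  have hb : ∀ y, ‖Complex.exp (t * hyp κ y) • h y‖ ≤
      (2 / (√(κ / 2) * m) * K * (1 / (√t * (1 + t)))) * jb y ^ (-(3 / 2 : ℝ)) := by
    intro y
    have hj := jb_pos y
    have hj1 := one_le_jb y
    have hsj : 0 < √(jb y) := Real.sqrt_pos.2 hj
    rw [norm_smul, norm_exp_hyp]
    have hu : 0 < κ / 2 * t * jb y := by positivity
    have h1 := exp_neg_le hu
    have h2 : √(κ / 2 * t * jb y) = √(κ / 2) * √t * √(jb y) := by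
      rw [Real.sqrt_mul (by positivity), Real.sqrt_mul (by positivity)]
    have h3 : m * (1 + t) ≤ 1 + κ / 2 * t * jb y := by
      have e1 : m ≤ 1 := min_le_left _ _
      have e2 : m ≤ κ / 2 := min_le_right _ _
      have e3 : m * t ≤ κ / 2 * t := by gcongr
      have e4 : κ / 2 * t * 1 ≤ κ / 2 * t * jb y := by gcongr
      linarith
    have h4 : jb y ^ (-(3 / 2 : ℝ)) = 1 / (√(jb y) * jb y) := by
      rw [Real.rpow_neg hj.le, Real.sqrt_eq_rpow, one_div]
      congr 1
      nth_rewrite 3 [← Real.rpow_one (jb y)]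
      rw [← Real.rpow_add hj]; norm_num
    calc Real.exp (-(κ / 2 * t * jb y)) * ‖h y‖
        ≤ (2 / (√(κ / 2) * √t * √(jb y) * (m * (1 + t)))) * (K / jb y) := by
          refine mul_le_mul (h1.trans ?_) (hh y) (norm_nonneg _) (by positivity)
          rw [h2]
          gcongr
      _ = _ := by rw [h4]; field_simp
  refine (norm_integral_le_of_norm_le (integrable_jb_rpow.const_mul _)
    (Eventually.of_forall hb)).trans (le_of_eq ?_)
  rw [integral_const_mul, lapConst]
  ring

lemma integrable_lap (hκ : 0 < κ) {h : ℝ → E} (hc : Continuous h) {K : ℝ}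
    (hh : ∀ y, ‖h y‖ ≤ K) {t : ℝ} (ht : 0 < t) :
    Integrable fun y => Complex.exp (t * hyp κ y) • h y := by
  refine Integrable.mono' (integrable_inv_jb_sq.const_mul (2 / (κ / 2 * t) ^ 2 * K))
    ((continuous_exp_hyp t).smul hc).aestronglyMeasurable (Eventually.of_forall fun y => ?_)
  have hj := jb_pos y
  rw [norm_smul, norm_exp_hyp]
  have hu : 0 < κ / 2 * t * jb y := by positivity
  calc _ ≤ 2 / (κ / 2 * t * jb y) ^ 2 * K :=
        mul_le_mul (exp_neg_le_sq hu) (hh y) (norm_nonneg _) (by positivity)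
    _ = _ := by field_simp

lemma hasDerivAt_lap (hκ : 0 < κ) {h : ℝ → E} (hc : Continuous h) {K : ℝ}
    (hh : ∀ y, ‖h y‖ ≤ K / jb y) {t : ℝ} (ht : 0 < t) :
    HasDerivAt (lap κ h) (lap κ (fun y => hyp κ y • h y) t) t := by
  have hK : 0 ≤ K := by
    have := (norm_nonneg _).trans (hh 0)
    by_contra hc
    exact absurd this (not_le.2 (div_neg_of_neg_of_pos (not_le.1 hc) (jb_pos 0)))
  have hh' : ∀ y, ‖h y‖ ≤ K := fun y => (hh y).trans (div_le_self hK (one_le_jb y))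
  have hc' : Continuous fun y => hyp κ y • h y := continuous_hyp.smul hc
  refine (hasDerivAt_integral_of_dominated_loc_of_deriv_le (s := Ioi (t / 2))
    (F := fun s y => Complex.exp ((s : ℝ) * hyp κ y) • h y)
    (F' := fun s y => Complex.exp (s * hyp κ y) • (hyp κ y • h y))
    (bound := fun y => (2 / (κ / 2 * (t / 2)) ^ 2 * ((κ / 2 + 1) * K)) * (jb y ^ 2)⁻¹)
    (Ioi_mem_nhds (by linarith))
    (Eventually.of_forall fun s => ((continuous_exp_hyp s).smul hc).aestronglyMeasurable)
    (integrable_lap hκ hc hh' ht) ((continuous_exp_hyp t).smul hc').aestronglyMeasurable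
    (Eventually.of_forall fun y s hs => ?_) (integrable_inv_jb_sq.const_mul _)
    (Eventually.of_forall fun y s _ => ?_)).2
  · have hj := jb_pos y
    have hs' : t / 2 < s := hs
    rw [norm_smul, norm_exp_hyp, norm_smul]
    have hu : 0 < κ / 2 * (t / 2) * jb y := by positivity
    have h1 : Real.exp (-(κ / 2 * s * jb y)) ≤ 2 / (κ / 2 * (t / 2) * jb y) ^ 2 := by
      refine le_trans ?_ (exp_neg_le_sq hu)
      gcongr
    calc _ ≤ 2 / (κ / 2 * (t / 2) * jb y) ^ 2 * (((κ / 2 + 1) * jb y) * (K / jb y)) :=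
          mul_le_mul h1 (mul_le_mul (norm_hyp_le hκ y) (hh y) (norm_nonneg _) (by positivity))
            (by positivity) (by positivity)
      _ = _ := by field_simp
  · have h1 : HasDerivAt (fun s : ℝ => (s : ℂ) * hyp κ y) (1 * hyp κ y) s :=
      (hasDerivAt_id s).ofReal_comp.mul_const _
    have := (h1.cexp.smul_const (h y))
    refine this.congr_deriv ?_
    rw [one_mul, smul_smul]

/-- Continuity at `t = 0` for weights that are integrable along the contour. -/
lemma tendsto_lap_zero (hκ : 0 < κ) {h : ℝ → E} (hc : Continuous h) {K : ℝ}
    (hh : ∀ y, ‖h y‖ ≤ K / jb y ^ 2) :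
    Tendsto (lap κ h) (𝓝[>] 0) (𝓝 (∫ y, h y)) := by
  refine tendsto_integral_filter_of_dominated_convergence (fun y => K * (jb y ^ 2)⁻¹)
    (Eventually.of_forall fun t => ((continuous_exp_hyp t).smul hc).aestronglyMeasurable)
    ?_ (integrable_inv_jb_sq.const_mul _) (Eventually.of_forall fun y => ?_)
  · filter_upwards [self_mem_nhdsWithin] with t ht
    refine Eventually.of_forall fun y => ?_
    rw [norm_smul, norm_exp_hyp, ← div_eq_mul_inv]
    refine (mul_le_of_le_one_left (norm_nonneg _) ?_).trans (hh y)
    rw [Real.exp_le_one_iff]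
    have : 0 < t := ht
    have := jb_pos y
    rw [Left.neg_nonpos_iff]; positivity
  · have : ContinuousAt (fun t : ℝ => Complex.exp (t * hyp κ y) • h y) 0 := by fun_prop
    have h2 := this.tendsto.mono_left (nhdsWithin_le_nhds (s := Ioi 0))
    simpa using h2

lemma tendsto_jb_cocompact : Tendsto jb (cocompact ℝ) atTop :=
  tendsto_atTop_mono (f := norm) abs_le_jb (tendsto_norm_cocompact_atTop (E := ℝ))

lemma tendsto_zero_of_norm_le_div_jb {E : Type*} [NormedAddCommGroup E] {f : ℝ → E} {K : ℝ} (hf : ∀ y, ‖f y‖ ≤ K / jb y) :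
    Tendsto f (cocompact ℝ) (𝓝 0) :=
  squeeze_zero_norm hf (tendsto_jb_cocompact.const_div_atTop K)

variable [CompleteSpace E]

lemma integral_eq_zero_of_hasDerivAt {f f' : ℝ → E} (hf : ∀ y, HasDerivAt f (f' y) y)
    (hi : Integrable f') {K : ℝ} (hb : ∀ y, ‖f y‖ ≤ K / jb y) : ∫ y, f' y = 0 := by
  have h := tendsto_zero_of_norm_le_div_jb hb
  rw [cocompact_eq_atBot_atTop, tendsto_sup] at h
  simpa using integral_of_hasDerivAt_of_tendsto hf hi h.1 h.2

lemma lap_hypDeriv (hκ : 0 < κ) {t : ℝ} (ht : 0 < t) : lap κ (hypDeriv κ) t = 0 := by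
  have hder : ∀ y, HasDerivAt (fun y => (t : ℂ)⁻¹ * Complex.exp (t * hyp κ y))
      (Complex.exp (t * hyp κ y) • hypDeriv κ y) y := by
    intro y
    have := (((hasDerivAt_hyp (κ := κ) y).const_mul (t : ℂ)).cexp).const_mul (t : ℂ)⁻¹
    refine this.congr_deriv ?_
    have ht' : (t : ℂ) ≠ 0 := by exact_mod_cast ht.ne'
    rw [smul_eq_mul]; field_simp
  refine integral_eq_zero_of_hasDerivAt hder
    (integrable_lap hκ continuous_hypDeriv (norm_hypDeriv_le hκ) ht)
    (K := t⁻¹ * (2 / (κ / 2 * t) ^ 2)) fun y => ?_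
  have hj := jb_pos y
  rw [norm_mul, norm_exp_hyp, norm_inv, Complex.norm_real, Real.norm_of_nonneg ht.le,
    mul_div_assoc]
  gcongr
  have hu : 0 < κ / 2 * t * jb y := by positivity
  refine (exp_neg_le_sq hu).trans ?_
  rw [mul_pow, ← div_div]
  gcongr
  nlinarith [one_le_jb y]

/-- Cauchy's theorem for the contour: functions that are holomorphic to the right of it and decay
like `1 / |z|²` have integral zero, because the contour may be shifted to infinity. -/
lemma integral_hyp_eq_zero {h h' : ℂ → E} {K : ℝ}
    (hd : ∀ a y : ℝ, -(κ / 4) < a → HasDerivAt h (h' (hyp κ y + a)) (hyp κ y + a))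
    (hc' : ∀ a : ℝ, -(κ / 4) < a → Continuous fun y => h' (hyp κ y + a))
    (hb : ∀ a y : ℝ, -(κ / 4) < a → ‖h (hyp κ y + a)‖ ≤ K / jb y ^ 2)
    (hb' : ∀ a y : ℝ, -(κ / 4) < a → ‖h' (hyp κ y + a)‖ ≤ K / jb y ^ 2)
    (hlim : ∀ y : ℝ, Tendsto (fun a : ℝ => h (hyp κ y + a)) atTop (𝓝 0)) (hκ : 0 < κ) :
    ∫ y, hypDeriv κ y • h (hyp κ y) = 0 := by
  have hK : 0 ≤ K := by
    have := (norm_nonneg _).trans (hb 0 0 (by linarith))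
    by_contra hcon
    exact absurd this (not_le.2 (div_neg_of_neg_of_pos (not_le.1 hcon) (by have := jb_pos 0; positivity)))
  have hshift : ∀ a y : ℝ, HasDerivAt (fun y => hyp κ y + a) (hypDeriv κ y) y :=
    fun a y => (hasDerivAt_hyp y).add_const _
  have hcy : ∀ a : ℝ, -(κ / 4) < a → Continuous fun y => h (hyp κ y + a) := fun a ha =>
    continuous_iff_continuousAt.2 fun y =>
      ((hd a y ha).scomp y (hshift a y)).continuousAt
  set I : ℝ → E := fun a => ∫ y, hypDeriv κ y • h (hyp κ y + a) with hI
  have hint : ∀ a : ℝ, -(κ / 4) < a → ∀ g : ℝ → E, Continuous g → (∀ y, ‖g y‖ ≤ K / jb y ^ 2) →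
      Integrable fun y => hypDeriv κ y • g y := by
    intro a ha g hg hgb
    refine Integrable.mono' (integrable_inv_jb_sq.const_mul ((κ / 2 + 1) * K))
      (continuous_hypDeriv.smul hg).aestronglyMeasurable (Eventually.of_forall fun y => ?_)
    rw [norm_smul, mul_assoc, ← div_eq_mul_inv]
    exact mul_le_mul (norm_hypDeriv_le hκ y) (hgb y) (norm_nonneg _) (by positivity)
  have hder : ∀ a : ℝ, -(κ / 4) < a → HasDerivAt I 0 a := by
    intro a ha
    have h1 : ∫ y, hypDeriv κ y • h' (hyp κ y + a) = 0 := by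
      refine integral_eq_zero_of_hasDerivAt (f := fun y => h (hyp κ y + a)) (fun y => ?_)
        (hint a ha _ (hc' a ha) (hb' a · ha)) (K := K) fun y => (hb a y ha).trans ?_
      · exact (hd a y ha).scomp y (hshift a y)
      · have := jb_pos y
        gcongr
        nlinarith [one_le_jb y]
    rw [← h1]
    refine (hasDerivAt_integral_of_dominated_loc_of_deriv_le (s := Ioi (-(κ / 4)))
      (F := fun (a : ℝ) y => hypDeriv κ y • h (hyp κ y + a))
      (F' := fun (a : ℝ) y => hypDeriv κ y • h' (hyp κ y + a))
      (bound := fun y => ((κ / 2 + 1) * K) * (jb y ^ 2)⁻¹)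
      (Ioi_mem_nhds ha) ?_ (hint a ha _ (hcy a ha) (hb a · ha))
      (hint a ha _ (hc' a ha) (hb' a · ha)).aestronglyMeasurable
      (Eventually.of_forall fun y s hs => ?_) (integrable_inv_jb_sq.const_mul _)
      (Eventually.of_forall fun y s hs => ?_)).2
    · filter_upwards [Ioi_mem_nhds ha] with s hs
      exact (hint s hs _ (hcy s hs) (hb s · hs)).aestronglyMeasurable
    · rw [norm_smul, mul_assoc, ← div_eq_mul_inv]
      exact mul_le_mul (norm_hypDeriv_le hκ y) (hb' s y hs) (norm_nonneg _) (by positivity)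
    · have h2 : HasDerivAt (fun s : ℝ => hyp κ y + (s : ℂ)) 1 s :=
        ((hasDerivAt_id s).ofReal_comp).const_add _
      have := ((hd s y hs).scomp s h2).const_smul (hypDeriv κ y)
      exact this.congr_deriv (by rw [one_smul])
  have hconst : ∀ a : ℝ, 0 ≤ a → I a = I 0 := by
    intro a ha
    refine isOpen_Ioi.is_const_of_deriv_eq_zero (s := Ioi (-(κ / 4))) isPreconnected_Ioi
      (fun b hb => (hder b hb).differentiableAt.differentiableWithinAt)
      (fun b hb => (hder b hb).deriv) (mem_Ioi.2 ?_) (mem_Ioi.2 ?_) <;> linarith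
  have hlim2 : Tendsto I atTop (𝓝 0) := by
    have : Tendsto I atTop (𝓝 (∫ y : ℝ, (0 : E))) := by
      refine tendsto_integral_filter_of_dominated_convergence
        (fun y => ((κ / 2 + 1) * K) * (jb y ^ 2)⁻¹) ?_ ?_ (integrable_inv_jb_sq.const_mul _)
        (Eventually.of_forall fun y => ?_)
      · filter_upwards [eventually_ge_atTop 0] with a ha
        exact (hint a (by linarith) _ (hcy a (by linarith))
          (hb a · (by linarith))).aestronglyMeasurable
      · filter_upwards [eventually_ge_atTop 0] with a ha
        refine Eventually.of_forall fun y => ?_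
        rw [norm_smul, mul_assoc, ← div_eq_mul_inv]
        exact mul_le_mul (norm_hypDeriv_le hκ y) (hb a y (by linarith)) (norm_nonneg _)
          (by positivity)
      · simpa using (hlim y).const_smul (hypDeriv κ y)
    simpa using this
  have h0 : I 0 = 0 := by
    refine tendsto_nhds_unique ?_ hlim2
    refine tendsto_const_nhds.congr' ?_
    filter_upwards [eventually_ge_atTop 0] with a ha
    exact (hconst a ha).symm
  simpa [hI] using h0

end Contour

/-! ### The analytic semigroup of a stable operator -/

noncomputable section Semigroup

variable {κ : ℝ}

lemma hyp_sub_ne_zero (hκ : 0 < κ) {a : ℝ} (ha : -(κ / 4) ≤ a) (y : ℝ) :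
    hyp κ y + a + 2 * κ ≠ 0 := by
  have h := le_norm_hyp_sub hκ ha y
  have hm0 : 0 < min 1 κ := lt_min one_pos hκ
  have := jb_pos y
  exact norm_pos_iff.1 (lt_of_lt_of_le (by positivity) h)

lemma hyp_ne_zero (hκ : 0 < κ) (y : ℝ) : hyp κ y ≠ 0 := by
  have := jb_pos y
  exact norm_pos_iff.1 (lt_of_lt_of_le (by positivity) (le_norm_hyp (κ := κ) y))

/-- The contour separates `-2 κ` from `0`: the integral is computed by the antiderivative
`log (z + 2 κ) - log (-z)`, both of whose branch cuts avoid the contour. -/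
lemma integral_hyp_residue (hκ : 0 < κ) :
    ∫ y, hypDeriv κ y * ((hyp κ y + 2 * κ)⁻¹ - (hyp κ y)⁻¹) = 2 * Real.pi * Complex.I := by
  have hs1 : ∀ y, -hyp κ y ∈ Complex.slitPlane := fun y => by
    left; rw [Complex.neg_re, hyp_re]; have := jb_pos y; rw [neg_neg]; positivity
  have hs2 : ∀ y, hyp κ y + 2 * κ ∈ Complex.slitPlane := fun y => by
    rcases eq_or_ne y 0 with rfl | hy
    · left
      have : jb 0 = 1 := by simp [jb]
      simp [this]; linarith
    · right; simpa using hy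
  have hder : ∀ y, HasDerivAt (fun y => Complex.log (hyp κ y + 2 * κ) - Complex.log (-hyp κ y))
      (hypDeriv κ y * ((hyp κ y + 2 * κ)⁻¹ - (hyp κ y)⁻¹)) y := by
    intro y
    have h1 := ((hasDerivAt_hyp (κ := κ) y).add_const (2 * κ : ℂ)).clog_real (hs2 y)
    have h2 := ((hasDerivAt_hyp (κ := κ) y).neg).clog_real (hs1 y)
    refine (h1.sub h2).congr_deriv ?_
    have := hyp_ne_zero hκ y
    rw [Pi.neg_apply, neg_div_neg_eq, mul_sub, ← div_eq_mul_inv, ← div_eq_mul_inv]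
  have hint : Integrable fun y => hypDeriv κ y * ((hyp κ y + 2 * κ)⁻¹ - (hyp κ y)⁻¹) := by
    have hm0 : 0 < min 1 κ := lt_min one_pos hκ
    refine Integrable.mono' (integrable_inv_jb_sq.const_mul
      ((κ / 2 + 1) * (2 * κ / (min 1 κ / 2 * (κ / 2))))) ?_ (Eventually.of_forall fun y => ?_)
    · refine (continuous_hypDeriv.mul (Continuous.sub (Continuous.inv₀ ?_ ?_)
        (continuous_hyp.inv₀ (hyp_ne_zero hκ)))).aestronglyMeasurable
      · exact continuous_hyp.add continuous_const
      · intro y; simpa using hyp_sub_ne_zero hκ (a := 0) (by linarith) y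
    · have h1 := le_norm_hyp_sub hκ (a := 0) (by linarith) y
      have h2 := le_norm_hyp (κ := κ) y
      have hj := jb_pos y
      have e0 := hyp_sub_ne_zero hκ (a := 0) (by linarith) y
      simp only [Complex.ofReal_zero, add_zero] at h1 e0
      have e : (hyp κ y + 2 * κ)⁻¹ - (hyp κ y)⁻¹ = -(2 * κ) / ((hyp κ y + 2 * κ) * hyp κ y) := by
        have := hyp_ne_zero hκ y
        field_simp; ring
      rw [norm_mul, e, norm_div, norm_mul, norm_neg, norm_mul, Complex.norm_real,
        Real.norm_of_nonneg hκ.le, Complex.norm_ofNat, mul_assoc]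
      refine mul_le_mul (norm_hypDeriv_le hκ y) ?_ (by positivity) (by positivity)
      calc 2 * κ / (‖hyp κ y + 2 * κ‖ * ‖hyp κ y‖)
          ≤ 2 * κ / ((min 1 κ / 2 * jb y) * (κ / 2 * jb y)) := by gcongr
        _ = _ := by field_simp
  -- the limits of the antiderivative: rescale both arguments by `|y|`
  have hjy : Tendsto (fun y : ℝ => jb y / |y|) (cocompact ℝ) (𝓝 1) := by
    have hsq : Tendsto (fun y : ℝ => √((y ^ 2)⁻¹ + 1)) (cocompact ℝ) (𝓝 (√(0 + 1))) := by
      refine (Real.continuous_sqrt.tendsto _).comp (Tendsto.add_const 1 ?_)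
      have : Tendsto (fun y : ℝ => y ^ 2) (cocompact ℝ) atTop := by
        have h := (tendsto_norm_cocompact_atTop (E := ℝ))
        have h2 := (tendsto_pow_atTop (α := ℝ) two_ne_zero).comp h
        refine h2.congr fun y => ?_
        simp
      exact this.inv_tendsto_atTop
    rw [zero_add, Real.sqrt_one] at hsq
    refine hsq.congr' ?_
    have : ∀ᶠ y : ℝ in cocompact ℝ, y ≠ 0 := by
      simpa using (isCompact_singleton (x := (0 : ℝ))).compl_mem_cocompact
    filter_upwards [this] with y hy
    rw [jb, ← Real.sqrt_sq_eq_abs, ← Real.sqrt_div (by positivity)]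
    congr 1
    field_simp
  have hinv : Tendsto (fun y : ℝ => |y|⁻¹) (cocompact ℝ) (𝓝 0) :=
    (tendsto_norm_cocompact_atTop (E := ℝ)).inv_tendsto_atTop
  have key : ∀ (l : Filter ℝ) (ε : ℝ), ε ≠ 0 → l ≤ cocompact ℝ → (∀ᶠ y in l, y = ε * |y|) →
      Tendsto (fun y => Complex.log (hyp κ y + 2 * κ) - Complex.log (-hyp κ y)) l
        (𝓝 (Complex.log ((-(κ / 2) : ℝ) + ε * Complex.I) -
          Complex.log ((κ / 2 : ℝ) - ε * Complex.I))) := by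
    intro l ε hε hl hev
    have hne : ∀ᶠ y : ℝ in l, 0 < |y| := by
      have : ∀ᶠ y : ℝ in cocompact ℝ, y ≠ 0 := by
        simpa using (isCompact_singleton (x := (0 : ℝ))).compl_mem_cocompact
      filter_upwards [hl this] with y hy using abs_pos.2 hy
    have t1 : Tendsto (fun y : ℝ => ((-(κ / 2 * (jb y / |y|)) : ℝ) : ℂ) + ε * Complex.I
        + (2 * κ * |y|⁻¹ : ℝ)) l (𝓝 ((-(κ / 2) : ℝ) + ε * Complex.I)) := by
      have := ((Complex.continuous_ofReal.tendsto _).comp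
        ((hjy.mono_left hl).const_mul (κ / 2)).neg).add_const ((ε : ℂ) * Complex.I)
      have h3 := this.add ((Complex.continuous_ofReal.tendsto _).comp
        ((hinv.mono_left hl).const_mul (2 * κ)))
      simpa using h3
    have t2 : Tendsto (fun y : ℝ => ((κ / 2 * (jb y / |y|) : ℝ) : ℂ) - ε * Complex.I) l
        (𝓝 ((κ / 2 : ℝ) - ε * Complex.I)) := by
      have := ((Complex.continuous_ofReal.tendsto _).comp
        ((hjy.mono_left hl).const_mul (κ / 2))).sub_const ((ε : ℂ) * Complex.I)
      simpa using this
    have l1 := t1.clog (by right; simpa using hε)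
    have l2 := t2.clog (by left; simp; exact hκ)
    refine (l1.sub l2).congr' ?_
    filter_upwards [hne, hev] with y hy hye
    have hyc : ((|y| : ℝ) : ℂ) ≠ 0 := by exact_mod_cast hy.ne'
    have hye' : (y : ℂ) = ε * (|y| : ℝ) := by exact_mod_cast hye
    have s1 : hyp κ y + 2 * κ = (|y| : ℝ) * (((-(κ / 2 * (jb y / |y|)) : ℝ) : ℂ) + ε * Complex.I
        + (2 * κ * |y|⁻¹ : ℝ)) := by
      rw [hyp, hye']; push_cast; field_simp
    have s2 : -hyp κ y = (|y| : ℝ) * (((κ / 2 * (jb y / |y|) : ℝ) : ℂ) - ε * Complex.I) := by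
      rw [hyp, hye']; push_cast; field_simp; ring
    have z1 : ((-(κ / 2 * (jb y / |y|)) : ℝ) : ℂ) + ε * Complex.I + (2 * κ * |y|⁻¹ : ℝ) ≠ 0 := by
      intro h; rw [h, mul_zero] at s1
      exact Complex.slitPlane_ne_zero (hs2 y) s1
    have z2 : ((κ / 2 * (jb y / |y|) : ℝ) : ℂ) - ε * Complex.I ≠ 0 := by
      intro h; rw [h, mul_zero] at s2
      exact Complex.slitPlane_ne_zero (hs1 y) s2
    rw [s1, s2, Complex.log_ofReal_mul hy z1, Complex.log_ofReal_mul hy z2]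
    ring
  have e1 := key atTop 1 one_ne_zero (by rw [cocompact_eq_atBot_atTop]; exact le_sup_right)
    (by filter_upwards [eventually_ge_atTop 0] with y hy; rw [abs_of_nonneg hy, one_mul])
  have e2 := key atBot (-1) (by norm_num) (by rw [cocompact_eq_atBot_atTop]; exact le_sup_left)
    (by filter_upwards [eventually_le_atBot 0] with y hy; rw [abs_of_nonpos hy]; ring)
  rw [integral_of_hasDerivAt_of_tendsto hder hint e2 e1]
  set w : ℂ := (κ / 2 : ℝ) - Complex.I with hw
  have hw1 : ((-(κ / 2) : ℝ) : ℂ) + (1 : ℝ) * Complex.I = -w := by rw [hw]; push_cast; ring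
  have hw2 : ((κ / 2 : ℝ) : ℂ) - (1 : ℝ) * Complex.I = w := by rw [hw]; push_cast; ring
  have hw3 : ((-(κ / 2) : ℝ) : ℂ) + (-1 : ℝ) * Complex.I = -(starRingEnd ℂ w) := by
    rw [hw, map_sub, Complex.conj_ofReal, Complex.conj_I]; push_cast; ring
  have hw4 : ((κ / 2 : ℝ) : ℂ) - (-1 : ℝ) * Complex.I = starRingEnd ℂ w := by
    rw [hw, map_sub, Complex.conj_ofReal, Complex.conj_I]; push_cast; ring
  rw [hw1, hw2, hw3, hw4]
  have hwim : w.im < 0 := by simp [hw]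
  have a1 : Complex.log (-w) = Complex.log w + Real.pi * Complex.I := by
    simp only [Complex.log, norm_neg, Complex.arg_neg_eq_arg_add_pi_of_im_neg hwim]
    push_cast; ring
  have a2 : Complex.log (-(starRingEnd ℂ w)) =
      Complex.log (starRingEnd ℂ w) - Real.pi * Complex.I := by
    have : 0 < (starRingEnd ℂ w).im := by simpa using hwim
    simp only [Complex.log, norm_neg, Complex.arg_neg_eq_arg_sub_pi_of_im_pos this]
    push_cast; ring
  rw [a1, a2]; ring

variable {X : Type*} [NormedAddCommGroup X] [NormedSpace ℂ X]

/-- `R` is the resolvent of `L` to the right of the wedge `Re z = -κ (1 + |Im z|)`, and it is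
bounded by `C / (1 + |z|)` there. -/
structure IsStableResolvent (L : X →ₗ.[ℂ] X) (κ C : ℝ) (R : ℂ → X →L[ℂ] X) : Prop where
  κ_pos : 0 < κ
  C_pos : 0 < C
  isResolventAt : ∀ z : ℂ, -(κ * (1 + |z.im|)) ≤ z.re → IsResolventAt L z (R z)
  norm_le : ∀ z : ℂ, -(κ * (1 + |z.im|)) ≤ z.re → ‖R z‖ ≤ C / (1 + ‖z‖)

lemma HasStableResolvent.exists_isStableResolvent {L : X →ₗ.[ℂ] X} {C : ℝ} (hκ : 0 < κ)
    (hC : 0 < C) (h : HasStableResolvent L κ C) : ∃ R, IsStableResolvent L κ C R := by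
  classical
  refine ⟨fun z => if hz : -(κ * (1 + |z.im|)) ≤ z.re then (h z hz).choose else 0, hκ, hC,
    fun z hz => ?_, fun z hz => ?_⟩
  · rw [dif_pos hz]; exact (h z hz).choose_spec.1
  · rw [dif_pos hz]; exact (h z hz).choose_spec.2

variable {L : X →ₗ.[ℂ] X} {C : ℝ} {R : ℂ → X →L[ℂ] X}

namespace IsStableResolvent

lemma norm_le_const (hR : IsStableResolvent L κ C R) {z : ℂ} (hz : -(κ * (1 + |z.im|)) ≤ z.re) :
    ‖R z‖ ≤ C :=
  (hR.norm_le z hz).trans (div_le_self hR.C_pos.le (by linarith [norm_nonneg z]))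

lemma eventually_mem (z : ℂ) (hz : -(κ * (1 + |z.im|)) < z.re) :
    ∀ᶠ z' in 𝓝 z, -(κ * (1 + |z'.im|)) ≤ z'.re := by
  have h1 : Continuous fun z : ℂ => -(κ * (1 + |z.im|)) :=
    (continuous_const.mul (continuous_const.add Complex.continuous_im.abs)).neg
  filter_upwards [(isOpen_lt h1 Complex.continuous_re).mem_nhds hz] with z' hz' using le_of_lt hz'

lemma hasDerivAt (hR : IsStableResolvent L κ C R) {z : ℂ} (hz : -(κ * (1 + |z.im|)) < z.re) :
    HasDerivAt R (-(R z * R z)) z := by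
  have hev := eventually_mem (κ := κ) z hz
  have hid : ∀ z', -(κ * (1 + |z'.im|)) ≤ z'.re → R z' - R z = (z - z') • (R z' * R z) :=
    fun z' hz' => (hR.isResolventAt z hz.le).sub_eq (hR.isResolventAt z' hz')
  have hcont : Tendsto R (𝓝 z) (𝓝 (R z)) := by
    rw [tendsto_iff_norm_sub_tendsto_zero]
    have hlim : Tendsto (fun z' => ‖z - z'‖ * (C * C)) (𝓝 z) (𝓝 0) := by
      have : Continuous fun z' => ‖z - z'‖ * (C * C) := by fun_prop
      simpa using this.tendsto z
    refine squeeze_zero' (Eventually.of_forall fun _ => norm_nonneg _) ?_ hlim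
    filter_upwards [hev] with z' hz'
    rw [hid z' hz', norm_smul]
    gcongr
    refine (norm_mul_le _ _).trans ?_
    exact mul_le_mul (hR.norm_le_const hz') (hR.norm_le_const hz.le) (norm_nonneg _) hR.C_pos.le
  rw [hasDerivAt_iff_tendsto_slope]
  have h2 : Tendsto (fun z' => -(R z' * R z)) (𝓝[≠] z) (𝓝 (-(R z * R z))) :=
    (((hcont.mul_const (R z))).neg).mono_left nhdsWithin_le_nhds
  refine h2.congr' ?_
  filter_upwards [nhdsWithin_le_nhds hev, self_mem_nhdsWithin] with z' hz' hne
  have : z' - z ≠ 0 := sub_ne_zero.2 hne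
  rw [slope_def_module, hid z' hz', smul_smul]
  have : (z' - z)⁻¹ * (z - z') = -1 := by
    rw [← neg_sub z' z]; field_simp
  rw [this]; simp

lemma hyp_mem (hR : IsStableResolvent L κ C R) {a : ℝ} (ha : -(κ / 4) < a) (y : ℝ) :
    -(κ * (1 + |(hyp κ y + a).im|)) < (hyp κ y + a).re := by
  have := hR.κ_pos
  have h := jb_le y
  have := abs_nonneg y
  simp
  nlinarith

lemma norm_hyp_le (hR : IsStableResolvent L κ C R) {a : ℝ} (ha : -(κ / 4) < a) (y : ℝ) :
    ‖R (hyp κ y + a)‖ ≤ C / jb y := by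
  refine (hR.norm_le _ (hR.hyp_mem ha y).le).trans ?_
  have := hR.C_pos
  have := jb_pos y
  gcongr
  exact jb_le_norm_hyp_add a y

lemma continuous_hyp (hR : IsStableResolvent L κ C R) {a : ℝ} (ha : -(κ / 4) < a) :
    Continuous fun y => R (hyp κ y + a) :=
  continuous_iff_continuousAt.2 fun y => by
    refine ContinuousAt.comp (hR.hasDerivAt (hR.hyp_mem ha y)).continuousAt ?_
    exact (UnstableChart.continuous_hyp.add continuous_const).continuousAt

/-- The weight `h` for which `lap κ h t` is `2 π i e^{t L}`. -/
def weight (κ : ℝ) (R : ℂ → X →L[ℂ] X) (y : ℝ) : X →L[ℂ] X := hypDeriv κ y • R (hyp κ y)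

lemma continuous_weight (hR : IsStableResolvent L κ C R) : Continuous (weight κ R) := by
  have := hR.continuous_hyp (a := 0) (by linarith [hR.κ_pos])
  simp only [Complex.ofReal_zero, add_zero] at this
  exact continuous_hypDeriv.smul this

lemma norm_weight_le (hR : IsStableResolvent L κ C R) (y : ℝ) :
    ‖weight κ R y‖ ≤ ((κ / 2 + 1) * C) / jb y := by
  have h := hR.norm_hyp_le (a := 0) (by linarith [hR.κ_pos]) y
  simp only [Complex.ofReal_zero, add_zero] at h
  rw [weight, norm_smul, mul_div_assoc]
  exact mul_le_mul (norm_hypDeriv_le hR.κ_pos y) h (norm_nonneg _) (by linarith [hR.κ_pos])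

/-- The semigroup `e^{t L}` for `t > 0`. -/
def semigroup (κ : ℝ) (R : ℂ → X →L[ℂ] X) (t : ℝ) : X →L[ℂ] X :=
  (2 * Real.pi * Complex.I)⁻¹ • lap κ (weight κ R) t

/-- The derivative of the semigroup. -/
def semigroupDeriv (κ : ℝ) (R : ℂ → X →L[ℂ] X) (t : ℝ) : X →L[ℂ] X :=
  (2 * Real.pi * Complex.I)⁻¹ • lap κ (fun y => hyp κ y • weight κ R y) t

/-- The constant in the bound of the semigroup. -/
def semigroupConst (κ C : ℝ) : ℝ :=
  ‖(2 * Real.pi * Complex.I : ℂ)⁻¹‖ * (lapConst κ * ((κ / 2 + 1) * C))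

lemma semigroupConst_nonneg (hR : IsStableResolvent L κ C R) : 0 ≤ semigroupConst κ C := by
  have := lapConst_nonneg hR.κ_pos
  have := hR.κ_pos
  have := hR.C_pos
  unfold semigroupConst; positivity

lemma norm_semigroup_le (hR : IsStableResolvent L κ C R) {t : ℝ} (ht : 0 < t) :
    ‖semigroup κ R t‖ ≤ semigroupConst κ C * (1 / (√t * (1 + t))) := by
  refine (norm_smul_le (2 * Real.pi * Complex.I : ℂ)⁻¹ (lap κ (weight κ R) t)).trans ?_
  rw [semigroupConst, mul_assoc ‖(2 * Real.pi * Complex.I : ℂ)⁻¹‖]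
  gcongr
  exact norm_lap_le hR.κ_pos hR.norm_weight_le ht

lemma hasDerivAt_semigroup (hR : IsStableResolvent L κ C R) {t : ℝ} (ht : 0 < t) :
    HasDerivAt (semigroup κ R) (semigroupDeriv κ R t) t :=
  (hasDerivAt_lap hR.κ_pos hR.continuous_weight hR.norm_weight_le ht).const_smul
    (2 * Real.pi * Complex.I)⁻¹

lemma lap_weight_apply (hR : IsStableResolvent L κ C R) {t : ℝ} (ht : 0 < t) (x : X) :
    lap κ (weight κ R) t x = lap κ (fun y => weight κ R y x) t := by
  have hb : ∀ y, ‖weight κ R y‖ ≤ (κ / 2 + 1) * C := fun y =>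
    (hR.norm_weight_le y).trans (div_le_self (by have := hR.κ_pos; have := hR.C_pos; positivity)
      (one_le_jb y))
  exact ContinuousLinearMap.integral_apply
    (integrable_lap hR.κ_pos hR.continuous_weight hb ht) x

variable [CompleteSpace X]

lemma semigroupDeriv_apply (hR : IsStableResolvent L κ C R) {t : ℝ} (ht : 0 < t) (x : L.domain) :
    semigroupDeriv κ R t x = semigroup κ R t (L x) := by
  have hκ := hR.κ_pos
  have hC := hR.C_pos
  rw [semigroupDeriv, semigroup, smul_apply, smul_apply, hR.lap_weight_apply ht]
  congr 1
  have hb : ∀ y, ‖weight κ R y‖ ≤ (κ / 2 + 1) * C := fun y =>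
    (hR.norm_weight_le y).trans (div_le_self (by positivity) (one_le_jb y))
  have hb2 : ∀ y, ‖hyp κ y • weight κ R y‖ ≤ (κ / 2 + 1) * ((κ / 2 + 1) * C) := fun y => by
    have hj := jb_pos y
    rw [norm_smul]
    refine (mul_le_mul (UnstableChart.norm_hyp_le hκ y) (hR.norm_weight_le y) (norm_nonneg _)
      (by positivity)).trans (le_of_eq ?_)
    field_simp
  have hc2 : Continuous fun y => hyp κ y • weight κ R y :=
    UnstableChart.continuous_hyp.smul hR.continuous_weight
  have e1 : lap κ (fun y => hyp κ y • weight κ R y) t (x : X) =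
      lap κ (fun y => (hyp κ y • weight κ R y) (x : X)) t :=
    ContinuousLinearMap.integral_apply (integrable_lap hκ hc2 hb2 ht) (x : X)
  rw [e1]
  have e2 : ∀ y, (hyp κ y • weight κ R y) (x : X) =
      hypDeriv κ y • (x : X) + weight κ R y (L x) := by
    intro y
    have hm := hR.hyp_mem (a := 0) (by linarith) y
    simp only [Complex.ofReal_zero, add_zero] at hm
    have := (hR.isResolventAt _ hm.le).apply_domain 0 x
    rw [sub_zero, zero_smul, sub_zero] at this
    rw [weight, smul_apply, smul_apply, smul_apply, smul_comm, this, smul_add]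
  simp only [e2]
  have hi1 : Integrable fun y => Complex.exp (t * hyp κ y) • (hypDeriv κ y • (x : X)) := by
    refine integrable_lap hκ (continuous_hypDeriv.smul continuous_const)
      (K := (κ / 2 + 1) * ‖(x : X)‖) (fun y => ?_) ht
    change ‖hypDeriv κ y • (x : X)‖ ≤ _
    rw [norm_smul]; gcongr; exact norm_hypDeriv_le hκ y
  have hi2 : Integrable fun y => Complex.exp (t * hyp κ y) • weight κ R y (L x) := by
    refine integrable_lap hκ (hR.continuous_weight.clm_apply continuous_const)
      (K := (κ / 2 + 1) * C * ‖L x‖) (fun y => ?_) ht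
    exact (ContinuousLinearMap.le_opNorm _ _).trans (by gcongr; exact hb y)
  have h0 : ∫ y, Complex.exp (t * hyp κ y) • (hypDeriv κ y • (x : X)) = 0 := by
    have := lap_hypDeriv (κ := κ) hκ ht
    rw [lap] at this
    simp only [← smul_assoc]
    rw [integral_smul_const, this, zero_smul]
  simp only [lap, smul_add]
  rw [integral_add hi1 hi2, h0, zero_add]

end IsStableResolvent

end Semigroup

noncomputable section StableEstimate

variable {κ C : ℝ} {X : Type*} [NormedAddCommGroup X] [NormedSpace ℂ X] {L : X →ₗ.[ℂ] X}
  {R : ℂ → X →L[ℂ] X}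

namespace IsStableResolvent

variable [CompleteSpace X]

/-- Cauchy's theorem applied to the resolvent. -/
lemma integral_resolvent_eq_zero (hR : IsStableResolvent L κ C R) :
    ∫ y, hypDeriv κ y • ((hyp κ y + 2 * κ)⁻¹ • R (hyp κ y)) = 0 := by
  have hκ := hR.κ_pos
  have hC := hR.C_pos
  have hm0 : 0 < min 1 κ := lt_min one_pos hκ
  set m := min 1 κ / 2 with hm
  have hmp : 0 < m := by positivity
  have hinv : ∀ a y : ℝ, -(κ / 4) < a → ‖(hyp κ y + a + 2 * κ)⁻¹‖ ≤ m⁻¹ / jb y := by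
    intro a y ha
    have := le_norm_hyp_sub hκ ha.le y
    have hj := jb_pos y
    rw [norm_inv, div_eq_mul_inv, ← mul_inv]
    gcongr
  refine integral_hyp_eq_zero (κ := κ)
    (h := fun z => (z + 2 * κ)⁻¹ • R z)
    (h' := fun z => (z + 2 * κ)⁻¹ • (-(R z * R z)) + (-1 / (z + 2 * κ) ^ 2) • R z)
    (K := m⁻¹ * (C * C) + m⁻¹ * C + m⁻¹ * m⁻¹ * C) ?_ ?_ ?_ ?_ ?_ hκ
  · intro a y ha
    have hz := hyp_sub_ne_zero hκ ha.le y
    have h1 : HasDerivAt (fun z : ℂ => (z + 2 * κ)⁻¹) (-1 / (hyp κ y + a + 2 * κ) ^ 2)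
        (hyp κ y + a) :=
      (((hasDerivAt_id _).add_const _).inv hz)
    exact h1.smul (hR.hasDerivAt (hR.hyp_mem ha y))
  · intro a ha
    have h1 := hR.continuous_hyp ha
    have h2 : Continuous fun y => hyp κ y + a + 2 * κ :=
      (UnstableChart.continuous_hyp.add continuous_const).add continuous_const
    have h3 : ∀ y, hyp κ y + a + 2 * κ ≠ 0 := fun y => hyp_sub_ne_zero hκ ha.le y
    have h4 : Continuous fun y => -1 / (hyp κ y + a + 2 * κ) ^ 2 :=
      continuous_const.div (h2.pow 2) fun y => pow_ne_zero 2 (h3 y)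
    exact ((h2.inv₀ h3).smul (h1.mul h1).neg).add (h4.smul h1)
  · intro a y ha
    have hj := jb_pos y
    rw [norm_smul]
    calc _ ≤ (m⁻¹ / jb y) * (C / jb y) :=
          mul_le_mul (hinv a y ha) (hR.norm_hyp_le ha y) (norm_nonneg _) (by positivity)
      _ = (m⁻¹ * C) / jb y ^ 2 := by field_simp
      _ ≤ _ := by
        gcongr
        have : 0 ≤ m⁻¹ * (C * C) := by positivity
        have : 0 ≤ m⁻¹ * m⁻¹ * C := by positivity
        linarith
  · intro a y ha
    have hj := jb_pos y
    have hRn := hR.norm_hyp_le ha y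
    have hRc := hR.norm_le_const (hR.hyp_mem ha y).le
    have hi := hinv a y ha
    refine (norm_add_le _ _).trans ?_
    have e1 : ‖(hyp κ y + a + 2 * κ)⁻¹ • (-(R (hyp κ y + a) * R (hyp κ y + a)))‖ ≤
        (m⁻¹ * (C * C)) / jb y ^ 2 := by
      rw [norm_smul, norm_neg]
      calc _ ≤ (m⁻¹ / jb y) * (C / jb y * C) := by
            refine mul_le_mul hi ((norm_mul_le _ _).trans ?_) (norm_nonneg _) (by positivity)
            exact mul_le_mul hRn hRc (norm_nonneg _) (by positivity)
        _ = _ := by field_simp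
    have e2 : ‖(-1 / (hyp κ y + a + 2 * κ) ^ 2) • R (hyp κ y + a)‖ ≤
        (m⁻¹ * m⁻¹ * C) / jb y ^ 2 := by
      rw [norm_smul, norm_div, norm_neg, norm_one, norm_pow, one_div, ← inv_pow, ← norm_inv]
      calc _ ≤ (m⁻¹ / jb y) ^ 2 * C := by gcongr
        _ = _ := by field_simp
    have e3 : 0 ≤ m⁻¹ * C / jb y ^ 2 := by positivity
    calc _ ≤ _ := add_le_add e1 e2
      _ ≤ _ := by rw [add_div, add_div]; linarith
  · intro y
    have h1 : Tendsto (fun a : ℝ => ‖hyp κ y + a + 2 * κ‖) atTop atTop := by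
      refine tendsto_atTop_mono (fun a => Complex.re_le_norm _) ?_
      simp only [Complex.add_re, Complex.ofReal_re]
      exact tendsto_atTop_add_const_right _ _ (tendsto_atTop_add_const_left _ _ tendsto_id)
    have h2 := h1.const_div_atTop C
    refine squeeze_zero_norm' ?_ h2
    filter_upwards [eventually_ge_atTop 0] with a ha
    rw [norm_smul, norm_inv, mul_comm, ← div_eq_mul_inv]
    gcongr
    exact hR.norm_le_const (hR.hyp_mem (by linarith) y).le

/-- The semigroup is strongly continuous at `0` on the domain of `L`. The identity
`R(z) x = (x + R(z) (L + 2 κ) x) / (z + 2 κ)` splits the contour integral into a scalar one,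
evaluated by residues, and one that vanishes in the limit by Cauchy's theorem. -/
lemma tendsto_semigroup (hR : IsStableResolvent L κ C R) (x : L.domain) :
    Tendsto (fun t => semigroup κ R t x) (𝓝[>] 0) (𝓝 (x : X)) := by
  have hκ := hR.κ_pos
  have hC := hR.C_pos
  have hm0 : 0 < min 1 κ := lt_min one_pos hκ
  set m := min 1 κ / 2 with hm
  have hmp : 0 < m := by positivity
  set v : X := L x - (-2 * κ : ℂ) • (x : X) with hv
  have hz0 : ∀ y, hyp κ y + 2 * κ ≠ 0 := fun y => by
    simpa using hyp_sub_ne_zero hκ (a := 0) (by linarith) y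
  have hinv : ∀ y, ‖(hyp κ y + 2 * κ)⁻¹‖ ≤ m⁻¹ / jb y := by
    intro y
    have := le_norm_hyp_sub hκ (a := 0) (by linarith) y
    simp only [Complex.ofReal_zero, add_zero] at this
    have hj := jb_pos y
    rw [norm_inv, div_eq_mul_inv, ← mul_inv]
    gcongr
  have hinv0 : ∀ y, ‖(hyp κ y)⁻¹‖ ≤ (κ / 2)⁻¹ / jb y := by
    intro y
    have := le_norm_hyp (κ := κ) y
    have hj := jb_pos y
    rw [norm_inv, div_eq_mul_inv, ← mul_inv]
    gcongr
  have hRn : ∀ y, ‖R (hyp κ y)‖ ≤ C / jb y := fun y => by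
    simpa using hR.norm_hyp_le (a := 0) (by linarith) y
  have hRc : Continuous fun y => R (hyp κ y) := by
    simpa using hR.continuous_hyp (a := 0) (by linarith)
  have hzc : Continuous fun y => (hyp κ y + 2 * κ)⁻¹ :=
    (UnstableChart.continuous_hyp.add continuous_const).inv₀ hz0
  have hzc0 : Continuous fun y => (hyp κ y)⁻¹ := UnstableChart.continuous_hyp.inv₀ (hyp_ne_zero hκ)
  -- the three weights
  set h₁ : ℝ → ℂ := fun y => hypDeriv κ y * ((hyp κ y + 2 * κ)⁻¹ - (hyp κ y)⁻¹) with hh₁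
  set h₂ : ℝ → X := fun y => hypDeriv κ y • ((hyp κ y + 2 * κ)⁻¹ • R (hyp κ y)) v with hh₂
  set h₀ : ℝ → ℂ := fun y => hypDeriv κ y * (hyp κ y)⁻¹ with hh₀
  have hc₁ : Continuous h₁ := continuous_hypDeriv.mul (hzc.sub hzc0)
  have hc₂ : Continuous h₂ :=
    continuous_hypDeriv.smul ((hzc.smul hRc).clm_apply continuous_const)
  have hc₀ : Continuous h₀ := continuous_hypDeriv.mul hzc0
  have hb₁ : ∀ y, ‖h₁ y‖ ≤ ((κ / 2 + 1) * (2 * κ * (m⁻¹ * (κ / 2)⁻¹))) / jb y ^ 2 := by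
    intro y
    have hj := jb_pos y
    have e : (hyp κ y + 2 * κ)⁻¹ - (hyp κ y)⁻¹ =
        -(2 * κ) * ((hyp κ y + 2 * κ)⁻¹ * (hyp κ y)⁻¹) := by
      have := hyp_ne_zero hκ y
      have := hz0 y
      field_simp; ring
    rw [hh₁, norm_mul, e, norm_mul, norm_mul, norm_neg, norm_mul, Complex.norm_real,
      Real.norm_of_nonneg hκ.le, Complex.norm_ofNat]
    calc _ ≤ (κ / 2 + 1) * (2 * κ * ((m⁻¹ / jb y) * ((κ / 2)⁻¹ / jb y))) := by
          gcongr
          · exact norm_hypDeriv_le hκ y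
          · exact hinv y
          · exact hinv0 y
      _ = _ := by field_simp
  have hb₂ : ∀ y, ‖h₂ y‖ ≤ ((κ / 2 + 1) * (m⁻¹ * C * ‖v‖)) / jb y ^ 2 := by
    intro y
    have hj := jb_pos y
    rw [hh₂, norm_smul]
    calc _ ≤ (κ / 2 + 1) * ((m⁻¹ / jb y) * (C / jb y) * ‖v‖) := by
          gcongr
          · exact norm_hypDeriv_le hκ y
          · refine (ContinuousLinearMap.le_opNorm _ _).trans ?_
            gcongr
            rw [norm_smul]
            exact mul_le_mul (hinv y) (hRn y) (norm_nonneg _) (by positivity)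
      _ = _ := by field_simp
  have hb₀ : ∀ y, ‖h₀ y‖ ≤ ((κ / 2 + 1) * (κ / 2)⁻¹) / jb y := by
    intro y
    rw [hh₀, norm_mul, mul_div_assoc]
    exact mul_le_mul (norm_hypDeriv_le hκ y) (hinv0 y) (norm_nonneg _) (by positivity)
  have hle : ∀ {K : ℝ} {y : ℝ}, 0 ≤ K → K / jb y ^ 2 ≤ K := fun hK =>
    div_le_self hK (one_le_pow₀ (one_le_jb _))
  have hle' : ∀ {K : ℝ} {y : ℝ}, 0 ≤ K → K / jb y ≤ K := fun hK => div_le_self hK (one_le_jb _)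
  -- the transform of `1 / z` is constant in time and decays, hence zero
  have hzero : ∀ t : ℝ, 0 < t → lap κ h₀ t = 0 := by
    have hder : ∀ t : ℝ, 0 < t → HasDerivAt (lap κ h₀) 0 t := by
      intro t ht
      have := hasDerivAt_lap hκ hc₀ hb₀ ht
      rw [← lap_hypDeriv hκ ht]
      refine this.congr_deriv ?_
      congr 1
      ext y
      have := hyp_ne_zero hκ y
      simp only [hh₀, smul_eq_mul]
      field_simp
    obtain ⟨c, hc⟩ := isOpen_Ioi.exists_is_const_of_deriv_eq_zero (s := Ioi (0 : ℝ))
      isPreconnected_Ioi (f := lap κ h₀)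
      (fun b hb => (hder b hb).differentiableAt.differentiableWithinAt)
      (fun b hb => (hder b hb).deriv)
    have hlim : Tendsto (lap κ h₀) atTop (𝓝 0) := by
      have h1 : Tendsto (fun t : ℝ => lapConst κ * ((κ / 2 + 1) * (κ / 2)⁻¹) / (1 + t)) atTop
          (𝓝 0) := (tendsto_atTop_add_const_left _ 1 tendsto_id).const_div_atTop _
      refine squeeze_zero_norm' ?_ h1
      filter_upwards [eventually_ge_atTop 1] with t ht
      refine (norm_lap_le hκ hb₀ (by linarith)).trans ?_
      rw [div_eq_mul_one_div _ (1 + t)]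
      have hs : 1 ≤ √t := Real.one_le_sqrt.2 ht
      have := lapConst_nonneg hκ
      gcongr
      nlinarith
    have hc0 : c = 0 := by
      refine tendsto_nhds_unique ?_ hlim
      refine tendsto_const_nhds.congr' ?_
      filter_upwards [eventually_gt_atTop 0] with t ht
      exact (hc t ht).symm
    intro t ht
    rw [hc t ht, hc0]
  have hsplit : ∀ t : ℝ, 0 < t → semigroup κ R t x =
      (2 * Real.pi * Complex.I : ℂ)⁻¹ • (lap κ h₁ t • (x : X) + lap κ h₂ t) := by
    intro t ht
    rw [semigroup, smul_apply, hR.lap_weight_apply ht]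
    congr 1
    have e1 : lap κ h₁ t • (x : X) = lap κ (fun y => (h₁ y + h₀ y) • (x : X)) t := by
      have i1 := integrable_lap hκ hc₁ (fun y => (hb₁ y).trans (hle (by positivity))) ht
      have i0 := integrable_lap hκ hc₀ (fun y => (hb₀ y).trans (hle' (by positivity))) ht
      have : lap κ h₁ t = lap κ (fun y => h₁ y + h₀ y) t := by
        have e := hzero t ht
        simp only [lap, smul_add] at e ⊢
        rw [integral_add i1 i0, e, add_zero]
      rw [this]
      simp only [lap, ← smul_assoc]
      rw [integral_smul_const]
    rw [e1]
    have i2 := integrable_lap hκ hc₂ (fun y => (hb₂ y).trans (hle (by positivity))) ht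
    have i3 : Integrable fun y => Complex.exp (t * hyp κ y) • ((h₁ y + h₀ y) • (x : X)) := by
      refine integrable_lap hκ ((hc₁.add hc₀).smul continuous_const)
        (K := ((κ / 2 + 1) * (2 * κ * (m⁻¹ * (κ / 2)⁻¹)) + (κ / 2 + 1) * (κ / 2)⁻¹) * ‖(x : X)‖)
        (fun y => ?_) ht
      change ‖(h₁ y + h₀ y) • (x : X)‖ ≤ _
      rw [norm_smul]
      gcongr
      exact (norm_add_le _ _).trans (add_le_add ((hb₁ y).trans (hle (by positivity)))
        ((hb₀ y).trans (hle' (by positivity))))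
    simp only [lap]
    rw [← integral_add i3 i2]
    refine integral_congr_ae (Eventually.of_forall fun y => ?_)
    simp only [← smul_add]
    congr 1
    have hmem := hR.hyp_mem (a := 0) (by linarith) y
    simp only [Complex.ofReal_zero, add_zero] at hmem
    have hres := (hR.isResolventAt _ hmem.le).apply_domain (-2 * κ) x
    have hne := hz0 y
    have h4 : R (hyp κ y) x = (hyp κ y + 2 * κ)⁻¹ • ((x : X) + R (hyp κ y) v) := by
      rw [hv, ← hres, smul_smul]
      have : hyp κ y - -2 * κ = hyp κ y + 2 * κ := by ring
      rw [this, inv_mul_cancel₀ hne, one_smul]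
    simp only [weight, hh₁, hh₂, hh₀, smul_apply, h4]
    rw [← mul_add, sub_add_cancel, smul_add, smul_add, mul_smul]
  have hlim1 : Tendsto (lap κ h₁) (𝓝[>] 0) (𝓝 (2 * Real.pi * Complex.I)) := by
    rw [← integral_hyp_residue hκ]
    exact tendsto_lap_zero hκ hc₁ hb₁
  have hlim2 : Tendsto (lap κ h₂) (𝓝[>] 0) (𝓝 0) := by
    have h0 : ∫ y, h₂ y = 0 := by
      have := hR.integral_resolvent_eq_zero
      have hi : Integrable fun y => hypDeriv κ y • ((hyp κ y + 2 * κ)⁻¹ • R (hyp κ y)) := by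
        refine Integrable.mono' (integrable_inv_jb_sq.const_mul ((κ / 2 + 1) * (m⁻¹ * C)))
          (continuous_hypDeriv.smul (hzc.smul hRc)).aestronglyMeasurable
          (Eventually.of_forall fun y => ?_)
        have hj := jb_pos y
        rw [norm_smul, norm_smul]
        calc _ ≤ (κ / 2 + 1) * ((m⁻¹ / jb y) * (C / jb y)) := by
              gcongr
              · exact norm_hypDeriv_le hκ y
              · exact hinv y
              · exact hRn y
          _ = _ := by field_simp
      have h2 := ContinuousLinearMap.integral_apply hi v
      rw [this, zero_apply] at h2
      exact h2.symm
    rw [← h0]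
    exact tendsto_lap_zero hκ hc₂ hb₂
  have hfin := ((hlim1.smul_const (x : X)).add hlim2).const_smul (2 * Real.pi * Complex.I : ℂ)⁻¹
  rw [add_zero, inv_smul_smul₀ Complex.two_pi_I_ne_zero] at hfin
  refine hfin.congr' ?_
  filter_upwards [self_mem_nhdsWithin] with t ht
  exact (hsplit t ht).symm

/-- A bounded backward solution of `w' = L w + f`, with `L` stable, is bounded by the forcing term:
`w(0) = ∫_{-∞}^0 e^{-τ L} f(τ) dτ`. The integral is estimated through the primitive `2 arctan √t` of
the bound `1 / (√t (1 + t))` of the semigroup. -/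
lemma norm_le_of_backward_solution (hR : IsStableResolvent L κ C R) {w f : ℝ → X}
    (hw : ∀ t ≤ 0, ∃ h : w t ∈ L.domain, HasDerivWithinAt w (L ⟨w t, h⟩ + f t) (Iic 0) t)
    {b F : ℝ} (hb : ∀ t ≤ 0, ‖w t‖ ≤ b) (hF : ∀ t ≤ 0, ‖f t‖ ≤ F) :
    ‖w 0‖ ≤ semigroupConst κ C * F * Real.pi := by
  have hF0 : 0 ≤ F := (norm_nonneg _).trans (hF 0 le_rfl)
  have hc0 := hR.semigroupConst_nonneg
  set c := semigroupConst κ C with hc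
  set g : ℝ → X := fun τ => semigroup κ R (-τ) (w τ) with hg
  have hder : ∀ τ < 0, HasDerivAt g (semigroup κ R (-τ) (f τ)) τ := by
    intro τ hτ
    obtain ⟨hd, hw1⟩ := hw τ hτ.le
    have hw2 : HasDerivAt w (L ⟨w τ, hd⟩ + f τ) τ := hw1.hasDerivAt (Iic_mem_nhds hτ)
    have hs : HasDerivAt (fun τ => semigroup κ R (-τ)) (-semigroupDeriv κ R (-τ)) τ := by
      have := (hR.hasDerivAt_semigroup (t := -τ) (by linarith)).scomp τ (hasDerivAt_neg τ)
      simpa [Function.comp_def] using! this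
    have hbil := (isBoundedBilinearMap_apply (𝕜 := ℂ) (E := X) (F := X)).hasFDerivAt
      (semigroup κ R (-τ), w τ)
    have h := (hbil.restrictScalars ℝ).comp_hasDerivAt τ (hs.prodMk hw2)
    refine h.congr_deriv ?_
    change semigroup κ R (-τ) (L ⟨w τ, hd⟩ + f τ) + (-semigroupDeriv κ R (-τ)) (w τ) = _
    have := hR.semigroupDeriv_apply (t := -τ) (by linarith) ⟨w τ, hd⟩
    rw [neg_apply, this, map_add]; abel
  -- the mean value inequality on `[-T, -ε]`
  have hmean : ∀ ε T : ℝ, 0 < ε → ε ≤ T →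
      ‖g (-ε)‖ ≤ c * (1 / (√T * (1 + T))) * b + c * F * Real.pi := by
    intro ε T hε hεT
    have hT : 0 < T := by linarith
    have hgT : ‖g (-T)‖ ≤ c * (1 / (√T * (1 + T))) * b := by
      simp only [hg, neg_neg]
      refine (ContinuousLinearMap.le_opNorm _ _).trans ?_
      exact mul_le_mul (hR.norm_semigroup_le hT) (hb _ (by linarith)) (norm_nonneg _)
        (by positivity)
    have hB : ∀ τ < 0, HasDerivAt (fun τ => -(c * F * (2 * Real.arctan √(-τ))))
        (c * F * (1 / (√(-τ) * (1 + -τ)))) τ := by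
      intro τ hτ
      have hs := ((hasDerivAt_neg τ).sqrt (by linarith)).arctan.const_mul (2 : ℝ)
      have := (hs.const_mul (c * F)).neg
      refine this.congr_deriv ?_
      have h1 : 0 < √(-τ) := Real.sqrt_pos.2 (by linarith)
      have h2 : √(-τ) ^ 2 = -τ := Real.sq_sqrt (by linarith)
      have h3 : 0 < 1 + -τ := by linarith
      rw [h2]; field_simp
    have key := image_norm_le_of_norm_deriv_right_le_deriv_boundary' (f := g) (a := -T) (b := -ε)
      (f' := fun τ => semigroup κ R (-τ) (f τ))
      (B := fun τ => c * (1 / (√T * (1 + T))) * b + c * F * (2 * Real.arctan √T) +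
        -(c * F * (2 * Real.arctan √(-τ))))
      (B' := fun τ => c * F * (1 / (√(-τ) * (1 + -τ))))
      (fun τ hτ => (hder τ (by linarith [hτ.2])).continuousAt.continuousWithinAt)
      (fun τ hτ => (hder τ (by linarith [hτ.2])).hasDerivWithinAt)
      (by simp only [neg_neg]; linarith)
      (fun τ hτ => ((hB τ (by linarith [hτ.2])).const_add _).continuousAt.continuousWithinAt)
      (fun τ hτ => ((hB τ (by linarith [hτ.2])).const_add _).hasDerivWithinAt)
      (fun τ hτ => by
        have hτ0 : τ < 0 := by linarith [hτ.2]
        refine (ContinuousLinearMap.le_opNorm _ _).trans ?_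
        refine (mul_le_mul (hR.norm_semigroup_le (t := -τ) (by linarith)) (hF τ hτ0.le)
          (norm_nonneg _) (by
            have : 0 < 1 + -τ := by linarith
            positivity)).trans (le_of_eq ?_)
        ring)
      (x := -ε) ⟨by linarith, le_rfl⟩
    refine key.trans ?_
    have h1 : Real.arctan √T ≤ Real.pi / 2 := (Real.arctan_lt_pi_div_two _).le
    have h2 : 0 ≤ Real.arctan √(- -ε) := Real.arctan_nonneg.2 (Real.sqrt_nonneg _)
    have h3 : c * F * (2 * Real.arctan √T) ≤ c * F * Real.pi := by
      gcongr; linarith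
    have h4 : 0 ≤ c * F * (2 * Real.arctan √(- -ε)) := by positivity
    linarith
  have hmean2 : ∀ ε : ℝ, 0 < ε → ‖g (-ε)‖ ≤ c * F * Real.pi := by
    intro ε hε
    have hlim : Tendsto (fun T : ℝ => c * (1 / (√T * (1 + T))) * b + c * F * Real.pi) atTop
        (𝓝 (c * F * Real.pi)) := by
      have h1 : Tendsto (fun T : ℝ => √T * (1 + T)) atTop atTop :=
        Real.tendsto_sqrt_atTop.atTop_mul_atTop₀ (tendsto_atTop_add_const_left _ 1 tendsto_id)
      have h2 := ((h1.const_div_atTop 1).const_mul c).mul_const b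
      simpa using h2.add_const (c * F * Real.pi)
    refine ge_of_tendsto hlim ?_
    filter_upwards [eventually_ge_atTop ε] with T hT using hmean ε T hε hT
  -- `g(-ε) → w(0)` because `w` is differentiable at `0`
  obtain ⟨hd, hw0⟩ := hw 0 le_rfl
  have hO : (fun τ => w τ - w 0) =O[𝓝[Iic 0] 0] fun τ => τ - 0 :=
    hw0.differentiableWithinAt.isBigO_sub
  obtain ⟨D, hD0, hD⟩ := hO.exists_pos
  rw [Asymptotics.isBigOWith_iff] at hD
  have hneg : Tendsto (fun ε : ℝ => -ε) (𝓝[>] 0) (𝓝[Iic 0] 0) := by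
    refine tendsto_nhdsWithin_iff.2 ⟨?_, ?_⟩
    · have : Tendsto (fun ε : ℝ => -ε) (𝓝 0) (𝓝 (-0)) := tendsto_neg 0
      rw [neg_zero] at this
      exact this.mono_left nhdsWithin_le_nhds
    · filter_upwards [self_mem_nhdsWithin] with ε hε
      have : 0 < ε := hε
      simp [this.le]
  have hg0 : Tendsto (fun ε : ℝ => g (-ε)) (𝓝[>] 0) (𝓝 (w 0)) := by
    have h1 := hR.tendsto_semigroup ⟨w 0, hd⟩
    have h2 : Tendsto (fun ε : ℝ => semigroup κ R ε (w (-ε) - w 0)) (𝓝[>] 0) (𝓝 0) := by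
      have h3 : Tendsto (fun ε : ℝ => c * D * √ε) (𝓝[>] 0) (𝓝 0) := by
        have : Continuous fun ε : ℝ => c * D * √ε := by fun_prop
        simpa using (this.tendsto 0).mono_left nhdsWithin_le_nhds
      refine squeeze_zero_norm' ?_ h3
      filter_upwards [hneg.eventually hD, self_mem_nhdsWithin] with ε h4 hε
      have hε' : 0 < ε := hε
      have hs : 0 < √ε := Real.sqrt_pos.2 hε'
      rw [sub_zero, norm_neg, Real.norm_of_nonneg hε'.le] at h4
      refine (ContinuousLinearMap.le_opNorm _ _).trans ?_
      calc _ ≤ (c * (1 / (√ε * (1 + ε)))) * (D * ε) :=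
            mul_le_mul (hR.norm_semigroup_le hε') h4 (norm_nonneg _) (by positivity)
        _ = c * D * √ε * (√ε * √ε / ε) * (ε / (√ε * √ε)) * (1 / (1 + ε)) := by
            field_simp
            rw [Real.sq_sqrt hε'.le]
        _ ≤ c * D * √ε := by
            rw [Real.mul_self_sqrt hε'.le, div_self hε'.ne', mul_one, mul_one]
            refine mul_le_of_le_one_right (by positivity) ?_
            rw [div_le_one (by positivity)]; linarith
    have h5 := h1.add h2
    rw [add_zero] at h5
    refine h5.congr fun ε => ?_
    simp only [hg, neg_neg, map_sub]
    abel
  exact le_of_tendsto hg0.norm (by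
    filter_upwards [self_mem_nhdsWithin] with ε hε using hmean2 ε hε)

end IsStableResolvent

end StableEstimate

/-! ### Absolutely summable families -/

noncomputable section Ell

/-- The Banach space `ℓ¹(ι; X)` of absolutely summable families. For `ι = Fin d → ℕ` its elements
are the coefficients of the power series in `d` variables that converge absolutely on the closed
unit polydisk. -/
abbrev Ell (ι X : Type*) [NormedAddCommGroup X] := lp (fun _ : ι => X) 1

variable {ι X Y : Type*} [NormedAddCommGroup X] [NormedSpace ℂ X] [NormedAddCommGroup Y]
  [NormedSpace ℂ Y]

namespace Ell

omit [NormedSpace ℂ X] in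
lemma hasSum_norm (u : Ell ι X) : HasSum (fun i => ‖u i‖) ‖u‖ := by
  simpa using lp.hasSum_norm (p := 1) (by simp) u

omit [NormedSpace ℂ X] in
lemma memℓp_one {u : ι → X} (h : Summable fun i => ‖u i‖) : Memℓp u 1 :=
  memℓp_gen (by simpa using h)

/-- The family with the single entry `x` at `i`, as a bounded operator. -/
abbrev single [DecidableEq ι] (i : ι) : X →L[ℂ] Ell ι X :=
  lp.singleContinuousLinearMap ℂ (fun _ : ι => X) 1 i

lemma norm_single_apply [DecidableEq ι] (i : ι) (x : X) : ‖single i x‖ = ‖x‖ :=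
  lp.norm_single (E := fun _ : ι => X) (by simp) i x

lemma norm_single_le [DecidableEq ι] (i : ι) : ‖(single i : X →L[ℂ] Ell ι X)‖ ≤ 1 :=
  ContinuousLinearMap.opNorm_le_bound _ zero_le_one fun x => by
    rw [norm_single_apply, one_mul]

lemma clm_ext [DecidableEq ι] {f g : Ell ι X →L[ℂ] Y}
    (h : ∀ i x, f (single i x) = g (single i x)) : f = g :=
  lp.ext_continuousLinearMap (by simp) fun i => ContinuousLinearMap.ext (h i)

lemma summable_lift {φ : ι → X →L[ℂ] Y} {K : ℝ} (hφ : ∀ i, ‖φ i‖ ≤ K) (u : Ell ι X) :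
    Summable fun i => ‖φ i (u i)‖ :=
  Summable.of_nonneg_of_le (fun _ => norm_nonneg _)
    (fun i => ((φ i).le_opNorm _).trans (by gcongr; exact hφ i)) ((hasSum_norm u).summable.mul_left K)

variable [CompleteSpace Y]

/-- The universal property of `ℓ¹`: a uniformly bounded family of operators on `X` extends to a
bounded operator on `ℓ¹(ι; X)`. -/
def lift (φ : ι → X →L[ℂ] Y) (K : ℝ) (hφ : ∀ i, ‖φ i‖ ≤ K) : Ell ι X →L[ℂ] Y :=
  LinearMap.mkContinuous
    { toFun := fun u => ∑' i, φ i (u i)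
      map_add' := fun u v => by
        rw [← (summable_lift hφ u).of_norm.tsum_add (summable_lift hφ v).of_norm]
        simp
      map_smul' := fun c u => by
        rw [RingHom.id_apply, ← tsum_const_smul'' c]
        simp }
    K fun u => by
      refine (norm_tsum_le_tsum_norm (summable_lift hφ u)).trans ?_
      rw [← (hasSum_norm u).tsum_eq, ← tsum_mul_left]
      exact (summable_lift hφ u).tsum_le_tsum
        (fun i => ((φ i).le_opNorm _).trans (by gcongr; exact hφ i))
        ((hasSum_norm u).summable.mul_left K)

lemma lift_apply (φ : ι → X →L[ℂ] Y) (K : ℝ) (hφ : ∀ i, ‖φ i‖ ≤ K) (u : Ell ι X) :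
    lift φ K hφ u = ∑' i, φ i (u i) := rfl

lemma lift_single [DecidableEq ι] (φ : ι → X →L[ℂ] Y) (K : ℝ) (hφ : ∀ i, ‖φ i‖ ≤ K) (i : ι)
    (x : X) : lift φ K hφ (single i x) = φ i x := by
  rw [lift_apply, tsum_eq_single i]
  · simp
  · intro j hj
    simp [hj]

lemma norm_lift_le {φ : ι → X →L[ℂ] Y} {K : ℝ} (hφ : ∀ i, ‖φ i‖ ≤ K) (hK : 0 ≤ K) :
    ‖lift φ K hφ‖ ≤ K :=
  LinearMap.mkContinuous_norm_le _ hK _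

omit [CompleteSpace Y] in
lemma memℓp_diag {φ : ι → X →L[ℂ] Y} {K : ℝ} (hφ : ∀ i, ‖φ i‖ ≤ K) (u : Ell ι X) :
    Memℓp (fun i => φ i (u i)) 1 :=
  memℓp_one (summable_lift hφ u)

/-- The operator on `ℓ¹(ι; X)` that applies `φ i` to the entry at `i`. -/
def diag (φ : ι → X →L[ℂ] Y) (K : ℝ) (hφ : ∀ i, ‖φ i‖ ≤ K) : Ell ι X →L[ℂ] Ell ι Y :=
  LinearMap.mkContinuous
    { toFun := fun u => ⟨fun i => φ i (u i), memℓp_diag hφ u⟩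
      map_add' := fun u v => by ext i; exact map_add (φ i) (u i) (v i)
      map_smul' := fun c u => by ext i; exact map_smul (φ i) c (u i) }
    K fun u => by
      rw [← (hasSum_norm u).tsum_eq, ← tsum_mul_left, ← (hasSum_norm _).tsum_eq]
      exact (summable_lift hφ u).tsum_le_tsum
        (fun i => ((φ i).le_opNorm _).trans (by gcongr; exact hφ i))
        ((hasSum_norm u).summable.mul_left K)

omit [CompleteSpace Y] in
@[simp] lemma diag_apply (φ : ι → X →L[ℂ] Y) (K : ℝ) (hφ : ∀ i, ‖φ i‖ ≤ K) (u : Ell ι X) (i : ι) :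
    diag φ K hφ u i = φ i (u i) := rfl

end Ell

/-! ### Power series with absolutely summable coefficients -/

variable {d : ℕ}

/-- The monomial `θ ^ n`. -/
def mon (θ : Fin d → ℂ) (n : Fin d → ℕ) : ℂ := ∏ j, θ j ^ n j

lemma mon_add (θ : Fin d → ℂ) (m n : Fin d → ℕ) : mon θ (m + n) = mon θ m * mon θ n := by
  simp [mon, pow_add, Finset.prod_mul_distrib]

lemma norm_mon_le (θ : Fin d → ℂ) (n : Fin d → ℕ) : ‖mon θ n‖ ≤ ‖θ‖ ^ (∑ j, n j) := by
  rw [mon, norm_prod, ← Finset.prod_pow_eq_pow_sum]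
  refine Finset.prod_le_prod (fun _ _ => norm_nonneg _) fun j _ => ?_
  rw [norm_pow]
  gcongr
  exact norm_le_pi_norm θ j

lemma norm_mon_le_one {θ : Fin d → ℂ} (hθ : ‖θ‖ ≤ 1) (n : Fin d → ℕ) : ‖mon θ n‖ ≤ 1 :=
  (norm_mon_le θ n).trans (pow_le_one₀ (norm_nonneg _) hθ)

/-- The sum of the power series with coefficients `b`. -/
def psum (b : Ell (Fin d → ℕ) X) (θ : Fin d → ℂ) : X := ∑' n, mon θ n • b n

lemma norm_mon_smul_id_le {θ : Fin d → ℂ} (hθ : ‖θ‖ ≤ 1) (n : Fin d → ℕ) :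
    ‖mon θ n • ContinuousLinearMap.id ℂ X‖ ≤ 1 := by
  refine (norm_smul_le (mon θ n) (ContinuousLinearMap.id ℂ X)).trans ?_
  exact mul_le_one₀ (norm_mon_le_one hθ n) (norm_nonneg _) ContinuousLinearMap.norm_id_le

lemma summable_psum (b : Ell (Fin d → ℕ) X) {θ : Fin d → ℂ} (hθ : ‖θ‖ ≤ 1) :
    Summable fun n => ‖mon θ n • b n‖ :=
  Ell.summable_lift (norm_mon_smul_id_le hθ) b

variable [CompleteSpace X]

/-- Evaluation of a power series at a point of the closed unit polydisk, as a bounded operator. -/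
def evalAt (θ : Fin d → ℂ) (hθ : ‖θ‖ ≤ 1) : Ell (Fin d → ℕ) X →L[ℂ] X :=
  Ell.lift (fun n => mon θ n • ContinuousLinearMap.id ℂ X) 1 (norm_mon_smul_id_le hθ)

lemma evalAt_apply (θ : Fin d → ℂ) (hθ : ‖θ‖ ≤ 1) (b : Ell (Fin d → ℕ) X) :
    evalAt θ hθ b = psum b θ := rfl

lemma evalAt_single (θ : Fin d → ℂ) (hθ : ‖θ‖ ≤ 1) (n : Fin d → ℕ) (x : X) :
    evalAt θ hθ (Ell.single n x) = mon θ n • x := by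
  rw [evalAt, Ell.lift_single]; rfl

lemma norm_evalAt_le (θ : Fin d → ℂ) (hθ : ‖θ‖ ≤ 1) :
    ‖(evalAt θ hθ : Ell (Fin d → ℕ) X →L[ℂ] X)‖ ≤ 1 :=
  Ell.norm_lift_le _ zero_le_one

/-- Multiplication of a power series by the monomial `θ ^ m`. -/
def shift (m : Fin d → ℕ) : Ell (Fin d → ℕ) X →L[ℂ] Ell (Fin d → ℕ) X :=
  Ell.lift (fun n => Ell.single (m + n)) 1 fun n => Ell.norm_single_le (m + n)

lemma norm_shift_le (m : Fin d → ℕ) :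
    ‖(shift m : Ell (Fin d → ℕ) X →L[ℂ] Ell (Fin d → ℕ) X)‖ ≤ 1 :=
  Ell.norm_lift_le _ zero_le_one

lemma evalAt_shift (θ : Fin d → ℂ) (hθ : ‖θ‖ ≤ 1) (m : Fin d → ℕ) (b : Ell (Fin d → ℕ) X) :
    evalAt θ hθ (shift m b) = mon θ m • evalAt θ hθ b := by
  have : evalAt θ hθ ∘L shift m = mon θ m • (evalAt θ hθ : Ell (Fin d → ℕ) X →L[ℂ] X) := by
    refine Ell.clm_ext fun n x => ?_
    rw [ContinuousLinearMap.comp_apply, smul_apply, shift, Ell.lift_single, evalAt_single,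
      evalAt_single, mon_add, mul_smul]
  exact congrArg (fun T : Ell (Fin d → ℕ) X →L[ℂ] X => T b) this

omit [CompleteSpace X] in
/-- An extension operator for `k + 1` arguments, from one that treats the first argument separately. -/
lemma exists_uncurry {W : Type*} [NormedAddCommGroup W] [NormedSpace ℂ W] {k : ℕ}
    (F : (X [×(k + 1)]→L[ℂ] X) → W →L[ℂ] (W [×k]→L[ℂ] W)) (hF : ∀ p, ‖F p‖ ≤ ‖p‖)
    (hadd : ∀ p q, F (p + q) = F p + F q) (hsmul : ∀ (c : ℂ) p, F (c • p) = c • F p) :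
    ∃ E : (X [×(k + 1)]→L[ℂ] X) →L[ℂ] (W [×(k + 1)]→L[ℂ] W),
      (∀ p, ‖E p‖ ≤ ‖p‖) ∧ ∀ p v, E p v = F p (v 0) (Fin.tail v) := by
  let cW := continuousMultilinearCurryLeftEquiv ℂ (fun _ : Fin (k + 1) => W) W
  have hn : ∀ p, ‖cW.symm (F p)‖ ≤ ‖p‖ := fun p => (cW.symm.norm_map (F p)).trans_le (hF p)
  exact ⟨LinearMap.mkContinuous
    { toFun := fun p => cW.symm (F p)
      map_add' := fun p q => by rw [hadd, cW.symm.map_add]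
      map_smul' := fun c p => by rw [hsmul, cW.symm.map_smul, RingHom.id_apply] }
    1 fun p => (hn p).trans_eq (one_mul _).symm, hn, fun p v => rfl⟩

/-- Every bounded multilinear map on `X` extends to a bounded multilinear map on power series with
coefficients in `X`, linearly and without increase of the norm, by convolution of the coefficients.
The extension is built one argument at a time. -/
lemma exists_multilinear_extension (k : ℕ) :
    ∃ E : (X [×k]→L[ℂ] X) →L[ℂ] (Ell (Fin d → ℕ) X [×k]→L[ℂ] Ell (Fin d → ℕ) X),
      (∀ p, ‖E p‖ ≤ ‖p‖) ∧ ∀ p (θ : Fin d → ℂ) (hθ : ‖θ‖ ≤ 1) v,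
        evalAt θ hθ (E p v) = p fun i => evalAt θ hθ (v i) := by
  induction k with
  | zero =>
    let cW := continuousMultilinearCurryFin0 ℂ (Ell (Fin d → ℕ) X) (Ell (Fin d → ℕ) X)
    refine ⟨cW.symm.toContinuousLinearEquiv.toContinuousLinearMap ∘L
        (Ell.single 0) ∘L
      (continuousMultilinearCurryFin0 ℂ X X).toContinuousLinearEquiv.toContinuousLinearMap,
      fun p => ?_, fun p θ hθ v => ?_⟩
    · change ‖cW.symm (Ell.single 0 (continuousMultilinearCurryFin0 ℂ X X p))‖ ≤ _
      rw [LinearIsometryEquiv.norm_map, Ell.norm_single_apply, LinearIsometryEquiv.norm_map]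
    · change evalAt θ hθ (Ell.single 0 (p 0)) = _
      rw [evalAt_single]
      simp [mon]
      congr 1
      exact Subsingleton.elim _ _
  | succ k ih =>
    obtain ⟨E, hE, hev⟩ := ih
    have hEn : ‖E‖ ≤ 1 := ContinuousLinearMap.opNorm_le_bound _ zero_le_one fun p => by
      rw [one_mul]; exact hE p
    let cX := continuousMultilinearCurryLeftEquiv ℂ (fun _ : Fin (k + 1) => X) X
    let sh : (Fin d → ℕ) → (Ell (Fin d → ℕ) X [×k]→L[ℂ] Ell (Fin d → ℕ) X) →L[ℂ]
        (Ell (Fin d → ℕ) X [×k]→L[ℂ] Ell (Fin d → ℕ) X) := fun m =>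
      ContinuousLinearMap.compContinuousMultilinearMapL ℂ (fun _ : Fin k => Ell (Fin d → ℕ) X)
        (Ell (Fin d → ℕ) X) (Ell (Fin d → ℕ) X) (shift m)
    have hsh : ∀ m q, ‖sh m q‖ ≤ ‖q‖ := fun m q =>
      (ContinuousLinearMap.norm_compContinuousMultilinearMap_le _ _).trans
        (mul_le_of_le_one_left (norm_nonneg _) (norm_shift_le m))
    let φ : (X [×(k + 1)]→L[ℂ] X) → (Fin d → ℕ) →
        X →L[ℂ] (Ell (Fin d → ℕ) X [×k]→L[ℂ] Ell (Fin d → ℕ) X) := fun p m =>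
      sh m ∘L E ∘L cX p
    have hφ : ∀ p m, ‖φ p m‖ ≤ ‖p‖ := fun p m =>
      ContinuousLinearMap.opNorm_le_bound _ (norm_nonneg _) fun x => by
        refine (hsh m _).trans ((hE _).trans ?_)
        refine ((cX p).le_opNorm x).trans ?_
        rw [cX.norm_map]
    let F : (X [×(k + 1)]→L[ℂ] X) → Ell (Fin d → ℕ) X →L[ℂ]
        (Ell (Fin d → ℕ) X [×k]→L[ℂ] Ell (Fin d → ℕ) X) := fun p => Ell.lift (φ p) ‖p‖ (hφ p)
    have hF : ∀ p, ‖F p‖ ≤ ‖p‖ := fun p => Ell.norm_lift_le _ (norm_nonneg _)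
    have hadd : ∀ p q, F (p + q) = F p + F q := fun p q => Ell.clm_ext fun m x => by
      rw [add_apply]
      simp only [F, Ell.lift_single]
      simp only [φ, map_add, ContinuousLinearMap.comp_add, add_apply]
    have hsmul : ∀ (c : ℂ) p, F (c • p) = c • F p := fun c p => Ell.clm_ext fun m x => by
      rw [smul_apply]
      simp only [F, Ell.lift_single]
      simp only [φ, map_smul, ContinuousLinearMap.comp_smul, smul_apply]
    obtain ⟨E', hE', hE'F⟩ := exists_uncurry F hF hadd hsmul
    refine ⟨E', hE', fun p θ hθ v => ?_⟩
    · rw [hE'F]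
      let t : Fin k → X := fun i => evalAt θ hθ (Fin.tail v i)
      have key : evalAt θ hθ ∘L (ContinuousMultilinearMap.apply ℂ
          (fun _ : Fin k => Ell (Fin d → ℕ) X) (Ell (Fin d → ℕ) X) (Fin.tail v)) ∘L F p =
          (ContinuousMultilinearMap.apply ℂ (fun _ : Fin k => X) X t) ∘L cX p ∘L
            evalAt θ hθ := by
        refine Ell.clm_ext fun m x => ?_
        simp only [ContinuousLinearMap.comp_apply, evalAt_single, map_smul]
        change evalAt θ hθ ((Ell.lift (φ p) ‖p‖ (hφ p) (Ell.single m x)) (Fin.tail v)) =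
          (mon θ m • (cX p x)) t
        rw [Ell.lift_single]
        change evalAt θ hθ (shift m (E (cX p x) (Fin.tail v))) = _
        rw [evalAt_shift, hev]
        rfl
      have h2 := congrArg (fun T : Ell (Fin d → ℕ) X →L[ℂ] X => T (v 0)) key
      refine h2.trans ?_
      change p (Fin.cons (evalAt θ hθ (v 0)) t) = _
      congr 1
      ext i
      refine Fin.cases ?_ (fun j => ?_) i <;> rfl

/-- Substitution of power series into an analytic nonlinearity. If `G` is analytic at `x₀`, then its
nonlinear part `x ↦ G (x₀ + x) - G x₀ - DG(x₀) x` acts on small power series, and this action is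
strictly differentiable at `0` with derivative `0`. -/
lemma exists_nonlinear_extension {G : X → X} {x₀ : X} (hG : AnalyticAt ℂ G x₀) (d : ℕ) :
    ∃ (r : ℝ) (N : Ell (Fin d → ℕ) X → Ell (Fin d → ℕ) X), 0 < r ∧ N 0 = 0 ∧
      HasStrictFDerivAt N (0 : Ell (Fin d → ℕ) X →L[ℂ] Ell (Fin d → ℕ) X) 0 ∧
      ∀ u, ‖u‖ < r → ∀ θ, ‖θ‖ ≤ 1 →
        psum (N u) θ = G (x₀ + psum u θ) - G x₀ - fderiv ℂ G x₀ (psum u θ) := by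
  obtain ⟨p, r', hp⟩ := hG
  choose E hE hev using exists_multilinear_extension (X := X) (d := d)
  set q : FormalMultilinearSeries ℂ (Ell (Fin d → ℕ) X) (Ell (Fin d → ℕ) X) :=
    fun k => E k (p k) with hq
  have hrad : p.radius ≤ q.radius := FormalMultilinearSeries.radius_le_of_le fun k => hE k (p k)
  have hqr : 0 < q.radius := (hp.r_pos.trans_le hp.r_le).trans_le hrad
  have hqs := q.hasFPowerSeriesOnBall hqr
  obtain ⟨r, hr0, hr⟩ := ENNReal.lt_iff_exists_real_btwn.1 hp.r_pos
  have hr0' : 0 < r := by simpa using hr.1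
  have hevq : ∀ u : Ell (Fin d → ℕ) X, ‖u‖ < r → ∀ θ (hθ : ‖θ‖ ≤ 1),
      evalAt θ hθ (q.sum u) = G (x₀ + evalAt θ hθ u) := by
    intro u hu θ hθ
    have hmem : ∀ {Z : Type _} [NormedAddCommGroup Z] (z : Z), ‖z‖ < r →
        z ∈ Metric.eball (0 : Z) r' := by
      intro Z _ z hz
      rw [Metric.mem_eball, edist_zero_right]
      refine lt_trans ?_ hr.2
      rw [← ofReal_norm]
      exact (ENNReal.ofReal_lt_ofReal_iff hr0').2 hz
    have h1 : HasSum (fun n => q n fun _ => u) (q.sum u) := by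
      have := hqs.hasSum (y := u) (Metric.eball_subset_eball (hp.r_le.trans hrad) (hmem u hu))
      simpa using this
    have h2 := h1.mapL (evalAt θ hθ)
    have hu' : ‖evalAt θ hθ u‖ < r := by
      refine lt_of_le_of_lt ?_ hu
      refine ((evalAt θ hθ).le_opNorm u).trans ?_
      exact mul_le_of_le_one_left (norm_nonneg _) (norm_evalAt_le θ hθ)
    have h3 := hp.hasSum (hmem _ hu')
    refine h2.unique ?_
    convert h3 using 2 with n
    exact hev n (p n) θ hθ _
  set D := continuousMultilinearCurryFin1 ℂ (Ell (Fin d → ℕ) X) (Ell (Fin d → ℕ) X) (q 1) with hD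
  have hDer : HasStrictFDerivAt q.sum D 0 := hqs.hasFPowerSeriesAt.hasStrictFDerivAt
  refine ⟨r, fun u => q.sum u - q.sum 0 - D u, hr0', by simp, ?_, fun u hu θ hθ => ?_⟩
  · have := (hDer.sub_const (q.sum 0)).sub D.hasStrictFDerivAt
    rwa [sub_self] at this
  · rw [← evalAt_apply θ hθ, map_sub, map_sub, hevq u hu θ hθ,
      hevq 0 (by simpa using hr0') θ hθ, map_zero, add_zero, ← evalAt_apply θ hθ,
      hp.hasFPowerSeriesAt.fderiv_eq]
    congr 1
    exact hev 1 (p 1) θ hθ _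

end Ell

noncomputable section PowerSeries

variable {X : Type*} [NormedAddCommGroup X] [NormedSpace ℂ X] {d : ℕ}

/-! ### Sums of power series: analyticity, derivatives, uniqueness, expansions -/

/-- The word `0…0 1…1 ⋯` in which the letter `j` occurs `m j` times turns products over words into
monomials. -/
lemma exists_word (m : Fin d → ℕ) {n : ℕ} (hm : ∑ j, m j = n) :
    ∃ w : Fin n → Fin d, ∀ θ : Fin d → ℂ, ∏ i, θ (w i) = mon θ m := by
  subst hm
  set s : Multiset (Fin d) := ∑ j, Multiset.replicate (m j) j with hs
  have hcard : s.toList.length = ∑ j, m j := by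
    simp [hs]
  refine ⟨fun i => s.toList.get (i.cast hcard.symm), fun θ => ?_⟩
  have h1 : (s.map θ).prod = mon θ m := by
    have h2 : s.map θ = ∑ j, (Multiset.replicate (m j) j).map θ :=
      map_sum (Multiset.mapAddMonoidHom θ) _ _
    rw [h2, Multiset.prod_sum]
    simp [mon]
  rw [← h1]
  conv_rhs => rw [← Multiset.coe_toList s]
  rw [Multiset.map_coe, Multiset.prod_coe, ← List.prod_ofFn]
  congr 1
  refine List.ext_get (by simp [hcard]) fun i h₁ h₂ => ?_
  simp

variable (X) in
/-- The `n`-th term of the formal multilinear series of a power series. -/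
lemma exists_monomial_map (m : Fin d → ℕ) {n : ℕ} (hm : ∑ j, m j = n) (x : X) :
    ∃ p : (Fin d → ℂ) [×n]→L[ℂ] X, ‖p‖ ≤ ‖x‖ ∧ ∀ θ, p (fun _ => θ) = mon θ m • x := by
  obtain ⟨w, hw⟩ := exists_word m hm
  let q : (Fin d → ℂ) [×n]→L[ℂ] ℂ := (ContinuousMultilinearMap.mkPiAlgebra ℂ (Fin n) ℂ
    ).compContinuousLinearMap fun i => ContinuousLinearMap.proj (w i)
  refine ⟨q.smulRight x, ?_, fun θ => ?_⟩
  · refine ContinuousMultilinearMap.opNorm_le_bound (norm_nonneg _) fun v => ?_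
    have : q v = ∏ i, v i (w i) := by simp [q]
    rw [ContinuousMultilinearMap.smulRight_apply, this, norm_smul, mul_comm, norm_prod]
    gcongr with i
    exact norm_le_pi_norm (v i) (w i)
  · rw [ContinuousMultilinearMap.smulRight_apply, ← hw θ]
    simp [q]

variable [CompleteSpace X]

/-- A power series with absolutely summable coefficients has a formal multilinear series on the open
unit polydisk, the unit ball of `ℂᵈ` for the supremum norm. -/
lemma exists_hasFPowerSeriesOnBall_psum (b : Ell (Fin d → ℕ) X) :
    ∃ p : FormalMultilinearSeries ℂ (Fin d → ℂ) X, HasFPowerSeriesOnBall (psum b) p 0 1 ∧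
      ∀ n θ, p n (fun _ => θ) = ∑ m ∈ Finset.piAntidiag Finset.univ n, mon θ m • b m := by
  have hmem : ∀ n (m : Fin d → ℕ), m ∈ Finset.piAntidiag Finset.univ n → ∑ j, m j = n := by
    intro n m hm; simpa using hm
  choose! q hq hqv using fun n (m : Fin d → ℕ) (hm : m ∈ Finset.piAntidiag Finset.univ n) =>
    exists_monomial_map X m (hmem n m hm) (b m)
  set p : FormalMultilinearSeries ℂ (Fin d → ℂ) X :=
    fun n => ∑ m ∈ Finset.piAntidiag Finset.univ n, q n m with hp
  have hpv : ∀ n θ, p n (fun _ => θ) = ∑ m ∈ Finset.piAntidiag Finset.univ n, mon θ m • b m := by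
    intro n θ
    rw [hp, sum_apply]
    exact Finset.sum_congr rfl fun m hm => hqv n m hm θ
  refine ⟨p, ⟨?_, one_pos, ?_⟩, hpv⟩
  · refine p.le_radius_of_bound ‖b‖ (r := 1) fun n => ?_
    rw [NNReal.coe_one, one_pow, mul_one]
    calc ‖p n‖ ≤ ∑ m ∈ Finset.piAntidiag Finset.univ n, ‖q n m‖ := norm_sum_le _ _
      _ ≤ ∑ m ∈ Finset.piAntidiag Finset.univ n, ‖b m‖ := Finset.sum_le_sum fun m hm => hq n m hm
      _ ≤ ‖b‖ := sum_le_hasSum _ (fun _ _ => norm_nonneg _) (Ell.hasSum_norm b)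
  · intro y hy
    have hy1 : ‖y‖ ≤ 1 := by
      rw [Metric.mem_eball, edist_zero_right, ← ofReal_norm, ENNReal.ofReal_lt_one] at hy
      exact hy.le
    rw [zero_add]
    have h1 : HasSum (fun m => mon y m • b m) (psum b y) := (summable_psum b hy1).of_norm.hasSum
    have h2 := (Equiv.sigmaFiberEquiv fun m : Fin d → ℕ => ∑ j, m j).hasSum_iff.2 h1
    refine h2.sigma fun n => ?_
    rw [hpv]
    have h3 := Finset.hasSum (Finset.piAntidiag Finset.univ n) fun m : Fin d → ℕ => mon y m • b m
    have e : {m : Fin d → ℕ // ∑ j, m j = n} ≃ {m // m ∈ Finset.piAntidiag Finset.univ n} :=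
      Equiv.subtypeEquivRight fun m => by simp
    let e' : {m : Fin d → ℕ // ∑ j, m j = n} ≃
        {m : Fin d → ℕ // m ∈ Finset.piAntidiag Finset.univ n} :=
      Equiv.subtypeEquivRight fun m => by simp
    exact e'.hasSum_iff.2 h3

lemma analyticOnNhd_psum (b : Ell (Fin d → ℕ) X) :
    AnalyticOnNhd ℂ (psum b) (Metric.ball 0 1) := by
  obtain ⟨p, hp, -⟩ := exists_hasFPowerSeriesOnBall_psum b
  have := hp.analyticOnNhd
  rwa [← ENNReal.ofReal_one, Metric.eball_ofReal] at this

/-- The coefficients of a power series are determined by its sum. -/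
lemma eq_zero_of_psum_eq_zero {b : Ell (Fin d → ℕ) X}
    (h : ∀ θ : Fin d → ℂ, ‖θ‖ < 1 → psum b θ = 0) : b = 0 := by
  obtain ⟨p, hp, hpv⟩ := exists_hasFPowerSeriesOnBall_psum b
  have h0 : HasFPowerSeriesAt (0 : (Fin d → ℂ) → X) p 0 := by
    refine hp.hasFPowerSeriesAt.congr ?_
    filter_upwards [Metric.ball_mem_nhds (0 : Fin d → ℂ) one_pos] with θ hθ
    exact h θ (by simpa using hθ)
  ext m
  set n := ∑ j, m j with hn
  -- the homogeneous component of degree `n` vanishes as a polynomial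
  refine (SeparatingDual.eq_zero_iff_forall_dual_eq_zero (R := ℂ) _).2 fun f => ?_
  let toF : (Fin d → ℕ) ≃ (Fin d →₀ ℕ) := Finsupp.equivFunOnFinite.symm
  let Q : MvPolynomial (Fin d) ℂ :=
    ∑ k ∈ Finset.piAntidiag Finset.univ n, MvPolynomial.monomial (toF k) (f (b k))
  have hQ : Q = 0 := by
    refine MvPolynomial.funext fun θ => ?_
    have h1 := congrArg f (hpv n θ)
    rw [h0.apply_eq_zero n θ, map_zero, map_sum] at h1
    rw [map_zero, map_sum, h1]
    refine Finset.sum_congr rfl fun k _ => ?_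
    rw [MvPolynomial.eval_monomial, map_smul, smul_eq_mul, mul_comm, mon]
    congr 1
    rw [Finsupp.prod_fintype _ _ fun i => pow_zero _]
    rfl
  have hc := congrArg (MvPolynomial.coeff (toF m)) hQ
  rw [MvPolynomial.coeff_zero, MvPolynomial.coeff_sum,
    Finset.sum_eq_single m] at hc
  · simpa using! hc
  · intro k _ hk
    rw [MvPolynomial.coeff_monomial, if_neg fun h => hk (toF.injective h)]
  · intro hm
    exact absurd (by simp [hn]) hm

lemma norm_basis_le_one (j : Fin d) : ‖(Pi.single j 1 : Fin d → ℂ)‖ ≤ 1 :=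
  (pi_norm_le_iff_of_nonneg zero_le_one).2 fun i => by
    rcases eq_or_ne i j with rfl | h
    · simp
    · simp [h]

/-- The derivative of a power series at `0`. -/
lemma fderiv_psum_zero (b : Ell (Fin d → ℕ) X) (j : Fin d) :
    fderiv ℂ (psum b) 0 (Pi.single j 1) = b (Pi.single j 1) := by
  have hder : DifferentiableAt ℂ (psum b) 0 :=
    (analyticOnNhd_psum b 0 (by simp)).differentiableAt
  -- differentiate along the line through the basis vector
  have h1 : HasDerivAt (fun t : ℂ => psum b (t • (Pi.single j 1 : Fin d → ℂ)))
      (fderiv ℂ (psum b) 0 (Pi.single j 1)) 0 := by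
    have h2 : HasDerivAt (fun t : ℂ => t • (Pi.single j 1 : Fin d → ℂ)) (Pi.single j 1) 0 := by
      simpa using (hasDerivAt_id (0 : ℂ)).smul_const (Pi.single j 1 : Fin d → ℂ)
    have h3 : HasFDerivAt (psum b) (fderiv ℂ (psum b) 0) ((0 : ℂ) • (Pi.single j 1 : Fin d → ℂ)) := by
      rw [zero_smul]; exact hder.hasFDerivAt
    exact h3.comp_hasDerivAt 0 h2
  have h4 : HasDerivAt (fun t : ℂ => psum b (t • (Pi.single j 1 : Fin d → ℂ)))
      (b (Pi.single j 1)) 0 := by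
    have hnorm : ‖(Pi.single j 1 : Fin d → ℂ)‖ ≤ 1 := norm_basis_le_one j
    -- remove the terms of degree at most `1` from the series
    set c : Ell (Fin d → ℕ) X := b - Ell.single 0 (b 0) - Ell.single (Pi.single j 1) (b (Pi.single j 1))
      with hc
    have hsplit : ∀ t : ℂ, ‖t‖ ≤ 1 → psum b (t • (Pi.single j 1 : Fin d → ℂ)) =
        psum c (t • (Pi.single j 1 : Fin d → ℂ)) + b 0 + t • b (Pi.single j 1) := by
      intro t ht
      have hθ : ‖t • (Pi.single j 1 : Fin d → ℂ)‖ ≤ 1 := by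
        rw [norm_smul]; exact mul_le_one₀ ht (norm_nonneg _) hnorm
      rw [← evalAt_apply _ hθ, ← evalAt_apply _ hθ, hc, map_sub, map_sub, evalAt_single,
        evalAt_single]
      have e1 : mon (t • (Pi.single j 1 : Fin d → ℂ)) 0 = 1 := by simp [mon]
      have e2 : mon (t • (Pi.single j 1 : Fin d → ℂ)) (Pi.single j 1) = t := by
        rw [mon, Finset.prod_eq_single j]
        · simp
        · intro i _ hi; simp [hi]
        · simp
      rw [e1, e2, one_smul]; abel
    have hquad : ∀ t : ℂ, ‖t‖ ≤ 1 →
        ‖psum c (t • (Pi.single j 1 : Fin d → ℂ))‖ ≤ ‖t‖ ^ 2 * ‖c‖ := by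
      intro t ht
      have hθ : ‖t • (Pi.single j 1 : Fin d → ℂ)‖ ≤ ‖t‖ := by
        rw [norm_smul]; exact mul_le_of_le_one_right (norm_nonneg _) hnorm
      refine tsum_of_norm_bounded ((Ell.hasSum_norm c).mul_left (‖t‖ ^ 2)) fun m => ?_
      rw [norm_smul]
      by_cases hm : ∃ i, i ≠ j ∧ m i ≠ 0
      · obtain ⟨i, hi, hmi⟩ := hm
        have : mon (t • (Pi.single j 1 : Fin d → ℂ)) m = 0 :=
          Finset.prod_eq_zero (Finset.mem_univ i) (by simp [hi, hmi])
        rw [this, norm_zero, zero_mul]; positivity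
      · push Not at hm
        have hmj : m = Pi.single j (m j) := by
          ext i
          rcases eq_or_ne i j with rfl | hi
          · simp
          · simp [hi, hm i hi]
        rcases Nat.lt_or_ge (m j) 2 with h2 | h2
        · have hcm : c m = 0 := by
            rcases Nat.lt_or_ge (m j) 1 with h1 | h1
            · have : m = 0 := by rw [hmj, Nat.lt_one_iff.1 h1]; simp
              have h01 : (0 : Fin d → ℕ) ≠ Pi.single j 1 := by
                intro h; have := congrFun h j; simp at this
              rw [hc, this]
              simp [h01]
            · have : m = Pi.single j 1 := by rw [hmj, le_antisymm (Nat.lt_succ_iff.1 h2) h1]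
              have h01 : (Pi.single j 1 : Fin d → ℕ) ≠ 0 := by
                intro h; have := congrFun h j; simp at this
              rw [hc, this]
              simp [h01]
          rw [hcm, norm_zero, mul_zero, mul_zero]
        · gcongr
          refine (norm_mon_le _ _).trans ?_
          have hsum : 2 ≤ ∑ i, m i := h2.trans (Finset.single_le_sum (fun _ _ => Nat.zero_le _)
            (Finset.mem_univ j))
          calc _ ≤ ‖t‖ ^ (∑ i, m i) := by gcongr
            _ ≤ ‖t‖ ^ 2 := pow_le_pow_of_le_one (norm_nonneg _) ht hsum
    have hc0 : HasDerivAt (fun t : ℂ => psum c (t • (Pi.single j 1 : Fin d → ℂ))) 0 0 := by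
      have hz : psum c ((0 : ℂ) • (Pi.single j 1 : Fin d → ℂ)) = 0 := by
        have := hquad 0 (by simp)
        simpa using this
      rw [hasDerivAt_iff_isLittleO]
      simp only [hz, sub_zero, smul_zero]
      refine Asymptotics.IsBigO.trans_isLittleO (g := fun t : ℂ => t ^ 2) ?_ ?_
      · refine Asymptotics.IsBigO.of_bound ‖c‖ ?_
        filter_upwards [Metric.closedBall_mem_nhds (0 : ℂ) one_pos] with t ht
        rw [norm_pow, mul_comm]
        exact hquad t (by simpa using ht)
      · simpa using Asymptotics.isLittleO_pow_pow (𝕜 := ℂ) (m := 1) (n := 2) one_lt_two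
    have hlin : HasDerivAt (fun t : ℂ => t • b (Pi.single j 1)) (b (Pi.single j 1)) 0 := by
      simpa using (hasDerivAt_id (0 : ℂ)).smul_const (b (Pi.single j 1))
    have := (hc0.add_const (b 0)).add hlin
    rw [zero_add] at this
    refine this.congr_of_eventuallyEq ?_
    filter_upwards [Metric.closedBall_mem_nhds (0 : ℂ) one_pos] with t ht
    exact hsplit t (by simpa using ht)
  exact h1.unique h4

/-- The exponent `⟨n, λ⟩` of the monomial `θ ^ n` under the linear flow with rates `λ`. -/
def wt (lam : Fin d → ℝ) (n : Fin d → ℕ) : ℝ := ∑ j, n j * lam j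

lemma mon_flow (lam : Fin d → ℝ) (n : Fin d → ℕ) (θ : Fin d → ℂ) (t : ℝ) :
    mon (fun j => (Real.exp (lam j * t) : ℂ) * θ j) n = Real.exp (wt lam n * t) * mon θ n := by
  simp only [mon, mul_pow, Finset.prod_mul_distrib]
  congr 1
  rw [wt, Finset.sum_mul, Real.exp_sum]
  push_cast
  refine Finset.prod_congr rfl fun j _ => ?_
  rw [← Complex.exp_nat_mul]
  congr 1; ring

lemma hasDerivAt_flow (lam : Fin d → ℝ) (θ : Fin d → ℂ) (t : ℝ) :
    HasDerivAt (fun t : ℝ => fun j => (Real.exp (lam j * t) : ℂ) * θ j)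
      (fun j => (lam j : ℂ) * ((Real.exp (lam j * t) : ℂ) * θ j)) t := by
  refine hasDerivAt_pi.2 fun j => ?_
  have h1 : HasDerivAt (fun t : ℝ => Real.exp (lam j * t)) (Real.exp (lam j * t) * (lam j * 1)) t :=
    ((hasDerivAt_id t).const_mul (lam j)).exp
  refine (h1.ofReal_comp.mul_const (θ j)).congr_deriv ?_
  push_cast; ring

lemma continuous_flow (lam : Fin d → ℝ) (θ : Fin d → ℂ) :
    Continuous fun t : ℝ => fun j => (Real.exp (lam j * t) : ℂ) * θ j :=
  continuous_iff_continuousAt.2 fun t => (hasDerivAt_flow lam θ t).continuousAt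

/-- The derivative of a power series along the linear vector field with rates `λ` multiplies the
coefficients by `⟨n, λ⟩`. -/
lemma fderiv_psum_flow (lam : Fin d → ℝ) {b c : Ell (Fin d → ℕ) X}
    (hc : ∀ n, c n = (wt lam n : ℂ) • b n) {θ : Fin d → ℂ} (hθ : ‖θ‖ < 1) :
    fderiv ℂ (psum b) θ (fun j => (lam j : ℂ) * θ j) = psum c θ := by
  have hder : DifferentiableAt ℂ (psum b) θ :=
    (analyticOnNhd_psum b θ (by simpa using hθ)).differentiableAt
  set flow : ℝ → Fin d → ℂ := fun t j => (Real.exp (lam j * t) : ℂ) * θ j with hflow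
  have hflow0 : flow 0 = θ := by ext j; simp [hflow]
  have h1 : HasDerivAt (fun t : ℝ => psum b (flow t))
      (fderiv ℂ (psum b) θ (fun j => (lam j : ℂ) * θ j)) 0 := by
    have h2 := hasDerivAt_flow lam θ 0
    have h3 : HasFDerivAt (psum b) (fderiv ℂ (psum b) θ) (flow 0) := by
      rw [hflow0]; exact hder.hasFDerivAt
    have := (h3.restrictScalars ℝ).comp_hasDerivAt (0 : ℝ) h2
    simpa [Function.comp_def] using! this
  obtain ⟨ε, hε, hball⟩ : ∃ ε > 0, ∀ t ∈ Metric.ball (0 : ℝ) ε, ‖flow t‖ < 1 := by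
    have hopen : IsOpen {t : ℝ | ‖flow t‖ < 1} :=
      isOpen_lt (continuous_flow lam θ).norm continuous_const
    obtain ⟨ε, hε, h⟩ := Metric.isOpen_iff.1 hopen 0 (by simpa [hflow0] using hθ)
    exact ⟨ε, hε, fun t ht => h ht⟩
  have h4 : HasDerivAt (fun t : ℝ => ∑' n, mon (flow t) n • b n)
      (∑' n, mon (flow 0) n • c n) 0 := by
    refine hasDerivAt_tsum_of_isPreconnected (u := fun n => ‖c n‖) (t := Metric.ball (0 : ℝ) ε)
      (g' := fun n t => mon (flow t) n • c n) (y₀ := 0)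
      (Ell.hasSum_norm c).summable Metric.isOpen_ball (convex_ball _ _).isPreconnected
      (fun n t ht => ?_) (fun n t ht => ?_) (Metric.mem_ball_self hε)
      (summable_psum b (hball 0 (Metric.mem_ball_self hε)).le).of_norm (Metric.mem_ball_self hε)
    · simp only [hflow, mon_flow]
      have h5 : HasDerivAt (fun t : ℝ => Real.exp (wt lam n * t))
          (Real.exp (wt lam n * t) * (wt lam n * 1)) t :=
        ((hasDerivAt_id t).const_mul (wt lam n)).exp
      refine ((h5.ofReal_comp.mul_const (mon θ n)).smul_const (b n)).congr_deriv ?_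
      rw [hc n, smul_smul]
      congr 1
      push_cast; ring
    · rw [norm_smul]
      exact mul_le_of_le_one_left (norm_nonneg _) (norm_mon_le_one (hball t ht).le n)
  rw [hflow0] at h4
  exact h1.unique h4

/-- A function that is analytic at `0` and vanishes there is, on small polydisks, the sum of a power
series with small absolutely summable coefficients. -/
lemma exists_psum_eq {q : (Fin d → ℂ) → X} (hq : AnalyticAt ℂ q 0) (hq0 : q 0 = 0) {ε : ℝ}
    (hε : 0 < ε) : ∃ ρ₀ : ℝ, 0 < ρ₀ ∧ ∀ ρ : ℝ, 0 < ρ → ρ ≤ ρ₀ → ∃ b : Ell (Fin d → ℕ) X, ‖b‖ < ε ∧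
      ∀ θ : Fin d → ℂ, ‖θ‖ ≤ 1 → psum b θ = q ((ρ : ℂ) • θ) := by
  obtain ⟨p, r, hp⟩ := hq
  obtain ⟨r₀, hr₀, hr⟩ := ENNReal.lt_iff_exists_nnreal_btwn.1 hp.r_pos
  have hr₀' : (0 : ℝ) < r₀ := by simpa using hr₀
  obtain ⟨C, hC, hpC⟩ := p.norm_mul_pow_le_of_lt_radius (hr.trans_le hp.r_le)
  refine ⟨min (r₀ / (2 * (d + 1))) (r₀ * ε / (4 * C * (d + 1))), by positivity, fun ρ hρ hρ₀ => ?_⟩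
  have hρ1 := hρ₀.trans (min_le_left _ _)
  have hρ2 := hρ₀.trans (min_le_right _ _)
  set x : ℝ := (d + 1) * ρ / r₀ with hx
  have hx0 : 0 < x := by positivity
  have hx1 : x ≤ 1 / 2 := by
    rw [hx, div_le_iff₀ hr₀']
    rw [le_div_iff₀ (by positivity)] at hρ1
    linarith
  have hx2 : C * x ≤ ε / 4 := by
    rw [hx, mul_div_assoc', div_le_iff₀ hr₀']
    rw [le_div_iff₀ (by positivity)] at hρ2
    linarith
  have hρr : ρ < r₀ := by
    have : ρ * (2 * (d + 1)) ≤ r₀ := by rwa [le_div_iff₀ (by positivity)] at hρ1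
    have hd : (0 : ℝ) ≤ d := Nat.cast_nonneg d
    nlinarith
  -- the coefficients of degree `n`, summed over words
  let content : ∀ n, (Fin n → Fin d) → Fin d → ℕ := fun n w j => (Finset.univ.filter (w · = j)).card
  have hcontent : ∀ n (w : Fin n → Fin d) (θ : Fin d → ℂ), mon θ (content n w) = ∏ i, θ (w i) := by
    intro n w θ
    rw [mon]
    exact (Finset.prod_comp θ w).symm ▸ (Finset.prod_subset (Finset.subset_univ _) fun j _ hj => by
      have : (Finset.univ.filter (w · = j)) = ∅ := by
        rw [Finset.filter_eq_empty_iff]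
        intro i _ hi
        exact hj (Finset.mem_image.2 ⟨i, Finset.mem_univ _, hi⟩)
      change θ j ^ (Finset.univ.filter (w · = j)).card = 1
      rw [this, Finset.card_empty, pow_zero]).symm
  let B : ∀ n, Ell (Fin d → ℕ) X := fun n => ∑ w : Fin n → Fin d,
    Ell.single (content n w) ((ρ : ℂ) ^ n • p n fun i => Pi.single (w i) 1)
  have hBn : ∀ n, ‖B n‖ ≤ C * x ^ n := by
    intro n
    have h1 : ∀ w : Fin n → Fin d,
        ‖(Ell.single (content n w) ((ρ : ℂ) ^ n • p n fun i => Pi.single (w i) 1) :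
          Ell (Fin d → ℕ) X)‖ ≤ ρ ^ n * ‖p n‖ := by
      intro w
      rw [Ell.norm_single_apply, norm_smul, norm_pow, Complex.norm_real, Real.norm_of_nonneg hρ.le]
      gcongr
      refine ((p n).le_opNorm _).trans (mul_le_of_le_one_right (norm_nonneg _) ?_)
      exact Finset.prod_le_one (fun _ _ => norm_nonneg _) fun i _ => norm_basis_le_one _
    calc ‖B n‖ ≤ ∑ w : Fin n → Fin d, ρ ^ n * ‖p n‖ :=
          (norm_sum_le _ _).trans (Finset.sum_le_sum fun w _ => h1 w)
      _ = (d : ℝ) ^ n * (ρ ^ n * ‖p n‖) := by simp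
      _ ≤ ((d : ℝ) + 1) ^ n * (ρ ^ n * ‖p n‖) := by gcongr; linarith
      _ = (‖p n‖ * r₀ ^ n) * x ^ n := by rw [hx, div_pow, mul_pow]; field_simp
      _ ≤ C * x ^ n := by gcongr; exact hpC n
  have hBev : ∀ n (θ : Fin d → ℂ) (hθ : ‖θ‖ ≤ 1),
      evalAt θ hθ (B n) = p n fun _ => (ρ : ℂ) • θ := by
    intro n θ hθ
    have hθs : (ρ : ℂ) • θ = ∑ j, (ρ * θ j : ℂ) • (Pi.single j 1 : Fin d → ℂ) := by
      ext i
      simp [Finset.sum_apply, Pi.single_apply]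
    rw [hθs, ContinuousMultilinearMap.map_sum, map_sum]
    refine Finset.sum_congr rfl fun w _ => ?_
    rw [evalAt_single, hcontent, ContinuousMultilinearMap.map_smul_univ, smul_smul,
      Finset.prod_mul_distrib]
    simp [mul_comm]
  have hsum : Summable fun n => ‖B (n + 1)‖ := by
    refine Summable.of_nonneg_of_le (fun _ => norm_nonneg _) (fun n => hBn (n + 1)) ?_
    have := (summable_geometric_of_lt_one hx0.le (by linarith)).mul_left (C * x)
    refine this.congr fun n => ?_
    ring
  refine ⟨∑' n, B (n + 1), ?_, fun θ hθ => ?_⟩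
  · have h1 : HasSum (fun n => C * x * x ^ n) (C * x * (1 - x)⁻¹) :=
      (hasSum_geometric_of_lt_one hx0.le (by linarith)).mul_left (C * x)
    have h2 : ‖∑' n, B (n + 1)‖ ≤ C * x * (1 - x)⁻¹ :=
      tsum_of_norm_bounded h1 fun n => (hBn (n + 1)).trans_eq (by ring)
    have h3 : (1 - x)⁻¹ ≤ 2 := by
      rw [inv_le_comm₀ (by linarith) (by norm_num)]; linarith
    have h4 : 0 ≤ (1 - x)⁻¹ := inv_nonneg.2 (by linarith)
    calc _ ≤ C * x * (1 - x)⁻¹ := h2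
      _ ≤ ε / 4 * 2 := by gcongr
      _ < ε := by linarith
  · have h1 := (hsum.of_norm.hasSum).mapL (evalAt θ hθ)
    have hmem : (ρ : ℂ) • θ ∈ Metric.eball (0 : Fin d → ℂ) r := by
      rw [Metric.mem_eball, edist_zero_right]
      refine lt_trans ?_ hr
      rw [← ofReal_norm, ← ENNReal.ofReal_coe_nnreal]
      refine (ENNReal.ofReal_lt_ofReal_iff hr₀').2 ?_
      rw [norm_smul, Complex.norm_real, Real.norm_of_nonneg hρ.le]
      exact (mul_le_of_le_one_right hρ.le hθ).trans_lt hρr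
    have h2 := hp.hasSum hmem
    rw [zero_add] at h2
    have h3 := (hasSum_nat_add_iff' 1).2 h2
    have h4 : p 0 (fun _ => (ρ : ℂ) • θ) = 0 := by
      rw [hp.coeff_zero, hq0]
    rw [Finset.sum_range_one, h4, sub_zero] at h3
    rw [← evalAt_apply θ hθ]
    refine h1.unique ?_
    convert h3 using 2 with n
    exact hBev (n + 1) θ hθ

end PowerSeries

noncomputable section Parameterization

variable {X : Type*} [NormedAddCommGroup X] [NormedSpace ℂ X] [CompleteSpace X] {d : ℕ}

/-! ### Formal solutions of the invariance equation -/

omit [NormedSpace ℂ X] [CompleteSpace X] in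
/-- The sum of finitely many families is computed entry by entry. -/
lemma Ell.sum_apply {ι κ : Type*} (s : Finset κ) (f : κ → Ell ι X) (i : ι) :
    (∑ k ∈ s, f k) i = ∑ k ∈ s, f k i := by
  classical
  induction s using Finset.induction_on with
  | empty => simp
  | insert k s hk ih => rw [Finset.sum_insert hk, Finset.sum_insert hk, ← ih]; rfl

/-- The power series `b(t θ)`, where `t θ` is the componentwise product. -/
def rescale (t : Fin d → ℂ) (ht : ‖t‖ ≤ 1) : Ell (Fin d → ℕ) X →L[ℂ] Ell (Fin d → ℕ) X :=
  Ell.diag (fun n => mon t n • ContinuousLinearMap.id ℂ X) 1 (norm_mon_smul_id_le ht)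

omit [CompleteSpace X] in
@[simp]
lemma rescale_apply (t : Fin d → ℂ) (ht : ‖t‖ ≤ 1) (b : Ell (Fin d → ℕ) X) (n : Fin d → ℕ) :
    rescale t ht b n = mon t n • b n := rfl

omit [CompleteSpace X] in
lemma psum_rescale (t : Fin d → ℂ) (ht : ‖t‖ ≤ 1) (b : Ell (Fin d → ℕ) X) (θ : Fin d → ℂ) :
    psum (rescale t ht b) θ = psum b (t * θ) := by
  refine tsum_congr fun n => ?_
  rw [rescale_apply, smul_smul]
  congr 1
  simp [mon, mul_pow, Finset.prod_mul_distrib, mul_comm]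

omit [CompleteSpace X] in
lemma norm_rescale_apply_le (t : Fin d → ℂ) (ht : ‖t‖ ≤ 1) (b : Ell (Fin d → ℕ) X) :
    ‖rescale t ht b‖ ≤ ‖b‖ := by
  refine hasSum_le (fun n => ?_) (Ell.hasSum_norm _) (Ell.hasSum_norm b)
  rw [rescale_apply, norm_smul]
  exact mul_le_of_le_one_left (norm_nonneg _) (norm_mon_le_one ht n)

lemma norm_mul_le_of_norm_le_one {t θ : Fin d → ℂ} (ht : ‖t‖ ≤ 1) : ‖t * θ‖ ≤ ‖θ‖ :=
  (norm_mul_le t θ).trans (mul_le_of_le_one_left (norm_nonneg _) ht)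

omit [CompleteSpace X] in
/-- Halving the variables makes the derivative along the linear flow act on `ℓ¹` coefficients. -/
lemma exists_wt_smul_rescale (lam : Fin d → ℝ) {t : Fin d → ℂ} (ht : ‖t‖ ≤ 1) (ht2 : ‖t‖ ≤ 1 / 2)
    (b : Ell (Fin d → ℕ) X) :
    ∃ c : Ell (Fin d → ℕ) X, ∀ n, c n = (wt lam n : ℂ) • rescale t ht b n := by
  have hbound : ∀ n : Fin d → ℕ, ‖((wt lam n : ℂ) * mon t n) • ContinuousLinearMap.id ℂ X‖ ≤ ‖lam‖ := by
    intro n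
    refine (norm_smul_le ((wt lam n : ℂ) * mon t n) (ContinuousLinearMap.id ℂ X)).trans ?_
    refine (mul_le_of_le_one_right (norm_nonneg _) ContinuousLinearMap.norm_id_le).trans ?_
    rw [norm_mul, Complex.norm_real]
    set k := ∑ j, n j with hk
    have h1 : ‖wt lam n‖ ≤ k * ‖lam‖ := by
      rw [wt, hk, Nat.cast_sum, Finset.sum_mul]
      refine (norm_sum_le _ _).trans (Finset.sum_le_sum fun j _ => ?_)
      rw [norm_mul, Real.norm_of_nonneg (Nat.cast_nonneg _)]
      gcongr
      exact norm_le_pi_norm lam j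
    have h2 : ‖mon t n‖ ≤ (1 / 2) ^ k := (norm_mon_le t n).trans (by gcongr)
    have h3 : (k : ℝ) * (1 / 2) ^ k ≤ 1 := by
      rw [one_div, inv_pow, ← div_eq_mul_inv, div_le_one (by positivity)]
      exact_mod_cast Nat.lt_two_pow_self.le
    calc ‖wt lam n‖ * ‖mon t n‖ ≤ (k * ‖lam‖) * (1 / 2) ^ k := by gcongr
      _ = (k * (1 / 2) ^ k) * ‖lam‖ := by ring
      _ ≤ 1 * ‖lam‖ := by gcongr
      _ = ‖lam‖ := one_mul _
  refine ⟨Ell.diag _ ‖lam‖ hbound b, fun n => ?_⟩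
  rw [Ell.diag_apply, rescale_apply, smul_smul]; rfl

omit [CompleteSpace X] in
lemma psum_zero_right (b : Ell (Fin d → ℕ) X) : psum b 0 = b 0 := by
  rw [psum, tsum_eq_single 0]
  · simp [mon]
  · intro n hn
    obtain ⟨j, hj⟩ := Function.ne_iff.1 hn
    have : mon (0 : Fin d → ℂ) n = 0 :=
      Finset.prod_eq_zero (Finset.mem_univ j) (by simpa using hj)
    rw [this, zero_smul]

lemma clm_psum (R : X →L[ℂ] X) (b : Ell (Fin d → ℕ) X) {θ : Fin d → ℂ} (hθ : ‖θ‖ ≤ 1) :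
    R (psum b θ) = psum (Ell.diag (fun _ => R) ‖R‖ (fun _ => le_rfl) b) θ := by
  rw [psum, R.map_tsum (summable_psum b hθ).of_norm]
  exact tsum_congr fun n => by rw [map_smul, Ell.diag_apply]

/-- A linear equation for a closed operator `L` (with nonempty resolvent set) holds for the sums of
power series iff it holds for their coefficients. -/
lemma forall_coeff_iff {L : X →ₗ.[ℂ] X} {μ : ℂ} {R : X →L[ℂ] X} (hR : IsResolventAt L μ R)
    (b g : Ell (Fin d → ℕ) X) :
    (∀ θ : Fin d → ℂ, ‖θ‖ < 1 → ∃ h : psum b θ ∈ L.domain, L ⟨psum b θ, h⟩ = psum g θ) ↔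
      ∀ n, ∃ h : b n ∈ L.domain, L ⟨b n, h⟩ = g n := by
  have key : ∀ x y : X, (∃ h : x ∈ L.domain, L ⟨x, h⟩ = y) ↔ R (μ • x - y) = x := by
    refine fun x y => ⟨fun ⟨h, e⟩ => ?_, fun h => ?_⟩
    · rw [← e]; exact hR.2 ⟨x, h⟩
    · obtain ⟨h1, h2⟩ := hR.1 (μ • x - y)
      have h3 : x ∈ L.domain := h ▸ h1
      refine ⟨h3, ?_⟩
      have h4 : L ⟨x, h3⟩ = L ⟨R (μ • x - y), h1⟩ := by congr 1; exact Subtype.ext h.symm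
      rw [← h4] at h2
      have h5 : μ • x - L ⟨x, h3⟩ = μ • x - y := by
        conv_rhs => rw [← h2, h]
      exact sub_right_injective h5
  simp only [key]
  set D : Ell (Fin d → ℕ) X →L[ℂ] Ell (Fin d → ℕ) X := Ell.diag (fun _ => R) ‖R‖ (fun _ => le_rfl)
    with hD
  have hev : ∀ θ : Fin d → ℂ, ‖θ‖ ≤ 1 →
      psum (D (μ • b - g) - b) θ = R (μ • psum b θ - psum g θ) - psum b θ := by
    intro θ hθ
    have h1 : psum (D (μ • b - g)) θ = R (psum (μ • b - g) θ) := (clm_psum R _ hθ).symm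
    simp only [← evalAt_apply θ hθ, map_sub, map_smul] at h1 ⊢
    rw [h1]
  constructor
  · intro h n
    have h0 : D (μ • b - g) - b = 0 := eq_zero_of_psum_eq_zero fun θ hθ => by
      rw [hev θ hθ.le, h θ hθ, sub_self]
    have h1 : D (μ • b - g) n = b n := by rw [sub_eq_zero.1 h0]
    exact h1
  · intro h θ hθ
    have h0 : D (μ • b - g) = b := by
      ext n
      exact h n
    rw [← sub_eq_zero, ← hev θ hθ.le, h0, sub_self, ← evalAt_apply θ hθ.le, map_zero]

/-- `b` solves, coefficient by coefficient, the equation `L b + N(b) = Σ_j λ_j θ_j ∂_j b`, and has no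
constant term and first order coefficients `v`. -/
structure IsFormalSolution (L : X →ₗ.[ℂ] X) (lam : Fin d → ℝ)
    (N : Ell (Fin d → ℕ) X → Ell (Fin d → ℕ) X) (v : Fin d → X) (b : Ell (Fin d → ℕ) X) : Prop where
  coeff_zero : b 0 = 0
  coeff_single : ∀ j, b (Pi.single j 1) = v j
  coeff_eq : ∀ n, ∃ h : b n ∈ L.domain, L ⟨b n, h⟩ = (wt lam n : ℂ) • b n - N b n

lemma eq_zero_or_eq_single_or_two_le (n : Fin d → ℕ) :
    n = 0 ∨ (∃ j, n = Pi.single j 1) ∨ 2 ≤ ∑ j, n j := by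
  rcases Nat.lt_or_ge (∑ j, n j) 2 with h | h
  · by_cases h0 : n = 0
    · exact Or.inl h0
    · obtain ⟨j, hj⟩ := Function.ne_iff.1 h0
      refine Or.inr (Or.inl ⟨j, ?_⟩)
      have hj' : n j ≠ 0 := hj
      have h1 := Finset.add_sum_erase Finset.univ n (Finset.mem_univ j)
      have h2 : ∑ i ∈ Finset.univ.erase j, n i = 0 := by omega
      ext i
      rcases eq_or_ne i j with rfl | hi
      · simp; omega
      · rw [Pi.single_eq_of_ne hi]
        exact Finset.sum_eq_zero_iff.1 h2 i (by simp [hi])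
  · exact Or.inr (Or.inr h)

lemma wt_single (lam : Fin d → ℝ) (j : Fin d) : wt lam (Pi.single j 1) = lam j := by
  rw [wt, Finset.sum_eq_single j] <;> simp +contextual

lemma wt_pos {lam : Fin d → ℝ} (hlam : ∀ j, 0 < lam j) {n : Fin d → ℕ} (hn : 2 ≤ ∑ j, n j) :
    0 < wt lam n := by
  obtain ⟨j, hj⟩ : ∃ j, n j ≠ 0 := by
    by_contra! h
    simp [h] at hn
  refine Finset.sum_pos' (fun i _ => mul_nonneg (Nat.cast_nonneg _) (hlam i).le)
    ⟨j, Finset.mem_univ j, mul_pos (by exact_mod_cast Nat.pos_of_ne_zero hj) (hlam j)⟩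

section Nonlinearity

variable {G : X → X} {x₀ : X} {r : ℝ} {N : Ell (Fin d → ℕ) X → Ell (Fin d → ℕ) X}

/-- The nonlinear part contributes nothing to the coefficients of degree at most `1`. -/
lemma nonlinear_coeff (hG : AnalyticAt ℂ G x₀)
    (hN : ∀ u, ‖u‖ < r → ∀ θ, ‖θ‖ ≤ 1 →
      psum (N u) θ = G (x₀ + psum u θ) - G x₀ - fderiv ℂ G x₀ (psum u θ))
    {b : Ell (Fin d → ℕ) X} (hb : ‖b‖ < r) (hb0 : b 0 = 0) :
    N b 0 = 0 ∧ ∀ j, N b (Pi.single j 1) = 0 := by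
  have hz : psum b 0 = 0 := by rw [psum_zero_right, hb0]
  constructor
  · rw [← psum_zero_right, hN b hb 0 (by simp), hz]; simp
  · intro j
    rw [← fderiv_psum_zero]
    have h1 : HasFDerivAt (psum b) (fderiv ℂ (psum b) 0) 0 :=
      (analyticOnNhd_psum b 0 (by simp)).differentiableAt.hasFDerivAt
    have h2 : HasFDerivAt G (fderiv ℂ G x₀) (x₀ + psum b 0) := by
      rw [hz, add_zero]; exact hG.differentiableAt.hasFDerivAt
    have h3 : HasFDerivAt (fun θ => G (x₀ + psum b θ) - G x₀ - fderiv ℂ G x₀ (psum b θ))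
        ((fderiv ℂ G x₀).comp (fderiv ℂ (psum b) 0) - (fderiv ℂ G x₀).comp (fderiv ℂ (psum b) 0))
        0 :=
      ((h2.comp 0 (h1.const_add x₀)).sub_const (G x₀)).sub
        ((fderiv ℂ G x₀).hasFDerivAt.comp 0 h1)
    have h4 : HasFDerivAt (psum (N b))
        ((fderiv ℂ G x₀).comp (fderiv ℂ (psum b) 0) - (fderiv ℂ G x₀).comp (fderiv ℂ (psum b) 0))
        0 := by
      refine h3.congr_of_eventuallyEq ?_
      filter_upwards [Metric.ball_mem_nhds (0 : Fin d → ℂ) one_pos] with θ hθ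
      exact hN b hb θ (by simpa using (mem_ball_zero_iff.1 hθ).le)
    rw [h4.fderiv, sub_self, zero_apply]

/-- Formal solutions are the solutions of a fixed point equation in `ℓ¹`: invert `⟨n, λ⟩ - L` in the
coefficients of degree at least `2`. -/
lemma isFormalSolution_iff (hG : AnalyticAt ℂ G x₀)
    (hN : ∀ u, ‖u‖ < r → ∀ θ, ‖θ‖ ≤ 1 →
      psum (N u) θ = G (x₀ + psum u θ) - G x₀ - fderiv ℂ G x₀ (psum u θ))
    {L : X →ₗ.[ℂ] X} {lam : Fin d → ℝ} {R : (Fin d → ℕ) → X →L[ℂ] X}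
    (hR : ∀ n, 2 ≤ ∑ j, n j → IsResolventAt L (wt lam n : ℂ) (R n))
    {v : Fin d → X} (hv : ∀ j, ∃ h : v j ∈ L.domain, L ⟨v j, h⟩ = (lam j : ℂ) • v j)
    {b : Ell (Fin d → ℕ) X} (hb : ‖b‖ < r) :
    IsFormalSolution L lam N v b ↔ b 0 = 0 ∧ (∀ j, b (Pi.single j 1) = v j) ∧
      ∀ n, 2 ≤ ∑ j, n j → b n = R n (N b n) := by
  constructor
  · refine fun h => ⟨h.coeff_zero, h.coeff_single, fun n hn => ?_⟩
    obtain ⟨h1, h2⟩ := h.coeff_eq n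
    have h3 := (hR n hn).2 ⟨b n, h1⟩
    rw [h2, sub_sub_cancel] at h3
    exact h3.symm
  · rintro ⟨h0, h1, h2⟩
    refine ⟨h0, h1, fun n => ?_⟩
    obtain ⟨hN0, hN1⟩ := nonlinear_coeff hG hN hb h0
    rcases eq_zero_or_eq_single_or_two_le n with rfl | ⟨j, rfl⟩ | hn
    · have h3 : b 0 ∈ L.domain := h0 ▸ L.domain.zero_mem
      refine ⟨h3, ?_⟩
      have : (⟨b 0, h3⟩ : L.domain) = 0 := Subtype.ext h0
      rw [this, LinearPMap.map_zero, h0, hN0]; simp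
    · obtain ⟨h3, h4⟩ := hv j
      have h5 : b (Pi.single j 1) ∈ L.domain := h1 j ▸ h3
      refine ⟨h5, ?_⟩
      have : (⟨b (Pi.single j 1), h5⟩ : L.domain) = ⟨v j, h3⟩ := Subtype.ext (h1 j)
      rw [this, h4, hN1, wt_single, h1, sub_zero]
    · obtain ⟨h3, h4⟩ := (hR n hn).1 (N b n)
      have h5 : b n ∈ L.domain := h2 n hn ▸ h3
      refine ⟨h5, ?_⟩
      have : (⟨b n, h5⟩ : L.domain) = ⟨R n (N b n), h3⟩ := Subtype.ext (h2 n hn)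
      rw [this, eq_sub_iff_add_eq, ← eq_sub_iff_add_eq']
      rw [h2 n hn]
      exact h4.symm ▸ rfl

/-- Small formal solutions exist for small first order coefficients in the eigenspaces, and are
unique. -/
theorem exists_isFormalSolution (hG : AnalyticAt ℂ G x₀) (hr : 0 < r) (hN0 : N 0 = 0)
    (hNd : HasStrictFDerivAt N (0 : Ell (Fin d → ℕ) X →L[ℂ] Ell (Fin d → ℕ) X) 0)
    (hN : ∀ u, ‖u‖ < r → ∀ θ, ‖θ‖ ≤ 1 →
      psum (N u) θ = G (x₀ + psum u θ) - G x₀ - fderiv ℂ G x₀ (psum u θ))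
    {L : X →ₗ.[ℂ] X} {lam : Fin d → ℝ} {K : ℝ} (hK : 0 ≤ K)
    (hR : ∀ n : Fin d → ℕ, 2 ≤ ∑ j, n j → ∃ R, IsResolventAt L (wt lam n : ℂ) R ∧ ‖R‖ ≤ K) :
    ∃ ε : ℝ, 0 < ε ∧ ε ≤ r ∧
      (∀ v : Fin d → X, (∀ j, ∃ h : v j ∈ L.domain, L ⟨v j, h⟩ = (lam j : ℂ) • v j) →
        ∀ b b', ‖b‖ < ε → ‖b'‖ < ε → IsFormalSolution L lam N v b → IsFormalSolution L lam N v b' →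
          b = b') ∧
      ∃ δ : ℝ, 0 < δ ∧ ∀ v : Fin d → X,
        (∀ j, ∃ h : v j ∈ L.domain, L ⟨v j, h⟩ = (lam j : ℂ) • v j) → (∀ j, ‖v j‖ ≤ δ) →
          ∃ b, ‖b‖ < ε ∧ IsFormalSolution L lam N v b := by
  choose! R hR hRK using hR
  let S : (Fin d → ℕ) → X →L[ℂ] X := fun n => if 2 ≤ ∑ j, n j then R n else 0
  have hS : ∀ n, ‖S n‖ ≤ K := by
    intro n
    by_cases hn : 2 ≤ ∑ j, n j
    · simp only [S, if_pos hn]; exact hRK n hn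
    · simp only [S, if_neg hn, norm_zero]; exact hK
  let T : Ell (Fin d → ℕ) X →L[ℂ] Ell (Fin d → ℕ) X := Ell.diag S K hS
  let Ψ : Ell (Fin d → ℕ) X → Ell (Fin d → ℕ) X := fun b => b - T (N b)
  have hΨd : HasStrictFDerivAt Ψ
      ((ContinuousLinearEquiv.refl ℂ (Ell (Fin d → ℕ) X) :
        Ell (Fin d → ℕ) X →L[ℂ] Ell (Fin d → ℕ) X)) 0 := by
    have h1 := (hasStrictFDerivAt_id (𝕜 := ℂ) (0 : Ell (Fin d → ℕ) X)).sub
      (T.hasStrictFDerivAt.comp (0 : Ell (Fin d → ℕ) X) hNd)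
    refine h1.congr_fderiv ?_
    rw [ContinuousLinearMap.comp_zero, sub_zero]; rfl
  let e := hΨd.toOpenPartialHomeomorph Ψ
  have hsrc : e.source ∈ 𝓝 (0 : Ell (Fin d → ℕ) X) :=
    e.open_source.mem_nhds hΨd.mem_toOpenPartialHomeomorph_source
  obtain ⟨ε', hε', hball⟩ := Metric.mem_nhds_iff.1 hsrc
  have hinjε : ∀ b b', ‖b‖ < ε' → ‖b'‖ < ε' → Ψ b = Ψ b' → b = b' := fun b b' hb hb' h =>
    e.injOn (hball (by simpa using hb)) (hball (by simpa using hb')) h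
  let ε := min ε' r
  have hε : 0 < ε := lt_min hε' hr
  -- formal solutions are the preimages of first order polynomials
  let ℓ : (Fin d → X) → Ell (Fin d → ℕ) X := fun v => ∑ j, Ell.single (Pi.single j 1) (v j)
  have hsing : ∀ i j : Fin d, (Pi.single i 1 : Fin d → ℕ) = Pi.single j 1 ↔ i = j := by
    refine fun i j => ⟨fun h => ?_, fun h => h ▸ rfl⟩
    by_contra hij
    have := congrFun h i
    simp [hij] at this
  have hℓ0 : ∀ v n, (∀ j, n ≠ Pi.single j 1) → ℓ v n = 0 := by
    intro v n hn
    simp only [ℓ]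
    rw [Ell.sum_apply]
    exact Finset.sum_eq_zero fun j _ => by simp [hn j]
  have hℓ1 : ∀ v j, ℓ v (Pi.single j 1) = v j := by
    intro v j
    simp only [ℓ]
    rw [Ell.sum_apply, Finset.sum_eq_single j]
    · simp
    · intro i _ hi
      have : (Pi.single j 1 : Fin d → ℕ) ≠ Pi.single i 1 := fun h => hi ((hsing j i).1 h).symm
      simp [this]
    · simp
  have hsum1 : ∀ j, ¬ 2 ≤ ∑ i, (Pi.single j 1 : Fin d → ℕ) i := by
    intro j; simp
  have hiff : ∀ v : Fin d → X, (∀ j, ∃ h : v j ∈ L.domain, L ⟨v j, h⟩ = (lam j : ℂ) • v j) →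
      ∀ b, ‖b‖ < ε → (IsFormalSolution L lam N v b ↔ Ψ b = ℓ v) := by
    intro v hv b hb
    rw [isFormalSolution_iff hG hN hR hv (hb.trans_le (min_le_right _ _))]
    have hT : ∀ n, T (N b) n = S n (N b n) := fun n => rfl
    have hΨn : ∀ n, Ψ b n = b n - S n (N b n) := fun n => rfl
    constructor
    · rintro ⟨h0, h1, h2⟩
      ext n
      rw [hΨn]
      rcases eq_zero_or_eq_single_or_two_le n with rfl | ⟨j, rfl⟩ | hn
      · rw [hℓ0 v 0 fun j h => by simpa using congrFun h j, h0]
        simp [S]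
      · rw [hℓ1, h1]
        simp only [S, if_neg (hsum1 j), zero_apply, sub_zero]
      · rw [hℓ0 v n fun j h => hsum1 j (h ▸ hn), h2 n hn]
        simp only [S, if_pos hn]
        exact sub_eq_zero.2 (by rw [← h2 n hn])
    · intro h
      have hn' : ∀ n, b n - S n (N b n) = ℓ v n := fun n => by rw [← hΨn, h]
      refine ⟨?_, fun j => ?_, fun n hn => ?_⟩
      · have := hn' 0
        rw [hℓ0 v 0 fun j h => by simpa using congrFun h j] at this
        simpa [S] using this
      · have := hn' (Pi.single j 1)
        rw [hℓ1] at this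
        simpa only [S, if_neg (hsum1 j), zero_apply, sub_zero] using this
      · have := hn' n
        rw [hℓ0 v n fun j h => hsum1 j (h ▸ hn)] at this
        simp only [S, if_pos hn] at this
        exact sub_eq_zero.1 this
  refine ⟨ε, hε, min_le_right _ _, fun v hv b b' hb hb' h h' => ?_, ?_⟩
  · refine hinjε b b' (hb.trans_le (min_le_left _ _)) (hb'.trans_le (min_le_left _ _)) ?_
    rw [(hiff v hv b hb).1 h, (hiff v hv b' hb').1 h']
  · have hΨ0 : Ψ 0 = 0 := by simp [Ψ, hN0]
    have himg : Ψ '' Metric.ball 0 ε ∈ 𝓝 (0 : Ell (Fin d → ℕ) X) := by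
      have h1 := hΨd.map_nhds_eq_of_equiv
      rw [hΨ0] at h1
      rw [← h1]
      exact image_mem_map (Metric.ball_mem_nhds _ hε)
    obtain ⟨δ', hδ', hδ⟩ := Metric.mem_nhds_iff.1 himg
    refine ⟨δ' / (d + 1), by positivity, fun v hv hvδ => ?_⟩
    have hℓv : ℓ v ∈ Metric.ball 0 δ' := by
      rw [mem_ball_zero_iff]
      have h1 : ‖ℓ v‖ ≤ ∑ j : Fin d, δ' / (d + 1) := by
        refine (norm_sum_le _ _).trans (Finset.sum_le_sum fun j _ => ?_)
        rw [Ell.norm_single_apply]; exact hvδ j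
      refine h1.trans_lt ?_
      rw [Finset.sum_const, Finset.card_univ, Fintype.card_fin, nsmul_eq_mul, mul_div_assoc',
        div_lt_iff₀ (by positivity)]
      nlinarith
    obtain ⟨b, hb, hbv⟩ := hδ hℓv
    rw [mem_ball_zero_iff] at hb
    exact ⟨b, hb, (hiff v hv b hb).2 hbv⟩

end Nonlinearity

end Parameterization

noncomputable section Solutions

variable {X : Type*} [NormedAddCommGroup X] [NormedSpace ℂ X] [CompleteSpace X] {d : ℕ}

/-! ### Solutions of the invariance equation -/

lemma polydisk_eq_ball (d : ℕ) : polydisk d = Metric.ball 0 1 := by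
  ext θ
  rw [mem_ball_zero_iff, pi_norm_lt_iff one_pos]
  rfl

/-- Germs at `0` of solutions of the invariance equation, with first order coefficients `v`. -/
structure IsLocalSolution (A : X →ₗ.[ℂ] X) (G : X → X) (x₀ : X) (lam : Fin d → ℝ) (v : Fin d → X)
    (Q : (Fin d → ℂ) → X) : Prop where
  analytic : AnalyticAt ℂ Q 0
  map_zero : Q 0 = x₀
  deriv_zero : ∀ j, fderiv ℂ Q 0 (Pi.single j 1) = v j
  invariance : ∀ᶠ θ in 𝓝 0, ∃ h : Q θ ∈ A.domain,
    A ⟨Q θ, h⟩ + G (Q θ) = fderiv ℂ Q θ (fun j => (lam j : ℂ) * θ j)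

omit [CompleteSpace X] in
lemma SolvesInvarianceEq.isLocalSolution {A : X →ₗ.[ℂ] X} {G : X → X} {x₀ : X} {lam : Fin d → ℝ}
    {ξ : Fin d → X} {s : Fin d → ℝ} {P : (Fin d → ℂ) → X}
    (h : SolvesInvarianceEq A G x₀ lam ξ s P) :
    IsLocalSolution A G x₀ lam (fun j => (s j : ℂ) • ξ j) P where
  analytic := h.analytic 0 (by simp [polydisk_eq_ball])
  map_zero := h.map_zero
  deriv_zero := h.deriv_zero
  invariance := by
    filter_upwards [Metric.ball_mem_nhds (0 : Fin d → ℂ) one_pos] with θ hθ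
    exact h.invariance θ (by rwa [polydisk_eq_ball])

omit [CompleteSpace X] in
/-- At an equilibrium the invariance equation is an equation for the linearization and the nonlinear
part of `G`. -/
lemma invariance_iff {A : X →ₗ.[ℂ] X} {G : X → X} {x₀ : X} (hx₀ : x₀ ∈ A.domain)
    (hF : A ⟨x₀, hx₀⟩ + G x₀ = 0) (x y : X) :
    (∃ h : x₀ + x ∈ A.domain, A ⟨x₀ + x, h⟩ + G (x₀ + x) = y) ↔
      ∃ h : x ∈ (linearization A G x₀).domain, linearization A G x₀ ⟨x, h⟩ =
        y - (G (x₀ + x) - G x₀ - fderiv ℂ G x₀ x) := by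
  have hdom : x₀ + x ∈ A.domain ↔ x ∈ A.domain := A.domain.add_mem_iff_right hx₀
  have hadd : ∀ (h : x₀ + x ∈ A.domain) (h' : x ∈ A.domain),
      A ⟨x₀ + x, h⟩ = A ⟨x₀, hx₀⟩ + A ⟨x, h'⟩ := fun h h' => LinearPMap.map_add A ⟨x₀, hx₀⟩ ⟨x, h'⟩
  have hlin : ∀ h : x ∈ A.domain, linearization A G x₀ ⟨x, h⟩ = fderiv ℂ G x₀ x + A ⟨x, h⟩ :=
    fun h => rfl
  constructor
  · rintro ⟨h, rfl⟩
    refine ⟨hdom.1 h, ?_⟩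
    rw [hlin (hdom.1 h), hadd h (hdom.1 h), eq_neg_of_add_eq_zero_left hF]
    abel
  · rintro ⟨h, e⟩
    refine ⟨hdom.2 h, ?_⟩
    rw [hlin h] at e
    rw [hadd (hdom.2 h) h, eq_neg_of_add_eq_zero_left hF, eq_sub_of_add_eq' e]
    abel

section

variable {A : X →ₗ.[ℂ] X} {G : X → X} {x₀ : X} {r : ℝ}
  {N : Ell (Fin d → ℕ) X → Ell (Fin d → ℕ) X} {lam : Fin d → ℝ}

/-- A formal solution, with its variables halved or shrunk further, defines a solution on the
polydisk. -/
theorem IsFormalSolution.solves (hx₀ : x₀ ∈ A.domain) (hF : A ⟨x₀, hx₀⟩ + G x₀ = 0)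
    (hN : ∀ u, ‖u‖ < r → ∀ θ, ‖θ‖ ≤ 1 →
      psum (N u) θ = G (x₀ + psum u θ) - G x₀ - fderiv ℂ G x₀ (psum u θ))
    {μ : ℂ} {R : X →L[ℂ] X} (hR : IsResolventAt (linearization A G x₀) μ R)
    {ξ : Fin d → X} {δ : ℝ} {b : Ell (Fin d → ℕ) X} (hb : ‖b‖ < r)
    (h : IsFormalSolution (linearization A G x₀) lam N (fun j => (δ : ℂ) • ξ j) b)
    {t : Fin d → ℝ} {t' : Fin d → ℂ} (htt' : ∀ j, t' j = t j) (ht : ‖t'‖ ≤ 1)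
    (ht2 : ‖t'‖ ≤ 1 / 2) :
    SolvesInvarianceEq A G x₀ lam ξ (fun j => t j * δ) fun θ => x₀ + psum (rescale t' ht b) θ := by
  obtain ⟨c, hc⟩ := exists_wt_smul_rescale lam ht ht2 b
  have hcoeff : ∀ n, ∃ h : rescale t' ht b n ∈ (linearization A G x₀).domain,
      linearization A G x₀ ⟨rescale t' ht b n, h⟩ = (c - rescale t' ht (N b)) n := by
    intro n
    obtain ⟨h1, h2⟩ := h.coeff_eq n
    refine ⟨Submodule.smul_mem _ _ h1, ?_⟩
    have h3 : linearization A G x₀ ⟨mon t' n • b n, Submodule.smul_mem _ _ h1⟩ =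
        mon t' n • linearization A G x₀ ⟨b n, h1⟩ := LinearPMap.map_smul _ _ ⟨b n, h1⟩
    change linearization A G x₀ ⟨mon t' n • b n, Submodule.smul_mem _ _ h1⟩ =
      c n - mon t' n • N b n
    rw [h3, h2, smul_sub, hc n, rescale_apply, smul_comm]
  refine ⟨?_, ?_, fun j => ?_, fun θ hθ => ?_⟩
  · rw [polydisk_eq_ball]
    exact analyticOnNhd_const.add (analyticOnNhd_psum _)
  · rw [psum_zero_right, rescale_apply, h.coeff_zero, smul_zero, add_zero]
  · rw [fderiv_const_add, fderiv_psum_zero, rescale_apply, h.coeff_single, smul_smul]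
    congr 1
    have : mon t' (Pi.single j 1) = t' j := by
      rw [mon, Finset.prod_eq_single j] <;> simp +contextual
    rw [this, htt']; push_cast; ring
  · rw [polydisk_eq_ball, mem_ball_zero_iff] at hθ
    rw [fderiv_const_add, fderiv_psum_flow lam hc hθ, invariance_iff hx₀ hF]
    obtain ⟨h1, h2⟩ := (forall_coeff_iff hR _ _).2 hcoeff θ hθ
    refine ⟨h1, ?_⟩
    rw [h2, ← evalAt_apply θ hθ.le, map_sub, evalAt_apply, evalAt_apply, psum_rescale t' ht (N b),
      hN b hb _ ((norm_mul_le_of_norm_le_one ht).trans hθ.le), psum_rescale]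

/-- Conversely, solutions near `0` have power series that are formal solutions, small if the
variables are shrunk. -/
theorem IsLocalSolution.exists_isFormalSolution (hx₀ : x₀ ∈ A.domain)
    (hF : A ⟨x₀, hx₀⟩ + G x₀ = 0)
    (hN : ∀ u, ‖u‖ < r → ∀ θ, ‖θ‖ ≤ 1 →
      psum (N u) θ = G (x₀ + psum u θ) - G x₀ - fderiv ℂ G x₀ (psum u θ))
    {μ : ℂ} {R : X →L[ℂ] X} (hR : IsResolventAt (linearization A G x₀) μ R)
    {v : Fin d → X} {Q : (Fin d → ℂ) → X} (hQ : IsLocalSolution A G x₀ lam v Q)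
    {ε : ℝ} (hε : 0 < ε) (hεr : ε ≤ r) :
    ∃ ρ₀ : ℝ, 0 < ρ₀ ∧ ∀ ρ : ℝ, 0 < ρ → ρ ≤ ρ₀ → ∃ b : Ell (Fin d → ℕ) X, ‖b‖ < ε ∧
      IsFormalSolution (linearization A G x₀) lam N (fun j => (ρ : ℂ) • v j) b ∧
      ∀ θ : Fin d → ℂ, ‖θ‖ ≤ 1 → Q ((ρ : ℂ) • θ) = x₀ + psum b θ := by
  have hq : AnalyticAt ℂ (fun θ => Q θ - x₀) 0 := hQ.analytic.sub analyticAt_const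
  obtain ⟨ρ₁, hρ₁, hexp⟩ := exists_psum_eq hq (by simp [hQ.map_zero]) hε
  obtain ⟨ρ₂, hρ₂, heq⟩ := Metric.eventually_nhds_iff_ball.1
    (hQ.invariance.and hQ.analytic.eventually_analyticAt)
  refine ⟨min ρ₁ ρ₂ / 2, by positivity, fun ρ hρ hρ₀ => ?_⟩
  have hρ2 : 2 * ρ ≤ min ρ₁ ρ₂ := by linarith
  obtain ⟨b₁, hb₁, hbQ⟩ := hexp (2 * ρ) (by positivity) (hρ2.trans (min_le_left _ _))
  -- half of the polydisk on which the series converges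
  set t : Fin d → ℂ := fun _ => 1 / 2 with ht_def
  have ht2 : ‖t‖ ≤ 1 / 2 := (pi_norm_le_iff_of_nonneg (by norm_num)).2 fun _ => by simp [ht_def]
  have ht : ‖t‖ ≤ 1 := ht2.trans (by norm_num)
  set b := rescale t ht b₁ with hb_def
  obtain ⟨c, hc⟩ := exists_wt_smul_rescale lam ht ht2 b₁
  have hb : ‖b‖ < ε := (norm_rescale_apply_le t ht b₁).trans_lt hb₁
  have hbQ' : ∀ θ : Fin d → ℂ, ‖θ‖ ≤ 1 → psum b θ = Q ((ρ : ℂ) • θ) - x₀ := by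
    intro θ hθ
    rw [hb_def, psum_rescale, hbQ _ ((norm_mul_le_of_norm_le_one ht).trans hθ)]
    congr 2
    ext j
    simp [ht_def]
    ring
  have hder : ∀ θ : Fin d → ℂ, ‖θ‖ < 1 → ∀ w,
      fderiv ℂ (psum b) θ w = fderiv ℂ Q ((ρ : ℂ) • θ) ((ρ : ℂ) • w) := by
    intro θ hθ w
    have hmem : (ρ : ℂ) • θ ∈ Metric.ball (0 : Fin d → ℂ) ρ₂ := by
      rw [mem_ball_zero_iff, norm_smul, Complex.norm_real, Real.norm_of_nonneg hρ.le]
      have : 2 * ρ ≤ ρ₂ := hρ2.trans (min_le_right _ _)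
      nlinarith [norm_nonneg θ]
    have h1 : HasFDerivAt Q (fderiv ℂ Q ((ρ : ℂ) • θ)) ((ρ : ℂ) • θ) :=
      (heq _ hmem).2.differentiableAt.hasFDerivAt
    have h2 : HasFDerivAt (fun θ : Fin d → ℂ => (ρ : ℂ) • θ)
        ((ρ : ℂ) • ContinuousLinearMap.id ℂ (Fin d → ℂ)) θ := (hasFDerivAt_id θ).const_smul (ρ : ℂ)
    have h3 : HasFDerivAt (psum b)
        ((fderiv ℂ Q ((ρ : ℂ) • θ)).comp ((ρ : ℂ) • ContinuousLinearMap.id ℂ (Fin d → ℂ))) θ := by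
      refine ((h1.comp θ h2).sub_const x₀).congr_of_eventuallyEq ?_
      filter_upwards [Metric.isOpen_ball.mem_nhds (mem_ball_zero_iff.2 hθ)] with θ' hθ'
      exact hbQ' θ' (mem_ball_zero_iff.1 hθ').le
    rw [h3.fderiv]; rfl
  have hcoeff := (forall_coeff_iff hR b (c - N b)).1 fun θ hθ => by
    have hmem : (ρ : ℂ) • θ ∈ Metric.ball (0 : Fin d → ℂ) ρ₂ := by
      rw [mem_ball_zero_iff, norm_smul, Complex.norm_real, Real.norm_of_nonneg hρ.le]
      have : 2 * ρ ≤ ρ₂ := hρ2.trans (min_le_right _ _)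
      nlinarith [norm_nonneg θ]
    have h1 := (heq _ hmem).1
    have h2 : Q ((ρ : ℂ) • θ) = x₀ + psum b θ := by rw [hbQ' θ hθ.le]; abel
    rw [h2, invariance_iff hx₀ hF] at h1
    obtain ⟨h3, h4⟩ := h1
    refine ⟨h3, h4.trans ?_⟩
    rw [← evalAt_apply θ hθ.le (c - N b), map_sub, evalAt_apply, evalAt_apply,
      hN b (hb.trans_le hεr) θ hθ.le, ← fderiv_psum_flow lam hc hθ, hder θ hθ]
    congr 2
    ext j
    simp [mul_left_comm]
  refine ⟨b, hb, ⟨?_, fun j => ?_, fun n => ?_⟩, fun θ hθ => by rw [hbQ' θ hθ]; abel⟩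
  · rw [← psum_zero_right, hbQ' 0 (by simp), smul_zero, hQ.map_zero, sub_self]
  · rw [← fderiv_psum_zero, hder 0 (by simp), map_smul, smul_zero, hQ.deriv_zero]
  · obtain ⟨h1, h2⟩ := hcoeff n
    refine ⟨h1, h2.trans ?_⟩
    change c n - N b n = _
    rw [hc n]

end

/-- The sum of the conjugated power series. -/
lemma exists_psum_conj (σ : X →SL[starRingEnd ℂ] X) (b : Ell (Fin d → ℕ) X) :
    ∃ b' : Ell (Fin d → ℕ) X, (∀ n, b' n = σ (b n)) ∧ ∀ θ : Fin d → ℂ, ‖θ‖ ≤ 1 →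
      psum b' θ = σ (psum b fun j => starRingEnd ℂ (θ j)) := by
  have hs : Summable fun n => ‖σ (b n)‖ :=
    Summable.of_nonneg_of_le (fun _ => norm_nonneg _) (fun n => σ.le_opNorm (b n))
      ((Ell.hasSum_norm b).summable.mul_left _)
  refine ⟨⟨fun n => σ (b n), Ell.memℓp_one hs⟩, fun n => rfl, fun θ hθ => ?_⟩
  have hθ' : ‖fun j => starRingEnd ℂ (θ j)‖ ≤ 1 :=
    (pi_norm_le_iff_of_nonneg zero_le_one).2 fun j => by
      simpa using (norm_le_pi_norm θ j).trans hθ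
  rw [psum, psum, σ.map_tsum (summable_psum b hθ').of_norm]
  refine tsum_congr fun n => ?_
  rw [σ.map_smulₛₗ]
  congr 1
  simp [mon]

/-- The reflection of a solution in a real structure is a solution. -/
theorem SolvesInvarianceEq.conj {A : X →ₗ.[ℂ] X} {G : X → X} {x₀ : X} {lam : Fin d → ℝ}
    {ξ : Fin d → X} {s : Fin d → ℝ} {b c : Ell (Fin d → ℕ) X}
    (hc : ∀ n, c n = (wt lam n : ℂ) • b n)
    (h : SolvesInvarianceEq A G x₀ lam ξ s fun θ => x₀ + psum b θ)
    {σ : X →SL[starRingEnd ℂ] X} (hσ : IsRealStructure A G x₀ ξ σ) {b' : Ell (Fin d → ℕ) X}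
    (hb' : ∀ n, b' n = σ (b n))
    (hb'p : ∀ θ : Fin d → ℂ, ‖θ‖ ≤ 1 → psum b' θ = σ (psum b fun j => starRingEnd ℂ (θ j))) :
    IsLocalSolution A G x₀ lam (fun j => (s j : ℂ) • ξ j) fun θ => x₀ + psum b' θ := by
  obtain ⟨c', hc', hc'p⟩ := exists_psum_conj σ c
  have hb0 : b 0 = 0 := by
    have := h.map_zero
    rwa [psum_zero_right, add_eq_left] at this
  refine ⟨analyticAt_const.add (analyticOnNhd_psum b' 0 (by simp)), ?_, fun j => ?_, ?_⟩
  · rw [psum_zero_right, hb', hb0, σ.map_zero, add_zero]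
  · have := h.deriv_zero j
    rw [fderiv_const_add, fderiv_psum_zero] at this
    rw [fderiv_const_add, fderiv_psum_zero, hb', this, σ.map_smulₛₗ, hσ.map_eigenvector,
      Complex.conj_ofReal]
  · let conj : (Fin d → ℂ) → Fin d → ℂ := fun θ j => starRingEnd ℂ (θ j)
    have hconj : Continuous conj := continuous_pi fun j => Complex.continuous_conj.comp (continuous_apply j)
    have hconj0 : conj 0 = 0 := by ext j; simp [conj]
    have hconj1 : ∀ θ, ‖θ‖ < 1 → ‖conj θ‖ < 1 := fun θ hθ =>
      (pi_norm_lt_iff one_pos).2 fun j => by simpa [conj] using (norm_le_pi_norm θ j).trans_lt hθ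
    have hcont : Tendsto (fun θ => x₀ + psum b (conj θ)) (𝓝 0) (𝓝 x₀) := by
      have h1 : ContinuousAt (fun θ => x₀ + psum b θ) (conj 0) := by
        rw [hconj0]
        exact (h.analytic 0 (by simp [polydisk_eq_ball])).continuousAt
      have h2 := (ContinuousAt.comp (f := conj) h1 hconj.continuousAt).tendsto
      simpa [Function.comp_def, hconj0, psum_zero_right, hb0] using h2
    filter_upwards [hcont.eventually hσ.map_nonlinearity,
      Metric.ball_mem_nhds (0 : Fin d → ℂ) one_pos] with θ hθG hθ
    rw [mem_ball_zero_iff] at hθ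
    have hval : x₀ + psum b' θ = σ (x₀ + psum b (conj θ)) := by
      rw [hb'p θ hθ.le, σ.map_add, hσ.map_equilibrium]
    obtain ⟨h1, h2⟩ := h.invariance (conj θ) (by
      rw [polydisk_eq_ball, mem_ball_zero_iff]; exact hconj1 θ hθ)
    obtain ⟨h3, h4⟩ := hσ.map_op ⟨_, h1⟩
    rw [fderiv_const_add, fderiv_psum_flow lam hc (hconj1 θ hθ)] at h2
    rw [fderiv_const_add, fderiv_psum_flow lam (c := c') (fun n => by
      rw [hc', hc, hb', σ.map_smulₛₗ, Complex.conj_ofReal]) hθ, hc'p θ hθ.le]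
    rw [show σ (psum c fun j => starRingEnd ℂ (θ j)) = σ (psum c (conj θ)) from rfl, ← h2, σ.map_add, ← h4, ← hθG]
    have h5 : x₀ + psum b' θ ∈ A.domain := hval ▸ h3
    refine ⟨h5, ?_⟩
    congr 2
    exact Subtype.ext hval

end Solutions

noncomputable section Existence

variable {X : Type*} [NormedAddCommGroup X] [NormedSpace ℂ X] [CompleteSpace X] {d : ℕ}

/-- Non-resonance and sectoriality bound the resolvents at all the points `⟨n, λ⟩` with `|n| ≥ 2`:
almost all of them are far out, and none is an eigenvalue. -/
lemma exists_resolvent_wt {A : X →ₗ.[ℂ] X} (hA : IsSectorial A) (hAc : HasCompactResolvent A)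
    (B : X →L[ℂ] X) {lam : Fin d → ℝ} (hlam : ∀ j, 0 < lam j)
    (hunst : ∀ z : ℂ, IsEigenvalue ((B : X →ₗ[ℂ] X) +ᵥ A) z → 0 < z.re → ∃ j, (lam j : ℂ) = z)
    (hres : NonResonant fun j => (lam j : ℂ)) :
    ∃ K : ℝ, 0 ≤ K ∧ ∀ n : Fin d → ℕ, 2 ≤ ∑ j, n j →
      ∃ R, IsResolventAt ((B : X →ₗ[ℂ] X) +ᵥ A) (wt lam n : ℂ) R ∧ ‖R‖ ≤ K := by
  obtain ⟨ρ, C, hρ, hC, hfar⟩ := hA.exists_resolvent_far B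
  set s : Set (Fin d → ℕ) := {n | 2 ≤ ∑ j, n j ∧ wt lam n < ρ} with hs
  have hfin : s.Finite := by
    refine (Set.finite_Iic (fun j => ⌈ρ / lam j⌉₊)).subset fun n hn j => ?_
    have h1 : (n j : ℝ) * lam j ≤ wt lam n :=
      Finset.single_le_sum (f := fun j => (n j : ℝ) * lam j)
        (fun i _ => mul_nonneg (Nat.cast_nonneg _) (hlam i).le) (Finset.mem_univ j)
    have h2 : (n j : ℝ) ≤ ρ / lam j := by
      rw [le_div_iff₀ (hlam j)]; exact h1.trans hn.2.le
    exact_mod_cast h2.trans (Nat.le_ceil _)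
  obtain ⟨C', hC', hnear⟩ := exists_resolvent_bound_of_isCompact
    (L := (B : X →ₗ[ℂ] X) +ᵥ A) (hfin.image fun n => (wt lam n : ℂ)).isCompact (by
      rintro _ ⟨n, hn, rfl⟩
      refine exists_resolvent_of_not_isEigenvalue hAc B fun he => ?_
      obtain ⟨j, hj⟩ := hunst _ he (by simpa using wt_pos hlam hn.1)
      refine hres n hn.1 j ?_
      beta_reduce at hj ⊢
      rw [hj, wt]; push_cast; rfl)
  refine ⟨max (C / ρ) C', by positivity, fun n hn => ?_⟩
  rcases lt_or_ge (wt lam n) ρ with h | h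
  · obtain ⟨R, hR, hRC⟩ := hnear _ ⟨n, ⟨hn, h⟩, rfl⟩
    exact ⟨R, hR, hRC.trans (le_max_right _ _)⟩
  · have hnorm : ‖(wt lam n : ℂ)‖ = wt lam n := by
      rw [Complex.norm_real, Real.norm_of_nonneg (hρ.le.trans h)]
    obtain ⟨R, hR, hRC⟩ := hfar (wt lam n) (by simpa using hρ.le.trans h) (by rwa [hnorm])
    refine ⟨R, hR, hRC.trans (le_trans ?_ (le_max_left _ _))⟩
    rw [hnorm]; gcongr

/-- Existence, uniqueness and reality of the solutions of the invariance equation. They all arise from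
one of them, `P₁`, by rescaling the variables. -/
theorem exists_solvesInvarianceEq {A : X →ₗ.[ℂ] X} (hA : IsSectorial A)
    (hAc : HasCompactResolvent A) {G : X → X} {x₀ : X} (hG : AnalyticAt ℂ G x₀)
    (hx₀ : x₀ ∈ A.domain) (hF : A ⟨x₀, hx₀⟩ + G x₀ = 0) {lam : Fin d → ℝ} (hlam : ∀ j, 0 < lam j)
    (hunst : ∀ z : ℂ, IsEigenvalue (linearization A G x₀) z → 0 < z.re → ∃ j, (lam j : ℂ) = z)
    (hres : NonResonant fun j => (lam j : ℂ)) {ξ : Fin d → X} (hnorm : ∀ j, ‖ξ j‖ = 1)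
    (hξ : ∀ j, ∃ h : ξ j ∈ (linearization A G x₀).domain,
      linearization A G x₀ ⟨ξ j, h⟩ = (lam j : ℂ) • ξ j) :
    ∃ (δ : ℝ) (P₁ : (Fin d → ℂ) → X), 0 < δ ∧ SolvesInvarianceEq A G x₀ lam ξ (fun _ => δ) P₁ ∧
      ∀ s : Fin d → ℝ, (∀ j, |s j| ≤ δ) → ∃ P : (Fin d → ℂ) → X,
        (∀ θ, P θ = P₁ fun j => ((s j / δ : ℝ) : ℂ) * θ j) ∧ SolvesInvarianceEq A G x₀ lam ξ s P ∧
        (∀ Q, SolvesInvarianceEq A G x₀ lam ξ s Q → EqOn Q P (polydisk d)) ∧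
        ∀ σ : X →SL[starRingEnd ℂ] X, IsRealStructure A G x₀ ξ σ →
          ∀ θ ∈ polydisk d, P (fun j => starRingEnd ℂ (θ j)) = σ (P θ) := by
  obtain ⟨r, N, hr, hN0, hNd, hN⟩ := exists_nonlinear_extension hG d
  obtain ⟨K, hK, hRK⟩ := exists_resolvent_wt hA hAc (fderiv ℂ G x₀) hlam hunst hres
  obtain ⟨ε, hε, hεr, huniq, δ₀, hδ₀, hex⟩ := exists_isFormalSolution hG hr hN0 hNd hN hK hRK
  obtain ⟨ρ, _, hρ, -, hfar⟩ := hA.exists_resolvent_far (fderiv ℂ G x₀)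
  obtain ⟨R, hR, -⟩ := hfar ρ (by simpa using hρ.le) (by simp [abs_of_pos hρ])
  have heig : ∀ c : Fin d → ℂ, ∀ j, ∃ h : c j • ξ j ∈ (linearization A G x₀).domain,
      linearization A G x₀ ⟨c j • ξ j, h⟩ = (lam j : ℂ) • c j • ξ j := by
    intro c j
    obtain ⟨h1, h2⟩ := hξ j
    refine ⟨Submodule.smul_mem _ _ h1, ?_⟩
    have h3 : linearization A G x₀ ⟨c j • ξ j, Submodule.smul_mem _ _ h1⟩ =
      c j • linearization A G x₀ ⟨ξ j, h1⟩ := LinearPMap.map_smul _ _ ⟨ξ j, h1⟩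
    rw [h3, h2, smul_comm]
  -- solutions with the same first order coefficients have the same germ at `0`
  have hloc : ∀ (s : Fin d → ℝ) (Q Q' : (Fin d → ℂ) → X),
      IsLocalSolution A G x₀ lam (fun j => (s j : ℂ) • ξ j) Q →
      IsLocalSolution A G x₀ lam (fun j => (s j : ℂ) • ξ j) Q' → Q =ᶠ[𝓝 0] Q' := by
    intro s Q Q' hQ hQ'
    obtain ⟨ρ₁, hρ₁, h₁⟩ := hQ.exists_isFormalSolution hx₀ hF hN hR hε hεr
    obtain ⟨ρ₂, hρ₂, h₂⟩ := hQ'.exists_isFormalSolution hx₀ hF hN hR hε hεr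
    obtain ⟨ρ, hρ, hρ1, hρ2⟩ : ∃ ρ : ℝ, 0 < ρ ∧ ρ ≤ ρ₁ ∧ ρ ≤ ρ₂ :=
      ⟨min ρ₁ ρ₂, lt_min hρ₁ hρ₂, min_le_left _ _, min_le_right _ _⟩
    obtain ⟨b, hb, hbs, hbQ⟩ := h₁ ρ hρ hρ1
    obtain ⟨b', hb', hbs', hbQ'⟩ := h₂ ρ hρ hρ2
    have hbb : b = b' := by
      refine huniq _ (fun j => ?_) b b' hb hb' hbs hbs'
      have := heig (fun j => (ρ : ℂ) * (s j : ℂ)) j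
      simpa only [mul_smul] using! this
    filter_upwards [Metric.ball_mem_nhds (0 : Fin d → ℂ) hρ] with θ hθ
    rw [mem_ball_zero_iff] at hθ
    have hθ' : θ = (ρ : ℂ) • ((ρ : ℂ)⁻¹ • θ) := by
      rw [smul_inv_smul₀ (by exact_mod_cast hρ.ne')]
    have hle : ‖(ρ : ℂ)⁻¹ • θ‖ ≤ 1 := by
      rw [norm_smul, norm_inv, Complex.norm_real, Real.norm_of_nonneg hρ.le, inv_mul_le_iff₀ hρ]
      linarith
    rw [hθ', hbQ _ hle, hbQ' _ hle, hbb]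
  have hglob : ∀ (s : Fin d → ℝ) (P Q : (Fin d → ℂ) → X), SolvesInvarianceEq A G x₀ lam ξ s P →
      AnalyticOnNhd ℂ Q (polydisk d) →
      IsLocalSolution A G x₀ lam (fun j => (s j : ℂ) • ξ j) Q → EqOn Q P (polydisk d) := by
    intro s P Q hP hQ hQl
    refine hQ.eqOn_of_preconnected_of_eventuallyEq hP.analytic ?_
      (z₀ := 0) (by simp [polydisk_eq_ball]) (hloc s _ _ hQl hP.isLocalSolution)
    rw [polydisk_eq_ball]
    exact (convex_ball _ _).isPreconnected
  obtain ⟨b, hb, hbs⟩ := hex (fun j => (δ₀ : ℂ) • ξ j) (heig fun _ => (δ₀ : ℂ)) fun j => by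
    rw [norm_smul, hnorm, mul_one, Complex.norm_real, Real.norm_of_nonneg hδ₀.le]
  have hbr := hb.trans_le hεr
  have hhalf : ‖(fun _ : Fin d => ((1 / 2 : ℝ) : ℂ))‖ ≤ 1 / 2 :=
    (pi_norm_le_iff_of_nonneg (by norm_num)).2 fun _ => by simp
  refine ⟨δ₀ / 2, fun θ => x₀ + psum (rescale (fun _ => ((1 / 2 : ℝ) : ℂ))
    (hhalf.trans (by norm_num)) b) θ, by positivity, ?_, fun s hs => ?_⟩
  · have := hbs.solves hx₀ hF hN hR hbr (t := fun _ => 1 / 2) (fun _ => rfl)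
      (hhalf.trans (by norm_num)) hhalf
    convert this using 2
    ring
  · set t : Fin d → ℂ := fun j => ((s j / δ₀ : ℝ) : ℂ) with ht_def
    have ht2 : ‖t‖ ≤ 1 / 2 := (pi_norm_le_iff_of_nonneg (by norm_num)).2 fun j => by
      rw [ht_def, Complex.norm_real, norm_div, Real.norm_of_nonneg hδ₀.le, div_le_iff₀ hδ₀]
      have := hs j
      rw [Real.norm_eq_abs]; linarith
    have ht : ‖t‖ ≤ 1 := ht2.trans (by norm_num)
    have hP : SolvesInvarianceEq A G x₀ lam ξ s fun θ => x₀ + psum (rescale t ht b) θ := by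
      have := hbs.solves hx₀ hF hN hR hbr (t := fun j => s j / δ₀) (fun _ => rfl) ht ht2
      convert this using 2
      field_simp
    refine ⟨_, fun θ => ?_, hP, fun Q hQ => hglob s _ Q hP hQ.analytic hQ.isLocalSolution,
      fun σ hσ θ hθ => ?_⟩
    · beta_reduce
      rw [psum_rescale, psum_rescale]
      congr 2
      ext j
      simp only [Pi.mul_apply, ht_def]
      push_cast
      field_simp
    · obtain ⟨c, hc⟩ := exists_wt_smul_rescale lam ht ht2 b
      obtain ⟨b', hb', hb'p⟩ := exists_psum_conj σ (rescale t ht b)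
      have hQ := hP.conj hc hσ hb' hb'p
      have hconj : (fun j => starRingEnd ℂ (θ j)) ∈ polydisk d := fun j => by simpa using hθ j
      have hθn : ‖fun j => starRingEnd ℂ (θ j)‖ ≤ 1 := by
        rw [polydisk_eq_ball, mem_ball_zero_iff] at hconj; exact hconj.le
      have h1 := hglob s _ _ hP (by
        rw [polydisk_eq_ball]
        exact analyticOnNhd_const.add (analyticOnNhd_psum b')) hQ hconj
      have h2 : psum b' (fun j => starRingEnd ℂ (θ j)) = σ (psum (rescale t ht b) θ) := by
        rw [hb'p _ hθn]
        simp
      refine h1.symm.trans ?_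
      rw [h2, σ.map_add, hσ.map_equilibrium]

end Existence

noncomputable section BackwardUniqueness

variable {X : Type*} [NormedAddCommGroup X] [NormedSpace ℂ X] [CompleteSpace X] {d : ℕ}

/-! ### Uniqueness of backward solutions -/

/-- The unstable eigenvalues are removed by a perturbation of finite rank, which moves each `λ_j` to
`-λ_j`; what is left has a stable resolvent. -/
theorem exists_dual_family {A : X →ₗ.[ℂ] X} (hA : IsSectorial A) (hAc : HasCompactResolvent A)
    (B : X →L[ℂ] X) {lam : Fin d → ℝ} (hinj : Function.Injective lam) (hlam : ∀ j, 0 < lam j)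
    (hhyp : ∀ z : ℂ, IsEigenvalue ((B : X →ₗ[ℂ] X) +ᵥ A) z → z.re ≠ 0)
    (hunst : ∀ z : ℂ, IsEigenvalue ((B : X →ₗ[ℂ] X) +ᵥ A) z → 0 < z.re → ∃ j, (lam j : ℂ) = z)
    (hsimple : ∀ j, algMultiplicity ((B : X →ₗ[ℂ] X) +ᵥ A) (lam j : ℂ) = 1)
    {ξ : Fin d → X} (hξ0 : ∀ j, ξ j ≠ 0)
    (hξ : ∀ j, ∃ h : ξ j ∈ A.domain, B (ξ j) + A ⟨ξ j, h⟩ = (lam j : ℂ) • ξ j) :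
    ∃ l : Fin d → X →L[ℂ] ℂ, (∀ i j, l i (ξ j) = if i = j then 1 else 0) ∧
      (∀ j (x : A.domain), l j (B x + A x) = lam j * l j x) ∧
      ∃ κ C, 0 < κ ∧ 0 < C ∧ HasStableResolvent
        (((B - ∑ j, (2 * lam j : ℂ) • (l j).smulRight (ξ j) : X →L[ℂ] X) : X →ₗ[ℂ] X) +ᵥ A) κ C := by
  choose hξd hξe using hξ
  choose l hl1 hl2 hl3 using fun j => exists_dual_eigenvector hAc B (hsimple j) (hξ0 j) (hξd j) (hξe j)
  have hdual : ∀ i j, l i (ξ j) = if i = j then 1 else 0 := by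
    intro i j
    rcases eq_or_ne i j with rfl | hij
    · simp [hl1]
    · rw [if_neg hij]
      have h1 := hl2 i ⟨ξ j, hξd j⟩
      rw [hξe j, map_smul, smul_eq_mul] at h1
      have h2 : ((lam j : ℂ) - lam i) * l i (ξ j) = 0 := by rw [sub_mul, h1]; exact sub_self _
      refine (mul_eq_zero.1 h2).resolve_left fun h => hij (hinj ?_)
      exact_mod_cast (sub_eq_zero.1 h).symm
  refine ⟨l, hdual, hl2, exists_hasStableResolvent hA hAc _ fun z hz hez => ?_⟩
  obtain ⟨⟨v, hv⟩, hv0, hve⟩ := hez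
  replace hv : v ∈ A.domain := hv
  have hv0' : v ≠ 0 := fun h => hv0 (Subtype.ext h)
  have hve' : (B - ∑ j, (2 * lam j : ℂ) • (l j).smulRight (ξ j) : X →L[ℂ] X) v + A ⟨v, hv⟩ = z • v := hve
  have hsum : (∑ j, (2 * lam j : ℂ) • (l j).smulRight (ξ j) : X →L[ℂ] X) v =
      ∑ j, (2 * lam j * l j v : ℂ) • ξ j := by
    simp [mul_smul]
  have hve2 : B v + A ⟨v, hv⟩ - ∑ j, (2 * lam j * l j v : ℂ) • ξ j = z • v := by
    rw [← hve', sub_apply, hsum]; abel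
  -- the functionals vanish on such an eigenvector
  have hlv : ∀ i, l i v = 0 := by
    intro i
    have h1 := congrArg (l i) hve2
    rw [map_sub, hl2 i ⟨v, hv⟩, map_sum, map_smul, Finset.sum_eq_single i (fun j _ hj => by
      rw [map_smul, hdual, if_neg hj.symm, smul_zero]) (by simp), map_smul, hl1] at h1
    simp only [smul_eq_mul, mul_one] at h1
    have h2 : (z + lam i) * l i v = 0 := by linear_combination -h1
    refine (mul_eq_zero.1 h2).resolve_left fun h => ?_
    have h3 := congrArg Complex.re h
    simp at h3
    linarith [hlam i]
  have hve3 : B v + A ⟨v, hv⟩ = z • v := by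
    rw [← hve2]; simp [hlv]
  have hez : IsEigenvalue ((B : X →ₗ[ℂ] X) +ᵥ A) z := ⟨⟨v, hv⟩, hv0, hve3⟩
  obtain ⟨j, hj⟩ := hunst z hez (lt_of_le_of_ne hz (hhyp z hez).symm)
  obtain ⟨c, hc⟩ := hl3 j ⟨v, hv⟩ (by rw [hj]; exact hve3)
  have hc' : v = c • ξ j := hc
  have h4 := hlv j
  rw [hc', map_smul, hl1, smul_eq_mul, mul_one] at h4
  exact hv0' (by rw [hc', h4, zero_smul])

omit [CompleteSpace X] in
/-- An unstable mode of a backward solution that vanishes at the final time is bounded by the forcing. -/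
lemma norm_le_of_unstable_mode {lam : ℝ} (hlam : 0 < lam) {φ g : ℝ → ℂ} {M : ℝ}
    (hφ : ∀ t ≤ 0, HasDerivWithinAt φ (lam * φ t + g t) (Iic 0) t) (hφ0 : φ 0 = 0)
    (hg : ∀ t ≤ 0, ‖g t‖ ≤ M) : ∀ t ≤ 0, ‖φ t‖ ≤ M / lam := by
  intro t ht
  have hM : 0 ≤ M := (norm_nonneg _).trans (hg 0 le_rfl)
  -- integrating factor and time reversal
  let ψ : ℝ → ℂ := fun s => (Real.exp (lam * s) : ℂ) * φ (-s)
  have hψ : ∀ s, 0 ≤ s → HasDerivWithinAt ψ (-((Real.exp (lam * s) : ℂ) * g (-s))) (Ici s) s := by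
    intro s hs
    have h1 : HasDerivWithinAt (fun s => φ (-s)) ((-1 : ℝ) • (lam * φ (-s) + g (-s))) (Ici s) s :=
      HasDerivWithinAt.scomp s (hφ (-s) (by linarith)) (hasDerivAt_neg s).hasDerivWithinAt
        fun y (hy : s ≤ y) => show -y ≤ 0 by linarith
    have h2 : HasDerivAt (fun s : ℝ => (Real.exp (lam * s) : ℂ))
        ((Real.exp (lam * s) * (lam * 1) : ℝ) : ℂ) s :=
      (((hasDerivAt_id s).const_mul lam).exp).ofReal_comp
    refine (h2.hasDerivWithinAt.mul h1).congr_deriv ?_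
    rw [Complex.real_smul]
    push_cast; ring
  have hcont : ContinuousOn ψ (Icc 0 (-t)) := by
    intro s hs
    have h1 : ContinuousWithinAt φ (Iic 0) (-s) := (hφ (-s) (by linarith [hs.1])).continuousWithinAt
    have h2 : ContinuousWithinAt (fun s => φ (-s)) (Icc 0 (-t)) s :=
      h1.comp continuous_neg.continuousWithinAt fun y hy => show -y ≤ 0 by linarith [hy.1]
    exact (by fun_prop : Continuous fun s : ℝ => (Real.exp (lam * s) : ℂ)).continuousWithinAt.mul h2
  have hB : ∀ s, HasDerivAt (fun s => M * (Real.exp (lam * s) - 1) / lam) (M * Real.exp (lam * s)) s := by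
    intro s
    have h2 : HasDerivAt (fun s : ℝ => Real.exp (lam * s)) (Real.exp (lam * s) * (lam * 1)) s :=
      ((hasDerivAt_id s).const_mul lam).exp
    refine (((h2.sub_const 1).const_mul M).div_const lam).congr_deriv ?_
    field_simp
  have key := image_norm_le_of_norm_deriv_right_le_deriv_boundary hcont (fun s hs => hψ s hs.1)
    (B := fun s => M * (Real.exp (lam * s) - 1) / lam) (by simp [ψ, hφ0]) hB (fun s hs => by
      rw [norm_neg, norm_mul, Complex.norm_real, Real.norm_of_nonneg (Real.exp_pos _).le, mul_comm]
      gcongr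
      exact hg (-s) (by linarith [hs.1])) (right_mem_Icc.2 (by linarith))
  simp only [ψ, neg_neg] at key
  rw [norm_mul, Complex.norm_real, Real.norm_of_nonneg (Real.exp_pos _).le] at key
  have hpos := Real.exp_pos (lam * -t)
  rw [le_div_iff₀ hlam]
  rw [le_div_iff₀ hlam] at key
  nlinarith

/-- A bounded backward solution of a small perturbation of the linear equation is determined by the
unstable components of its final value. -/
theorem exists_backward_unique {A : X →ₗ.[ℂ] X} {B : X →L[ℂ] X} {lam : Fin d → ℝ}
    (hlam : ∀ j, 0 < lam j) {ξ : Fin d → X} (hnorm : ∀ j, ‖ξ j‖ = 1) {l : Fin d → X →L[ℂ] ℂ}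
    (hl : ∀ j (x : A.domain), l j (B x + A x) = lam j * l j x) {κ C : ℝ} {R : ℂ → X →L[ℂ] X}
    (hR : IsStableResolvent
      (((B - ∑ j, (2 * lam j : ℂ) • (l j).smulRight (ξ j) : X →L[ℂ] X) : X →ₗ[ℂ] X) +ᵥ A) κ C R) :
    ∃ ε : ℝ, 0 < ε ∧ ∀ (w f : ℝ → X) (b : ℝ),
      (∀ t ≤ 0, ∃ h : w t ∈ A.domain, HasDerivWithinAt w (B (w t) + A ⟨w t, h⟩ + f t) (Iic 0) t) →
      (∀ t ≤ 0, ‖w t‖ ≤ b) → (∀ t ≤ 0, ‖f t‖ ≤ ε * ‖w t‖) → (∀ j, l j (w 0) = 0) →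
      w 0 = 0 := by
  set D : ℝ := 1 + ∑ j, 2 * ‖l j‖ with hD
  have hD0 : 0 < D := by positivity
  set S : ℝ := IsStableResolvent.semigroupConst κ C with hS
  have hS0 : 0 ≤ S := hR.semigroupConst_nonneg
  set ε : ℝ := 1 / (2 * (S * D * Real.pi + 1)) with hε
  have hpi := Real.pi_pos
  have hε0 : 0 < ε := by positivity
  refine ⟨ε, hε0, fun w f b hw hwb hf hl0 => ?_⟩
  -- every bound for `w` can be halved
  have hhalf : ∀ b, (∀ t ≤ 0, ‖w t‖ ≤ b) → ∀ t ≤ 0, ‖w t‖ ≤ b / 2 := by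
    intro b hb t₀ ht₀
    have hb0 : 0 ≤ b := (norm_nonneg _).trans (hb 0 le_rfl)
    have hfb : ∀ t ≤ 0, ‖f t‖ ≤ ε * b := fun t ht => (hf t ht).trans (by gcongr; exact hb t ht)
    have hmode : ∀ j, ∀ t ≤ 0, ‖l j (w t)‖ ≤ ‖l j‖ * (ε * b) / lam j := by
      intro j
      refine norm_le_of_unstable_mode (hlam j) (g := fun t => l j (f t)) (fun t ht => ?_) (hl0 j)
        fun t ht => ((l j).le_opNorm _).trans (by gcongr; exact hfb t ht)
      obtain ⟨h1, h2⟩ := hw t ht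
      have h3 := ((l j).restrictScalars ℝ).hasFDerivAt.comp_hasDerivWithinAt t h2
      refine h3.congr_deriv ?_
      change l j (B (w t) + A ⟨w t, h1⟩ + f t) = _
      rw [map_add, hl j ⟨w t, h1⟩]
    let g : ℝ → X := fun t => f t + ∑ j, (2 * lam j * l j (w t) : ℂ) • ξ j
    have hg : ∀ t ≤ 0, ‖g t‖ ≤ ε * b * D := by
      intro t ht
      have h1 : ∀ j, ‖(2 * lam j * l j (w t) : ℂ) • ξ j‖ ≤ 2 * ‖l j‖ * (ε * b) := by
        intro j
        rw [norm_smul, hnorm, mul_one, norm_mul, norm_mul, Complex.norm_real,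
          Real.norm_of_nonneg (hlam j).le, Complex.norm_ofNat]
        have := hmode j t ht
        rw [le_div_iff₀ (hlam j)] at this
        nlinarith
      calc ‖g t‖ ≤ ‖f t‖ + ‖∑ j, (2 * lam j * l j (w t) : ℂ) • ξ j‖ := norm_add_le _ _
        _ ≤ ε * b + ∑ j, 2 * ‖l j‖ * (ε * b) := by
            gcongr
            · exact hfb t ht
            · exact (norm_sum_le _ _).trans (Finset.sum_le_sum fun j _ => h1 j)
        _ = ε * b * D := by rw [hD, ← Finset.sum_mul]; ring
    have key := hR.norm_le_of_backward_solution (w := fun t => w (t + t₀)) (f := fun t => g (t + t₀))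
      (fun t ht => by
        obtain ⟨h1, h2⟩ := hw (t + t₀) (by linarith)
        refine ⟨h1, ?_⟩
        have h3 : HasDerivWithinAt (fun t => w (t + t₀))
            ((1 : ℝ) • (B (w (t + t₀)) + A ⟨w (t + t₀), h1⟩ + f (t + t₀))) (Iic 0) t :=
          HasDerivWithinAt.scomp t h2 ((hasDerivAt_id t).add_const t₀).hasDerivWithinAt
            fun y (hy : y ≤ 0) => show y + t₀ ≤ 0 by linarith
        refine h3.congr_deriv ?_
        change (1 : ℝ) • (B (w (t + t₀)) + A ⟨w (t + t₀), h1⟩ + f (t + t₀)) =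
          ((B - ∑ j, (2 * lam j : ℂ) • (l j).smulRight (ξ j) : X →L[ℂ] X) (w (t + t₀)) +
            A ⟨w (t + t₀), h1⟩) + (f (t + t₀) + ∑ j, (2 * lam j * l j (w (t + t₀)) : ℂ) • ξ j)
        have hsum : (∑ j, (2 * lam j : ℂ) • (l j).smulRight (ξ j) : X →L[ℂ] X) (w (t + t₀)) =
            ∑ j, (2 * lam j * l j (w (t + t₀)) : ℂ) • ξ j := by
          simp [mul_smul]
        rw [sub_apply, hsum, one_smul]
        abel)
      (fun t ht => hb (t + t₀) (by linarith)) (fun t ht => hg (t + t₀) (by linarith))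
    simp only [zero_add] at key
    refine key.trans ?_
    have h1 : ε * (2 * (S * D * Real.pi + 1)) = 1 := by rw [hε]; field_simp
    have h2 : S * (ε * b * D) * Real.pi = (ε * (S * D * Real.pi)) * b := by ring
    rw [← hS, h2]
    have h3 : ε * (S * D * Real.pi) ≤ 1 / 2 := by nlinarith
    calc _ ≤ 1 / 2 * b := by gcongr
      _ = b / 2 := by ring
  have hpow : ∀ n : ℕ, ∀ t ≤ 0, ‖w t‖ ≤ b * (1 / 2) ^ n := by
    intro n
    induction n with
    | zero => simpa using hwb
    | succ n ih =>
      intro t ht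
      have := hhalf _ ih t ht
      rw [pow_succ]; linarith
  have hlim : Tendsto (fun n : ℕ => b * (1 / 2 : ℝ) ^ n) atTop (𝓝 (b * 0)) :=
    (tendsto_pow_atTop_nhds_zero_of_lt_one (by norm_num) (by norm_num)).const_mul b
  rw [mul_zero] at hlim
  exact norm_le_zero_iff.1 (ge_of_tendsto' hlim fun n => hpow n 0 le_rfl)

/-- Near the equilibrium, backward solutions of the nonlinear equation are determined by the unstable
components of their final values. -/
theorem exists_ball_backward_unique {A : X →ₗ.[ℂ] X} {G : X → X} {x₀ : X} (hG : AnalyticAt ℂ G x₀)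
    {lam : Fin d → ℝ} (hlam : ∀ j, 0 < lam j) {ξ : Fin d → X} (hnorm : ∀ j, ‖ξ j‖ = 1)
    {l : Fin d → X →L[ℂ] ℂ}
    (hl : ∀ j (x : A.domain), l j (fderiv ℂ G x₀ x + A x) = lam j * l j x)
    {κ C : ℝ} {R : ℂ → X →L[ℂ] X}
    (hR : IsStableResolvent (((fderiv ℂ G x₀ - ∑ j, (2 * lam j : ℂ) • (l j).smulRight (ξ j) :
      X →L[ℂ] X) : X →ₗ[ℂ] X) +ᵥ A) κ C R) :
    ∃ η : ℝ, 0 < η ∧ ∀ a a' : ℝ → X, IsBackwardSolution A G a → IsBackwardSolution A G a' →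
      (∀ t ≤ 0, a t ∈ Metric.ball x₀ η) → (∀ t ≤ 0, a' t ∈ Metric.ball x₀ η) →
      (∀ j, l j (a 0) = l j (a' 0)) → a 0 = a' 0 := by
  obtain ⟨ε, hε, huniq⟩ := exists_backward_unique hlam hnorm hl hR
  obtain ⟨s, hs, happ⟩ := hG.hasStrictFDerivAt.approximates_deriv_on_nhds (c := ⟨ε, hε.le⟩)
    (Or.inr hε)
  obtain ⟨η, hη, hηs⟩ := Metric.mem_nhds_iff.1 hs
  refine ⟨η, hη, fun a a' ha ha' haη ha'η hl0 => ?_⟩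
  have := huniq (fun t => a t - a' t)
    (fun t => G (a t) - G (a' t) - fderiv ℂ G x₀ (a t - a' t)) (2 * η) (fun t ht => ?_)
    (fun t ht => ?_) (fun t ht => ?_) (fun j => ?_)
  · exact sub_eq_zero.1 this
  · obtain ⟨h1, h2⟩ := ha t ht
    obtain ⟨h3, h4⟩ := ha' t ht
    refine ⟨A.domain.sub_mem h1 h3, (h2.sub h4).congr_deriv ?_⟩
    have h5 : A ⟨a t - a' t, A.domain.sub_mem h1 h3⟩ = A ⟨a t, h1⟩ - A ⟨a' t, h3⟩ :=
      LinearPMap.map_sub A ⟨a t, h1⟩ ⟨a' t, h3⟩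
    rw [h5]; abel
  · have h1 := haη t ht
    have h2 := ha'η t ht
    rw [mem_ball_iff_norm] at h1 h2
    calc ‖a t - a' t‖ = ‖(a t - x₀) - (a' t - x₀)‖ := by congr 1; abel
      _ ≤ ‖a t - x₀‖ + ‖a' t - x₀‖ := norm_sub_le _ _
      _ ≤ 2 * η := by linarith
  · exact happ (a t) (hηs (haη t ht)) (a' t) (hηs (ha'η t ht))
  · rw [map_sub, hl0 j, sub_self]

end BackwardUniqueness

noncomputable section Chart

variable {X : Type*} [NormedAddCommGroup X] [NormedSpace ℂ X] {d : ℕ}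

/-! ### The chart -/

lemma norm_flow_le {lam : Fin d → ℝ} (hlam : ∀ j, 0 < lam j) (θ : Fin d → ℂ) {t : ℝ} (ht : t ≤ 0) :
    ‖fun j => (Real.exp (lam j * t) : ℂ) * θ j‖ ≤ ‖θ‖ :=
  (pi_norm_le_iff_of_nonneg (norm_nonneg θ)).2 fun j => by
    rw [norm_mul, Complex.norm_real, Real.norm_of_nonneg (Real.exp_pos _).le]
    refine (mul_le_of_le_one_left (norm_nonneg _) ?_).trans (norm_le_pi_norm θ j)
    exact Real.exp_le_one_iff.2 (mul_nonpos_of_nonneg_of_nonpos (hlam j).le ht)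

lemma tendsto_flow_atBot {lam : Fin d → ℝ} (hlam : ∀ j, 0 < lam j) (θ : Fin d → ℂ) :
    Tendsto (fun t : ℝ => fun j => (Real.exp (lam j * t) : ℂ) * θ j) atBot (𝓝 0) := by
  refine tendsto_pi_nhds.2 fun j => ?_
  have h1 : Tendsto (fun t : ℝ => Real.exp (lam j * t)) atBot (𝓝 0) :=
    Real.tendsto_exp_atBot.comp (tendsto_id.const_mul_atBot (hlam j))
  have h2 : Tendsto (fun t : ℝ => (Real.exp (lam j * t) : ℂ)) atBot (𝓝 ((0 : ℝ) : ℂ)) :=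
    (Complex.continuous_ofReal.tendsto 0).comp h1
  simpa using h2.mul_const (θ j)

/-- A solution of the invariance equation conjugates the linear flow to the flow of the equation. -/
lemma SolvesInvarianceEq.isBackwardSolution {A : X →ₗ.[ℂ] X} {G : X → X} {x₀ : X}
    {lam : Fin d → ℝ} (hlam : ∀ j, 0 < lam j) {ξ : Fin d → X} {s : Fin d → ℝ} {P : (Fin d → ℂ) → X}
    (hP : SolvesInvarianceEq A G x₀ lam ξ s P) {θ : Fin d → ℂ} (hθ : θ ∈ polydisk d) :
    IsBackwardSolution A G fun t => P fun j => (Real.exp (lam j * t) : ℂ) * θ j := by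
  intro t ht
  have hmem : (fun j => (Real.exp (lam j * t) : ℂ) * θ j) ∈ polydisk d := by
    rw [polydisk_eq_ball, mem_ball_zero_iff] at hθ ⊢
    exact (norm_flow_le hlam θ ht).trans_lt hθ
  obtain ⟨h1, h2⟩ := hP.invariance _ hmem
  refine ⟨h1, ?_⟩
  rw [h2]
  have h3 := ((hP.analytic _ hmem).differentiableAt.hasFDerivAt.restrictScalars ℝ).comp_hasDerivAt t
    (hasDerivAt_flow lam θ t)
  exact h3.hasDerivWithinAt

/-- If the solution `P₁` is sent by linear functionals to a local diffeomorphism and final values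
of backward solutions are determined by these functionals, then sufficiently small rescalings of `P₁`
are charts of local unstable manifolds. -/
theorem exists_isLocalUnstableManifoldChart {A : X →ₗ.[ℂ] X} {G : X → X} {x₀ : X}
    {lam : Fin d → ℝ} (hlam : ∀ j, 0 < lam j) {ξ : Fin d → X} {l : Fin d → X →L[ℂ] ℂ}
    (hdual : ∀ i j, l i (ξ j) = if i = j then 1 else 0) {η : ℝ} (hη : 0 < η)
    (huniq : ∀ a a' : ℝ → X, IsBackwardSolution A G a → IsBackwardSolution A G a' →
      (∀ t ≤ 0, a t ∈ Metric.ball x₀ η) → (∀ t ≤ 0, a' t ∈ Metric.ball x₀ η) →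
      (∀ j, l j (a 0) = l j (a' 0)) → a 0 = a' 0)
    {δ : ℝ} (hδ : 0 < δ) {P₁ : (Fin d → ℂ) → X}
    (hP₁ : SolvesInvarianceEq A G x₀ lam ξ (fun _ => δ) P₁) :
    ∃ δ' : ℝ, 0 < δ' ∧ ∀ (s : Fin d → ℝ) (P : (Fin d → ℂ) → X), (∀ j, |s j| ≤ δ') →
      (∀ j, s j ≠ 0) → (∀ θ, P θ = P₁ fun j => ((s j / δ : ℝ) : ℂ) * θ j) →
      SolvesInvarianceEq A G x₀ lam ξ s P → IsLocalUnstableManifoldChart A G x₀ P := by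
  let g : X → Fin d → ℂ := fun x j => l j (x - x₀)
  have hg : Continuous g := by fun_prop
  let lL : X →L[ℂ] (Fin d → ℂ) := ContinuousLinearMap.pi l
  let Φ : (Fin d → ℂ) → Fin d → ℂ := fun θ => lL (P₁ θ - x₀)
  have hgΦ : ∀ θ, g (P₁ θ) = Φ θ := fun θ => rfl
  have h0mem : (0 : Fin d → ℂ) ∈ polydisk d := by simp [polydisk_eq_ball]
  have hΦan : AnalyticOnNhd ℂ Φ (polydisk d) :=
    lL.comp_analyticOnNhd (hP₁.analytic.sub analyticOnNhd_const)
  have hΦd : ∀ θ ∈ polydisk d, ∀ w, fderiv ℂ Φ θ w = lL (fderiv ℂ P₁ θ w) := by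
    intro θ hθ w
    have h1 : HasFDerivAt Φ (lL.comp (fderiv ℂ P₁ θ)) θ :=
      lL.hasFDerivAt.comp θ ((hP₁.analytic θ hθ).differentiableAt.hasFDerivAt.sub_const x₀)
    rw [h1.fderiv]; rfl
  let E : (Fin d → ℂ) ≃L[ℂ] (Fin d → ℂ) :=
    ContinuousLinearEquiv.smulLeft (Units.mk0 (δ : ℂ) (by exact_mod_cast hδ.ne'))
  have hE : fderiv ℂ Φ 0 = (E : (Fin d → ℂ) →L[ℂ] (Fin d → ℂ)) := by
    refine ContinuousLinearMap.coe_injective (LinearMap.pi_ext fun j c => ?_)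
    change fderiv ℂ Φ 0 (Pi.single j c) = (δ : ℂ) • (Pi.single j c : Fin d → ℂ)
    have h1 : (Pi.single j c : Fin d → ℂ) = c • Pi.single j 1 := by
      rw [← Pi.single_smul, smul_eq_mul, mul_one]
    rw [h1, map_smul, hΦd 0 h0mem, hP₁.deriv_zero, map_smul, smul_comm]
    congr 2
    ext i
    change l i (ξ j) = _
    rw [hdual, Pi.single_apply]
  have hΦs : HasStrictFDerivAt Φ (E : (Fin d → ℂ) →L[ℂ] (Fin d → ℂ)) 0 :=
    hE ▸ (hΦan 0 h0mem).hasStrictFDerivAt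
  let e := hΦs.toOpenPartialHomeomorph Φ
  have heΦ : ∀ θ, e θ = Φ θ := fun θ => rfl
  have hsrc : e.source ∈ 𝓝 (0 : Fin d → ℂ) :=
    e.open_source.mem_nhds hΦs.mem_toOpenPartialHomeomorph_source
  have hinv : ∀ᶠ θ in 𝓝 (0 : Fin d → ℂ), Function.Injective (fderiv ℂ Φ θ) := by
    have h1 : ContinuousAt (fderiv ℂ Φ) 0 := (hΦan 0 h0mem).fderiv.continuousAt
    have h2 := E.nhds
    rw [← hE] at h2
    filter_upwards [h1.eventually_mem h2] with θ hθ
    obtain ⟨E', hE'⟩ := hθ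
    rw [← hE']
    exact E'.injective
  have hV : ∀ᶠ θ in 𝓝 (0 : Fin d → ℂ), P₁ θ ∈ Metric.ball x₀ η := by
    refine (hP₁.analytic 0 h0mem).continuousAt.eventually_mem ?_
    rw [hP₁.map_zero]
    exact Metric.ball_mem_nhds _ hη
  obtain ⟨ρ', hρ', hball'⟩ := Metric.eventually_nhds_iff_ball.1 ((hinv.and hV).and hsrc)
  obtain ⟨ρ, hρ, hρ1, hball⟩ : ∃ ρ : ℝ, 0 < ρ ∧ ρ ≤ 1 ∧ ∀ θ : Fin d → ℂ, ‖θ‖ < ρ →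
      Function.Injective (fderiv ℂ Φ θ) ∧ P₁ θ ∈ Metric.ball x₀ η ∧ θ ∈ e.source :=
    ⟨min ρ' 1, lt_min hρ' one_pos, min_le_right _ _, fun θ hθ => by
      have := hball' θ (mem_ball_zero_iff.2 (hθ.trans_le (min_le_left _ _)))
      exact ⟨this.1.1, this.1.2, this.2⟩⟩
  refine ⟨ρ * δ, by positivity, fun s P hs hs0 hPP₁ hP => ?_⟩
  -- the linear change of variables relating `P` to `P₁`
  have ht0 : ∀ j, ((s j / δ : ℝ) : ℂ) ≠ 0 := fun j => by
    exact_mod_cast div_ne_zero (hs0 j) hδ.ne'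
  let T : (Fin d → ℂ) ≃L[ℂ] (Fin d → ℂ) := ContinuousLinearEquiv.piCongrRight fun j =>
    ContinuousLinearEquiv.smulLeft (Units.mk0 _ (ht0 j))
  have hT : ∀ θ, T θ = fun j => ((s j / δ : ℝ) : ℂ) * θ j := fun θ => rfl
  have hTρ : ∀ θ ∈ polydisk d, ‖T θ‖ < ρ := by
    intro θ hθ
    refine (pi_norm_lt_iff hρ).2 fun j => ?_
    rw [hT, norm_mul, Complex.norm_real, norm_div, Real.norm_of_nonneg hδ.le]
    have h1 : ‖s j‖ / δ ≤ ρ := by rw [div_le_iff₀ hδ]; exact hs j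
    have h2 := hθ j
    have h3 := norm_nonneg (θ j)
    nlinarith
  have hTd : ∀ θ ∈ polydisk d, T θ ∈ polydisk d := fun θ hθ => by
    rw [polydisk_eq_ball, mem_ball_zero_iff]; exact (hTρ θ hθ).trans_le hρ1
  have hPT : ∀ θ, P θ = P₁ (T θ) := fun θ => by rw [hPP₁, hT]
  have hopen : IsOpen (polydisk d) := by rw [polydisk_eq_ball]; exact Metric.isOpen_ball
  have hsub : T '' polydisk d ⊆ e.source := by
    rintro _ ⟨θ, hθ, rfl⟩; exact (hball _ (hTρ θ hθ)).2.2
  have hflow : ∀ θ ∈ polydisk d, ∀ t ≤ (0 : ℝ),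
      (fun j => (Real.exp (lam j * t) : ℂ) * θ j) ∈ polydisk d := fun θ hθ t ht => by
    rw [polydisk_eq_ball, mem_ball_zero_iff] at hθ ⊢
    exact (norm_flow_le hlam θ ht).trans_lt hθ
  refine ⟨fun θ hθ => ?_, ?_, Metric.ball x₀ η ∩ g ⁻¹' (e '' (T '' polydisk d)), ?_, ?_, ?_⟩
  · have hd : ∀ w, fderiv ℂ P θ w = fderiv ℂ P₁ (T θ) (T w) := by
      intro w
      have h1 : HasFDerivAt P ((fderiv ℂ P₁ (T θ)).comp (T : (Fin d → ℂ) →L[ℂ] (Fin d → ℂ))) θ := by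
        have h2 := (hP₁.analytic _ (hTd θ hθ)).differentiableAt.hasFDerivAt.comp θ
          (T : (Fin d → ℂ) →L[ℂ] (Fin d → ℂ)).hasFDerivAt
        exact h2.congr_of_eventuallyEq (Eventually.of_forall hPT)
      rw [h1.fderiv]; rfl
    intro w w' hww
    rw [hd, hd] at hww
    refine T.injective ((hball _ (hTρ θ hθ)).1 ?_)
    rw [hΦd _ (hTd θ hθ), hΦd _ (hTd θ hθ), hww]
  · refine IsEmbedding.of_comp (g := g) ?_ hg ?_
    · exact continuousOn_iff_continuous_domRestrict.1 hP.analytic.continuousOn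
    · let T' : polydisk d → e.source := fun θ => ⟨T θ, hsub ⟨θ, θ.2, rfl⟩⟩
      have hT'c : Continuous T' := by fun_prop
      have hT' : IsEmbedding T' :=
        IsEmbedding.of_comp hT'c continuous_subtype_val
          (T.toHomeomorph.isEmbedding.comp IsEmbedding.subtypeVal)
      have h1 := e.isOpenEmbedding_restrict.isEmbedding.comp hT'
      have h2 : g ∘ (polydisk d).domRestrict P = e.source.domRestrict e ∘ T' := by
        funext θ
        change g (P θ) = Φ (T θ)
        rw [hPT, hgΦ]
      rw [h2]
      exact h1
  · refine Metric.isOpen_ball.inter (IsOpen.preimage hg ?_)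
    exact e.isOpen_image_of_subset_source (T.toHomeomorph.isOpenMap _ hopen) hsub
  · refine ⟨Metric.mem_ball_self hη, T 0, ⟨0, h0mem, rfl⟩, ?_⟩
    rw [heΦ, map_zero, ← hgΦ, hP₁.map_zero]
  · ext x
    constructor
    · rintro ⟨θ, hθ, rfl⟩
      refine ⟨_, hP.isBackwardSolution hlam hθ, by simp, fun t ht => ?_, ?_⟩
      · have h1 := hflow θ hθ t ht
        rw [hPT]
        exact ⟨(hball _ (hTρ _ h1)).2.1, _, ⟨_, h1, rfl⟩, rfl⟩
      · have h1 := (hP.analytic 0 h0mem).continuousAt.tendsto.comp (tendsto_flow_atBot hlam θ)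
        rwa [hP.map_zero] at h1
    · rintro ⟨a, ha, rfl, haU, -⟩
      obtain ⟨-, -, ⟨θ, hθ, rfl⟩, he⟩ := haU 0 le_rfl
      refine ⟨θ, hθ, ?_⟩
      have h1 := huniq a _ ha (hP.isBackwardSolution hlam hθ) (fun t ht => (haU t ht).1)
        (fun t ht => by
          have h1 := hflow θ hθ t ht
          rw [hPT]
          exact (hball _ (hTρ _ h1)).2.1) fun j => by
          have h2 : l j (P₁ (T θ) - x₀) = l j (a 0 - x₀) := congrFun he j
          rw [map_sub, map_sub, sub_left_inj] at h2
          simp [hPT, ← h2]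
      rw [h1]; simp

end Chart
end UnstableChart

theorem mainTheorem1 {X : Type*} [NormedAddCommGroup X] [NormedSpace ℂ X] [CompleteSpace X]
    (A : X →ₗ.[ℂ] X) (hA : UnstableChart.IsSectorial A)
    (hAc : UnstableChart.HasCompactResolvent A)
    (G : X → X) (x₀ : X) (hG : AnalyticAt ℂ G x₀)
    (hx₀ : x₀ ∈ A.domain) (hF : A ⟨x₀, hx₀⟩ + G x₀ = 0)
    (hhyp : ∀ z : ℂ, UnstableChart.IsEigenvalue (UnstableChart.linearization A G x₀) z →
      z.re ≠ 0)
    {d : ℕ} (lam : Fin d → ℝ) (hinj : Function.Injective lam)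
    (hunst : {z : ℂ | UnstableChart.IsEigenvalue (UnstableChart.linearization A G x₀) z ∧
      0 < z.re} = Set.range (fun j => (lam j : ℂ)))
    (hsimple : ∀ j,
      UnstableChart.algMultiplicity (UnstableChart.linearization A G x₀) (lam j : ℂ) = 1)
    (hres : UnstableChart.NonResonant (fun j => (lam j : ℂ)))
    (ξ : Fin d → X) (hnorm : ∀ j, ‖ξ j‖ = 1)
    (hξ : ∀ j, ∃ h : ξ j ∈ (UnstableChart.linearization A G x₀).domain,
      UnstableChart.linearization A G x₀ ⟨ξ j, h⟩ = (lam j : ℂ) • ξ j) :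
    ∃ δ : ℝ, 0 < δ ∧ ∀ s : Fin d → ℝ, (∀ j, |s j| ≤ δ) →
      ∃ P : (Fin d → ℂ) → X,
        UnstableChart.SolvesInvarianceEq A G x₀ lam ξ s P ∧
        (∀ Q : (Fin d → ℂ) → X, UnstableChart.SolvesInvarianceEq A G x₀ lam ξ s Q →
          Set.EqOn Q P (UnstableChart.polydisk d)) ∧
        ((∀ j, s j ≠ 0) → UnstableChart.IsLocalUnstableManifoldChart A G x₀ P) ∧
        (∀ σ : X →SL[starRingEnd ℂ] X, UnstableChart.IsRealStructure A G x₀ ξ σ →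
          ∀ θ ∈ UnstableChart.polydisk d,
            P (fun j => starRingEnd ℂ (θ j)) = σ (P θ)) := by
  have hlam : ∀ j, 0 < lam j := fun j => by
    have h : ((lam j : ℂ)) ∈ Set.range fun j => (lam j : ℂ) := ⟨j, rfl⟩
    rw [← hunst] at h
    simpa using h.2
  have hunst' : ∀ z : ℂ, UnstableChart.IsEigenvalue (UnstableChart.linearization A G x₀) z →
      0 < z.re → ∃ j, (lam j : ℂ) = z := fun z hz hre => by
    have h : z ∈ {z : ℂ | UnstableChart.IsEigenvalue (UnstableChart.linearization A G x₀) z ∧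
      0 < z.re} := ⟨hz, hre⟩
    rwa [hunst] at h
  have hξ0 : ∀ j, ξ j ≠ 0 := fun j h => by simpa [h] using hnorm j
  obtain ⟨δ, P₁, hδ, hP₁, hex⟩ := UnstableChart.exists_solvesInvarianceEq hA hAc hG hx₀ hF hlam
    hunst' hres hnorm hξ
  obtain ⟨l, hdual, hl, κ, C, hκ, hC, hstab⟩ := UnstableChart.exists_dual_family hA hAc
    (fderiv ℂ G x₀) hinj hlam hhyp hunst' hsimple hξ0 hξ
  obtain ⟨R, hR⟩ := hstab.exists_isStableResolvent hκ hC
  obtain ⟨η, hη, huniq⟩ := UnstableChart.exists_ball_backward_unique hG hlam hnorm hl hR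
  obtain ⟨δ', hδ', hchart⟩ := UnstableChart.exists_isLocalUnstableManifoldChart hlam hdual hη huniq
    hδ hP₁
  refine ⟨min δ δ', lt_min hδ hδ', fun s hs => ?_⟩
  obtain ⟨P, hPP₁, hP, hPu, hPσ⟩ := hex s fun j => (hs j).trans (min_le_left _ _)
  exact ⟨P, hP, hPu, fun hs0 => hchart s P (fun j => (hs j).trans (min_le_right _ _)) hs0 hPP₁ hP,
    hPσ⟩
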